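/- **Theorem.** Let $\Sigma$ be a connected 2-dimensional conformal manifold, possibly non-orientable and possibly with boundary, with interior $\Sigma^\circ$. Let $\pi:\widehat\Sigma\to\Sigma$ be its orientation double (pairs of a point and a local orientation, the two orientations being identified at each boundary point), which is a Riemann surface. Let $L\to\widehat\Sigma$ be a holomorphic vector bundle such that $V\mapsto(\Omega^{0,\bullet}_c(V,L),\bar\partial)$ is a precosheaf of DG Lie algebras, and let $\alpha$ be a 2-cocycle on each $\Omega^{0,\bullet}_c(V,L)$. Assume that over every coordinate chart $\xi:W\to\mathbb C$ of $\widehat\Sigma$ a holomorphic trivialisation $L|_W\cong W\times\mathfrak a_\xi$ is given, with $\mathfrak a_\xi$ finite-dimensional, together with an isomorphism $\mathfrak a\to\mathfrak a_\xi$, $\mathsf a\mapsto\mathsf a_\xi$, from a fixed vector space $\mathfrak a$. For $U\subset\Sigma$ open let $$\mathcal L^\Sigma_\alpha(U)=\Omega^{0,\bullet}_c(\pi^{-1}(U),L)\oplus\mathbb C\mathbf 1,$$ with $\mathbf 1$ a cocycle of degree $1$; this is the pointed DG vector space (DG vector space with a distinguished map from $\mathbb C$ to its $1$-cocycles) that underlies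 the central extension of $\Omega^{0,\bullet}_c(\pi^{-1}(U),L)$ by $\alpha$. For $W\subset\mathbb C$ bounded and open let $W^c=\mathbb{CP}^1\setminus W$, and let $\mathcal O_\infty(W^c)$ be the space of germs at $W^c$ of holomorphic functions vanishing at $\infty$. For $\omega\in\Omega^{0,1}_c(W)$ put $\omega^\downarrow(\lambda)=\frac1{2\pi i}\int_W\frac{d\mu\wedge\omega}{\mu-\lambda}$. Choose a basis of $\mathcal O_\infty(W^c)$, for each basis element a representative $f$, holomorphic on an open neighbourhood $\Delta_f$ of $W^c$, and a smooth function $\rho_f$ with compact support in $W$ that equals $1$ on a neighbourhood of $\mathbb{CP}^1\setminus\Delta_f$; let $\lceil\cdot\rceil:\mathcal O_\infty(W^c)\to\Omega^{0,1}_c(W)$ be the linear map with $\lceil f\rceil=-f\,\bar\partial\rho_f$ on basis elements. Let $U\subset\Sigma^\circ$ be open and connected, and let $\pi^{-1}(U)=\bigsqcup_{j=1}^mW_j$, $m\in\{1,2\}$, with $W_j$ open and connected and with holomorphic coordinates $\xi_j:W_j\to\mathbb C$ whose images $\xi_j(W_j)$ are bounded. Put $$\mathcal L_{\mathcal O}=\bigoplus_{j=1}^m\mathfrak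 a\otimes\mathcal O_\infty(\xi_j(W_j)^c)\oplus\mathbb C,$$ and regard $\mathcal L_{\mathcal O}[-1]$, which is concentrated in degree $1$, as pointed by the summand $\mathbb C$. Then, for all choices made in the definition of $\lceil\cdot\rceil$ for the sets $\xi_j(W_j)$, the formulas $$i\big((\mathsf a_j\otimes[f_j])_j\big)=\sum_j(\mathsf a_j)_{\xi_j}\otimes\xi_j^*\lceil f_j\rceil,\qquad i(a)=a\mathbf 1,$$ $$p\Big(\sum_j(\mathsf a_j)_{\xi_j}\otimes\omega_j\Big)=\Big(\mathsf a_j\otimes\big[((\xi_j^{-1})^*\omega_j)^\downarrow\big]\Big)_j,\qquad p(a\mathbf 1)=a,$$ $$h\Big(\sum_j(\mathsf a_j)_{\xi_j}\otimes\omega_j\Big)=\sum_j(\mathsf a_j)_{\xi_j}\otimes\xi_j^*\Big((\xi_j^{-1})^*\omega_j-\big\lceil((\xi_j^{-1})^*\omega_j)^\downarrow\big\rceil\Big)^\downarrow,\qquad h(a\mathbf 1)=0,$$ for $\mathsf a_j\in\mathfrak a$, $\omega_j\in\Omega^{0,1}_c(W_j)$, $[f_j]\in\mathcal O_\infty(\xi_j(W_j)^c)$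 and $a\in\mathbb C$, with $p=h=0$ on elements of degree $0$, define morphisms $i:\mathcal L_{\mathcal O}[-1]\to\mathcal L^\Sigma_\alpha(U)$ and $p:\mathcal L^\Sigma_\alpha(U)\to\mathcal L_{\mathcal O}[-1]$ of pointed DG vector spaces and a linear map $h:\mathcal L^\Sigma_\alpha(U)\to\mathcal L^\Sigma_\alpha(U)$ of degree $-1$ that form a strong deformation retract: $$p\,i=\mathrm{id},\qquad i\,p-\mathrm{id}=-(\bar\partial h+h\bar\partial),\qquad p\,h=0,\quad h\,i=0,\quad h\,h=0.$$ In particular $H^0(\mathcal L^\Sigma_\alpha(U))=0$, and $p$ induces an isomorphism $H^1(\mathcal L^\Sigma_\alpha(U))\cong\mathcal L_{\mathcal O}$. -/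

import Mathlib

open Set Filter Topology Bundle CategoryTheory
open scoped Manifold ContDiff ComplexConjugate TensorProduct

universe u

noncomputable section

namespace CFT

/-! ## Conformal surfaces -/

/-- The closed upper half-plane, the local model of surfaces with boundary. -/
abbrev HalfPlane : Type := {z : ℂ // 0 ≤ z.im}

/-- `f` is holomorphic at `x`: near `x` it is the restriction of a function that is holomorphic on
a neighbourhood of `x` in `ℂ`. -/
def HolAt (f : HalfPlane → ℂ) (x : HalfPlane) : Prop :=
  ∃ F : ℂ → ℂ, AnalyticAt ℂ F x ∧ ∀ᶠ y : HalfPlane in 𝓝 x, f y = F y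

/-- `f` is antiholomorphic at `x`. -/
def AntiHolAt (f : HalfPlane → ℂ) (x : HalfPlane) : Prop :=
  HolAt (fun y => conj (f y)) x

theorem analyticAt_conj_conj {F : ℂ → ℂ} {x : ℂ} (h : AnalyticAt ℂ F (conj x)) :
    AnalyticAt ℂ (fun z => conj (F (conj z))) x := by
  rw [Complex.analyticAt_iff_eventually_differentiableAt] at h ⊢
  have hc : Tendsto (fun z : ℂ => conj z) (𝓝 x) (𝓝 (conj x)) :=
    Complex.continuous_conj.continuousAt
  filter_upwards [hc.eventually h] with z hz
  have := hz.conj_conj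
  simpa [Function.comp_def] using this

theorem HolAt.continuousAt {f : HalfPlane → HalfPlane} {x : HalfPlane}
    (h : HolAt (fun y => (f y : ℂ)) x) : ContinuousAt f x := by
  obtain ⟨F, hF, hfF⟩ := h
  refine (⟨rfl⟩ : IsInducing (Subtype.val : HalfPlane → ℂ)).continuousAt_iff.2 ?_
  have h1 : ContinuousAt (fun y : HalfPlane => F y) x :=
    ContinuousAt.comp (f := fun y : HalfPlane => (y : ℂ)) hF.continuousAt
      continuous_subtype_val.continuousAt
  exact h1.congr (hfF.mono fun y hy => hy.symm)

theorem AntiHolAt.continuousAt {f : HalfPlane → HalfPlane} {x : HalfPlane}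
    (h : AntiHolAt (fun y => (f y : ℂ)) x) : ContinuousAt f x := by
  obtain ⟨F, hF, hfF⟩ := h
  refine (⟨rfl⟩ : IsInducing (Subtype.val : HalfPlane → ℂ)).continuousAt_iff.2 ?_
  have h1 : ContinuousAt (fun y : HalfPlane => conj (F y)) x :=
    Complex.continuous_conj.continuousAt.comp
      (ContinuousAt.comp (f := fun y : HalfPlane => (y : ℂ)) hF.continuousAt
      continuous_subtype_val.continuousAt)
  refine h1.congr (hfF.mono fun y hy => ?_)
  simp only [Function.comp_def]
  rw [← hy, Complex.conj_conj]

theorem HolAt.comp {g : HalfPlane → ℂ} {f : HalfPlane → HalfPlane} {x : HalfPlane}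
    (hg : HolAt g (f x)) (hf : HolAt (fun y => (f y : ℂ)) x) : HolAt (fun y => g (f y)) x := by
  have hc := hf.continuousAt
  obtain ⟨F, hF, hfF⟩ := hf
  obtain ⟨G, hG, hgG⟩ := hg
  refine ⟨fun z => G (F z), ?_, ?_⟩
  · refine AnalyticAt.fun_comp ?_ hF
    rw [← hfF.self_of_nhds]; exact hG
  · filter_upwards [hfF, hc.eventually hgG] with y h1 h2
    rw [h2, h1]

theorem HolAt.comp_anti {g : HalfPlane → ℂ} {f : HalfPlane → HalfPlane} {x : HalfPlane}
    (hg : HolAt g (f x)) (hf : AntiHolAt (fun y => (f y : ℂ)) x) :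
    AntiHolAt (fun y => g (f y)) x := by
  have hc := hf.continuousAt
  obtain ⟨F, hF, hfF⟩ := hf
  obtain ⟨G, hG, hgG⟩ := hg
  refine ⟨fun z => conj (G (conj (F z))), ?_, ?_⟩
  · refine AnalyticAt.fun_comp (g := fun z => conj (G (conj z))) ?_ hF
    apply analyticAt_conj_conj
    have := hfF.self_of_nhds
    rw [← this, Complex.conj_conj]; exact hG
  · filter_upwards [hfF, hc.eventually hgG] with y h1 h2
    rw [h2, ← h1, Complex.conj_conj]

theorem AntiHolAt.comp_anti {g : HalfPlane → ℂ} {f : HalfPlane → HalfPlane} {x : HalfPlane}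
    (hg : AntiHolAt g (f x)) (hf : AntiHolAt (fun y => (f y : ℂ)) x) :
    HolAt (fun y => g (f y)) x := by
  have := HolAt.comp_anti (g := fun y => conj (g y)) hg hf
  simpa [AntiHolAt] using this

/-- Conformal maps between open subsets of the half-plane: maps which near each point are
holomorphic or antiholomorphic, and which map boundary points to boundary points and interior
points to interior points. -/
def conformalPregroupoid : Pregroupoid HalfPlane where
  property f s := ∀ x ∈ s, (HolAt (fun y => (f y : ℂ)) x ∨ AntiHolAt (fun y => (f y : ℂ)) x) ∧
    ((f x : ℂ).im = 0 ↔ (x : ℂ).im = 0)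
  comp := by
    intro f g u v hf hg _ _ _ x hx
    obtain ⟨h1, h1'⟩ := hf x hx.1
    obtain ⟨h2, h2'⟩ := hg (f x) hx.2
    refine ⟨?_, h2'.trans h1'⟩
    rcases h1 with h1 | h1 <;> rcases h2 with h2 | h2
    · exact Or.inl (HolAt.comp (g := fun y => (g y : ℂ)) h2 h1)
    · exact Or.inr (HolAt.comp (g := fun y => conj (g y : ℂ)) h2 h1)
    · exact Or.inr (HolAt.comp_anti (g := fun y => (g y : ℂ)) h2 h1)
    · exact Or.inl (AntiHolAt.comp_anti (g := fun y => (g y : ℂ)) h2 h1)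
  id_mem := fun x _ => ⟨Or.inl ⟨id, analyticAt_id, Eventually.of_forall fun _ => rfl⟩, Iff.rfl⟩
  locality := by
    intro f u _ h x hx
    obtain ⟨v, _, hxv, h'⟩ := h x hx
    exact h' x ⟨hx, hxv⟩
  congr := by
    intro f g u hu hfg hf x hx
    have he : ∀ᶠ y in 𝓝 x, g y = f y := by
      filter_upwards [hu.mem_nhds hx] with y hy
      exact hfg y hy
    obtain ⟨h1, h2⟩ := hf x hx
    rw [hfg x hx]
    refine ⟨?_, h2⟩
    rcases h1 with ⟨F, hF, h⟩ | ⟨F, hF, h⟩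
    · refine Or.inl ⟨F, hF, ?_⟩
      filter_upwards [h, he] with y h1 h2
      rw [h2, h1]
    · refine Or.inr ⟨F, hF, ?_⟩
      filter_upwards [h, he] with y h1 h2
      rw [h2, h1]

/-- The conformal structure groupoid. A two-dimensional conformal manifold, possibly with boundary
and possibly non-orientable, is a space with an atlas of charts in `HalfPlane` whose changes of
charts belong to it. -/
def conformalGroupoid : StructureGroupoid HalfPlane := conformalPregroupoid.groupoid

set_option linter.unusedSectionVars false

variable {M : Type u} [TopologicalSpace M] [ChartedSpace HalfPlane M]

/-- The charts `φ` and `ψ` induce the same orientation at `p`: the change of charts is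
holomorphic (and not antiholomorphic) there. -/
def SameOr (φ ψ : OpenPartialHomeomorph M HalfPlane) (p : M) : Prop :=
  HolAt (fun z => (φ (ψ.symm z) : ℂ)) (ψ p)

/-- The charts `φ` and `ψ` induce opposite orientations at `p`. -/
def OppOr (φ ψ : OpenPartialHomeomorph M HalfPlane) (p : M) : Prop :=
  AntiHolAt (fun z => (φ (ψ.symm z) : ℂ)) (ψ p)

/-- `φ` is a chart of the atlas around `p`. -/
def ChartNear (φ : OpenPartialHomeomorph M HalfPlane) (p : M) : Prop :=
  φ ∈ atlas HalfPlane M ∧ p ∈ φ.source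

theorem HolAt.congr {f g : HalfPlane → ℂ} {x : HalfPlane} (h : HolAt f x)
    (he : ∀ᶠ y in 𝓝 x, g y = f y) : HolAt g x := by
  obtain ⟨F, hF, hf⟩ := h
  refine ⟨F, hF, ?_⟩
  filter_upwards [hf, he] with y h1 h2
  rw [h2, h1]

theorem not_antiHolAt_id (x : HalfPlane) : ¬ AntiHolAt (fun y => (y : ℂ)) x := by
  rintro ⟨G, hG, h⟩
  have hd := hG.differentiableAt.hasDerivAt
  -- differentiate along `x + t v` for `v = 1` and `v = I`
  have key : ∀ v : ℂ, 0 ≤ v.im → v * deriv G x = conj v := by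
    intro v hv
    have h1 : HasDerivAt (fun t : ℝ => G (x + t * v)) (v * deriv G x) 0 := by
      have hl : HasDerivAt (fun t : ℝ => (x : ℂ) + t * v) v 0 := by
        have := ((Complex.ofRealCLM.hasDerivAt (x := (0 : ℝ))).mul_const v).const_add (x : ℂ)
        simpa using this
      have hd' : HasDerivAt G (deriv G x) ((x : ℂ) + ((0 : ℝ) : ℂ) * v) := by simpa using hd
      have := hd'.scomp (𝕜 := ℝ) 0 hl
      simpa [Function.comp_def] using this
    have h2 : HasDerivAt (fun t : ℝ => conj (x : ℂ) + t * conj v) (conj v) 0 := by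
      have := ((Complex.ofRealCLM.hasDerivAt (x := (0 : ℝ))).mul_const (conj v)).const_add
        (conj (x : ℂ))
      simpa using this
    have hm : ∀ t : ℝ, 0 ≤ t → 0 ≤ ((x : ℂ) + t * v).im := by
      intro t ht
      have := x.2
      simp only [Complex.add_im, Complex.mul_im, Complex.ofReal_re, Complex.ofReal_im, zero_mul,
        add_zero]
      positivity
    have he : (fun t : ℝ => G (x + t * v)) =ᶠ[𝓝[Ici 0] 0]
        fun t : ℝ => conj (x : ℂ) + t * conj v := by
      have hnb : ∀ᶠ w in 𝓝 (x : ℂ), ∀ hw : 0 ≤ w.im, conj w = G w := by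
        rw [nhds_subtype_eq_comap, eventually_comap] at h
        filter_upwards [h] with w hw hw'
        exact hw ⟨w, hw'⟩ rfl
      have hcont : Tendsto (fun t : ℝ => (x : ℂ) + t * v) (𝓝[Ici 0] 0) (𝓝 (x : ℂ)) := by
        have : Continuous (fun t : ℝ => (x : ℂ) + t * v) := by fun_prop
        have := this.tendsto 0
        simp only [Complex.ofReal_zero, zero_mul, add_zero] at this
        exact this.mono_left nhdsWithin_le_nhds
      filter_upwards [hcont.eventually hnb, self_mem_nhdsWithin] with t ht ht0
      rw [← ht (hm t ht0)]
      simp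
    have hu : UniqueDiffWithinAt ℝ (Ici (0 : ℝ)) 0 := uniqueDiffOn_Ici 0 0 self_mem_Ici
    have h3 := (h2.hasDerivWithinAt (s := Ici 0)).congr_of_eventuallyEq_of_mem he self_mem_Ici
    exact hu.eq_deriv _ h1.hasDerivWithinAt h3
  have k1 := key 1 (by simp)
  have k2 := key Complex.I (by simp)
  simp only [one_mul, map_one] at k1
  rw [k1] at k2
  have := congrArg Complex.im k2
  simp at this
  norm_num at this

theorem transition_eventuallyEq {φ ψ χ : OpenPartialHomeomorph M HalfPlane} {p : M}
    (hψ : p ∈ ψ.source) (hχ : p ∈ χ.source) :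
    ∀ᶠ z in 𝓝 (χ p), φ (χ.symm z) = φ (ψ.symm (ψ (χ.symm z))) := by
  have h1 : ∀ᶠ z in 𝓝 (χ p), χ.symm z ∈ ψ.source := by
    have hc := χ.symm.continuousAt (x := χ p) (by simpa using χ.map_source hχ)
    have hm : ψ.source ∈ 𝓝 (χ.symm (χ p)) := by
      rw [χ.left_inv hχ]; exact ψ.open_source.mem_nhds hψ
    exact hc.eventually_mem hm
  filter_upwards [h1] with z hz
  rw [ψ.left_inv hz]

theorem orient_comp {φ ψ χ : OpenPartialHomeomorph M HalfPlane} {p : M}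
    (hψ : p ∈ ψ.source) (hχ : p ∈ χ.source) :
    (SameOr φ ψ p → SameOr ψ χ p → SameOr φ χ p) ∧
    (SameOr φ ψ p → OppOr ψ χ p → OppOr φ χ p) ∧
    (OppOr φ ψ p → SameOr ψ χ p → OppOr φ χ p) ∧
    (OppOr φ ψ p → OppOr ψ χ p → SameOr φ χ p) := by
  have hp : ψ (χ.symm (χ p)) = ψ p := by rw [χ.left_inv hχ]
  have he := transition_eventuallyEq (φ := φ) hψ hχ
  have he1 := he.mono fun z hz => congrArg (fun w : HalfPlane => (w : ℂ)) hz
  have he2 := he.mono fun z hz => congrArg (fun w : HalfPlane => conj (w : ℂ)) hz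
  unfold SameOr OppOr
  rw [← hp]
  refine ⟨fun h1 h2 => ?_, fun h1 h2 => ?_, fun h1 h2 => ?_, fun h1 h2 => ?_⟩
  · exact (HolAt.comp (f := fun z => ψ (χ.symm z)) h1 h2).congr he1
  · exact HolAt.congr (HolAt.comp_anti (f := fun z => ψ (χ.symm z)) h1 h2) he2
  · exact HolAt.congr (HolAt.comp (f := fun z => ψ (χ.symm z)) h1 h2) he2
  · exact (AntiHolAt.comp_anti (f := fun z => ψ (χ.symm z)) h1 h2).congr he1

theorem transition_mem [HasGroupoid M conformalGroupoid]
    {φ ψ : OpenPartialHomeomorph M HalfPlane} {p : M}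
    (hφ : ChartNear φ p) (hψ : ChartNear ψ p) :
    (SameOr φ ψ p ∨ OppOr φ ψ p) ∧ ((φ p : ℂ).im = 0 ↔ (ψ p : ℂ).im = 0) := by
  have h := HasGroupoid.compatible (G := conformalGroupoid) hψ.1 hφ.1
  have h' := (mem_groupoid_of_pregroupoid.1 h).1 (ψ p) (by
    simp [hψ.2, hφ.2, ψ.left_inv hψ.2])
  simpa [ψ.left_inv hψ.2, conformalPregroupoid, SameOr, OppOr] using h'

theorem not_oppOr_self {φ : OpenPartialHomeomorph M HalfPlane} {p : M} (hφ : p ∈ φ.source) :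
    ¬ OppOr φ φ p := by
  intro h
  refine not_antiHolAt_id (φ p) (HolAt.congr h ?_)
  filter_upwards [φ.open_target.mem_nhds (φ.map_source hφ)] with z hz
  rw [φ.right_inv hz]

theorem oppOr_iff [HasGroupoid M conformalGroupoid]
    {φ ψ : OpenPartialHomeomorph M HalfPlane} {p : M}
    (hφ : ChartNear φ p) (hψ : ChartNear ψ p) : OppOr φ ψ p ↔ ¬ SameOr φ ψ p := by
  constructor
  · intro h1 h2
    rcases (transition_mem hψ hφ).1 with h | h
    · exact not_oppOr_self hψ.2 ((orient_comp hφ.2 hψ.2).2.1 h h1)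
    · exact not_oppOr_self hψ.2 ((orient_comp hφ.2 hψ.2).2.2.1 h h2)
  · intro h
    exact (transition_mem hφ hψ).1.resolve_left h

theorem sameOr_comp_iff [HasGroupoid M conformalGroupoid]
    {φ ψ χ : OpenPartialHomeomorph M HalfPlane} {p : M}
    (hφ : ChartNear φ p) (hψ : ChartNear ψ p) (hχ : ChartNear χ p) :
    (SameOr φ χ p ↔ SameOr ψ χ p) ↔ SameOr φ ψ p := by
  obtain ⟨h1, h2, h3, h4⟩ := orient_comp (φ := φ) hψ.2 hχ.2
  rw [oppOr_iff hψ hχ, oppOr_iff hφ hχ, oppOr_iff hφ hψ] at *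
  tauto

/-! ## The orientation double -/

/-- An orientation of the surface at `p`, given as the set of those charts around `p` that are
positively oriented at `p`. -/
@[ext]
structure PointOrientation (p : M) where
  /-- the positively oriented charts -/
  pos : Set (OpenPartialHomeomorph M HalfPlane)
  near : ∀ φ ∈ pos, ChartNear φ p
  compat : ∀ φ ψ, ChartNear φ p → ChartNear ψ p → ((φ ∈ pos ↔ ψ ∈ pos) ↔ SameOr φ ψ p)

variable (M) in
/-- The orientation bundle, as a set. -/
abbrev OrientationBundle : Type u := Σ p : M, PointOrientation p

variable (M) in
/-- The boundary of the surface. -/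
def boundary : Set M := {p | ((chartAt HalfPlane p p : HalfPlane) : ℂ).im = 0}

variable (M) in
/-- The interior of the surface. -/
def surfaceInterior : Set M := (boundary M)ᶜ

variable (M) in
/-- The relation that identifies the two orientations at each boundary point. -/
def doubleSetoid : Setoid (OrientationBundle M) where
  r a b := a = b ∨ (a.1 = b.1 ∧ a.1 ∈ boundary M)
  iseqv := by
    refine ⟨fun _ => Or.inl rfl, ?_, ?_⟩
    · rintro a b (h | ⟨h, h'⟩)
      · exact Or.inl h.symm
      · exact Or.inr ⟨h.symm, h ▸ h'⟩
    · rintro a b c (rfl | ⟨h, h'⟩) (rfl | ⟨k, k'⟩)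
      · exact Or.inl rfl
      · exact Or.inr ⟨k, k'⟩
      · exact Or.inr ⟨h, h'⟩
      · exact Or.inr ⟨h.trans k, h'⟩

variable (M) in
/-- The orientation double of the surface. -/
def Double : Type u := Quotient (doubleSetoid M)

/-- The projection of the double onto the surface. -/
def Double.proj : Double M → M :=
  Quotient.lift (fun a : OrientationBundle M => a.1) (by
    rintro a b (rfl | ⟨h, _⟩)
    · rfl
    · exact h)

theorem im_eq_zero_of_boundary [HasGroupoid M conformalGroupoid]
    {φ : OpenPartialHomeomorph M HalfPlane} {p : M} (hφ : ChartNear φ p) (hp : p ∈ boundary M) :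
    (φ p : ℂ).im = 0 :=
  (transition_mem hφ ⟨chart_mem_atlas HalfPlane p, mem_chart_source HalfPlane p⟩).2.2 hp

open Classical in
/-- The orientation at `p` for which the chart `φ` is positively oriented if and only if `s`
holds (for `φ` not a chart around `p`, a junk value). -/
def orientBy [HasGroupoid M conformalGroupoid] (φ : OpenPartialHomeomorph M HalfPlane) (p : M)
    (s : Prop) : PointOrientation p where
  pos := {ψ | ChartNear ψ p ∧
    (SameOr ψ (if ChartNear φ p then φ else chartAt HalfPlane p) p ↔ s)}
  near := fun ψ h => h.1
  compat := by
    intro ψ χ hψ hχ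
    have hb : ChartNear (if ChartNear φ p then φ else chartAt HalfPlane p) p := by
      split_ifs with h
      · exact h
      · exact ⟨chart_mem_atlas HalfPlane p, mem_chart_source HalfPlane p⟩
    have := sameOr_comp_iff hψ hχ hb
    simp only [mem_ofPred_eq, hψ, hχ, true_and]
    tauto

theorem mem_orientBy [HasGroupoid M conformalGroupoid] {φ ψ : OpenPartialHomeomorph M HalfPlane}
    {p : M} (hφ : ChartNear φ p) (hψ : ChartNear ψ p) (s : Prop) :
    ψ ∈ (orientBy φ p s).pos ↔ (SameOr ψ φ p ↔ s) := by
  simp [orientBy, hφ, hψ]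

theorem sameOr_self {φ : OpenPartialHomeomorph M HalfPlane} {p : M} (hφ : p ∈ φ.source) :
    SameOr φ φ p := by
  refine HolAt.congr (f := fun z => (z : ℂ))
    ⟨id, analyticAt_id, Eventually.of_forall fun _ => rfl⟩ ?_
  filter_upwards [φ.open_target.mem_nhds (φ.map_source hφ)] with z hz
  rw [φ.right_inv hz]

/-- Folding the complex plane onto the closed upper half-plane. -/
def fold (z : ℂ) : HalfPlane := ⟨⟨z.re, |z.im|⟩, abs_nonneg _⟩

theorem continuous_fold : Continuous fold := by
  refine Continuous.subtype_mk ?_ _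
  have h : (fun z : ℂ => (⟨z.re, |z.im|⟩ : ℂ)) = fun z => (z.re : ℂ) + (|z.im| : ℝ) * Complex.I := by
    funext z
    apply Complex.ext <;> simp
  rw [h]
  fun_prop

theorem fold_of_nonneg {z : ℂ} (h : 0 ≤ z.im) : (fold z : ℂ) = z := by
  apply Complex.ext <;> simp [fold, abs_of_nonneg h]

theorem fold_of_nonpos {z : ℂ} (h : z.im ≤ 0) : (fold z : ℂ) = conj z := by
  apply Complex.ext <;> simp [fold, abs_of_nonpos h]

open Classical in
/-- The chart of the double defined by a chart `φ` of the surface: a point `p` with an orientation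
is sent to `φ p` if `φ` is positively oriented, and to the complex conjugate of `φ p`
otherwise. -/
def doubleChart [HasGroupoid M conformalGroupoid] (φ : OpenPartialHomeomorph M HalfPlane)
    (hφ : φ ∈ atlas HalfPlane M) : PartialEquiv (Double M) ℂ where
  toFun := Quotient.lift
    (fun a : OrientationBundle M => if φ ∈ a.2.pos then (φ a.1 : ℂ) else conj (φ a.1 : ℂ)) (by
      rintro ⟨p, o⟩ ⟨q, o'⟩ (h | ⟨h, h'⟩)
      · rw [h]
      · obtain rfl : p = q := h
        by_cases hp : p ∈ φ.source
        · have him := im_eq_zero_of_boundary ⟨hφ, hp⟩ h'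
          have : conj (φ p : ℂ) = φ p := Complex.conj_eq_iff_im.2 him
          simp [this]
        · have h1 : φ ∉ o.pos := fun h => hp (o.near φ h).2
          have h2 : φ ∉ o'.pos := fun h => hp (o'.near φ h).2
          simp [h1, h2])
  invFun z := Quotient.mk (doubleSetoid M)
    ⟨φ.symm (fold z), orientBy φ (φ.symm (fold z)) (0 ≤ z.im)⟩
  source := Double.proj ⁻¹' φ.source
  target := fold ⁻¹' φ.target
  map_source' := by
    intro a
    induction a using Quotient.inductionOn with
    | h a =>
      intro ha
      change a.1 ∈ φ.source at ha
      have hφa := φ.map_source ha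
      change fold (if φ ∈ a.2.pos then (φ a.1 : ℂ) else conj (φ a.1 : ℂ)) ∈ φ.target
      have : fold (if φ ∈ a.2.pos then (φ a.1 : ℂ) else conj (φ a.1 : ℂ)) = φ a.1 := by
        apply Subtype.ext
        split_ifs
        · exact fold_of_nonneg (φ a.1).2
        · rw [fold_of_nonpos (by simpa using (φ a.1).2), Complex.conj_conj]
      rw [this]; exact hφa
  map_target' := fun z hz => φ.map_target hz
  left_inv' := by
    intro a
    induction a using Quotient.inductionOn with
    | h a =>
      obtain ⟨p, o⟩ := a
      intro ha
      change p ∈ φ.source at ha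
      have hn : ChartNear φ p := ⟨hφ, ha⟩
      change Quotient.mk (doubleSetoid M) ⟨φ.symm (fold (if φ ∈ o.pos then (φ p : ℂ)
        else conj (φ p : ℂ))), orientBy φ (φ.symm (fold (if φ ∈ o.pos then (φ p : ℂ)
        else conj (φ p : ℂ)))) (0 ≤ (if φ ∈ o.pos then (φ p : ℂ) else conj (φ p : ℂ)).im)⟩ = _
      have hf : fold (if φ ∈ o.pos then (φ p : ℂ) else conj (φ p : ℂ)) = φ p := by
        apply Subtype.ext
        split_ifs
        · exact fold_of_nonneg (φ p).2
        · rw [fold_of_nonpos (by simpa using (φ p).2), Complex.conj_conj]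
      rw [hf, φ.left_inv ha]
      apply Quotient.sound
      by_cases hb : p ∈ boundary M
      · exact Or.inr ⟨rfl, hb⟩
      · refine Or.inl ?_
        congr 1
        have him : (φ p : ℂ).im ≠ 0 := fun h => hb
          ((transition_mem hn ⟨chart_mem_atlas HalfPlane p, mem_chart_source HalfPlane p⟩).2.1 h)
        have hpos : 0 < (φ p : ℂ).im := lt_of_le_of_ne (φ p).2 (Ne.symm him)
        have hs : (0 ≤ (if φ ∈ o.pos then (φ p : ℂ) else conj (φ p : ℂ)).im) ↔ φ ∈ o.pos := by
          split_ifs with h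
          · simp [h, hpos.le]
          · simp [h, hpos]
        ext ψ
        by_cases hψ : ChartNear ψ p
        · rw [mem_orientBy hn hψ, hs, ← o.compat ψ φ hψ hn]
          tauto
        · exact ⟨fun h => absurd ((orientBy _ _ _).near ψ h) hψ, fun h => absurd (o.near ψ h) hψ⟩
  right_inv' := by
    intro z hz
    have hs : φ.symm (fold z) ∈ φ.source := φ.map_target hz
    change (if φ ∈ (orientBy φ (φ.symm (fold z)) (0 ≤ z.im)).pos then
      (φ (φ.symm (fold z)) : ℂ) else conj (φ (φ.symm (fold z)) : ℂ)) = z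
    rw [φ.right_inv hz]
    have := mem_orientBy (φ := φ) (ψ := φ) ⟨hφ, hs⟩ ⟨hφ, hs⟩ (0 ≤ z.im)
    simp only [this, sameOr_self hs, true_iff]
    split_ifs with h
    · exact fold_of_nonneg h
    · rw [fold_of_nonpos (not_le.1 h).le, Complex.conj_conj]

/-- Extension of `F` from the upper half-plane by reflection. -/
def reflect (F : ℂ → ℂ) (z : ℂ) : ℂ := if 0 ≤ z.im then F z else conj (F (conj z))

theorem analyticAt_reflect {F : ℂ → ℂ} {z₀ : ℂ} (hF : AnalyticAt ℂ F (fold z₀))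
    (hreal : ∀ᶠ y : HalfPlane in 𝓝 (fold z₀), (y : ℂ).im = 0 → (F y).im = 0) :
    AnalyticAt ℂ (reflect F) z₀ := by
  rcases lt_trichotomy z₀.im 0 with h | h | h
  · rw [fold_of_nonpos h.le] at hF
    refine (analyticAt_conj_conj hF).congr ?_
    filter_upwards [(isOpen_lt Complex.continuous_im continuous_const).mem_nhds h] with z hz
    have hz : z.im < 0 := hz
    simp [reflect, not_le.2 hz]
  · rw [fold_of_nonneg h.ge] at hF
    have hG : AnalyticAt ℂ (fun z => conj (F (conj z))) z₀ := by
      apply analyticAt_conj_conj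
      rwa [Complex.conj_eq_iff_im.2 h]
    have hFG : ∀ᶠ z in 𝓝 z₀, F z = conj (F (conj z)) := by
      refine (hF.frequently_eq_iff_eventually_eq hG).1 ?_
      have hnb : ∀ᶠ w in 𝓝 z₀, w.im = 0 → (F w).im = 0 := by
        rw [nhds_subtype_eq_comap, eventually_comap, fold_of_nonneg h.ge] at hreal
        filter_upwards [hreal] with w hw hw'
        exact hw ⟨w, hw'.ge⟩ rfl hw'
      have hcont : Tendsto (fun t : ℝ => z₀ + (t : ℂ)) (𝓝[≠] 0) (𝓝[≠] z₀) := by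
        refine tendsto_nhdsWithin_of_tendsto_nhds_of_eventually_within _ ?_ ?_
        · have hc : Continuous (fun t : ℝ => z₀ + (t : ℂ)) := by fun_prop
          have := hc.tendsto 0
          simp only [Complex.ofReal_zero, add_zero] at this
          exact this.mono_left nhdsWithin_le_nhds
        · filter_upwards [self_mem_nhdsWithin] with t ht
          simpa using ht
      refine hcont.frequently (Eventually.frequently ?_)
      filter_upwards [(hcont.mono_right nhdsWithin_le_nhds).eventually hnb] with t ht
      have him : (z₀ + (t : ℂ)).im = 0 := by simp [h]
      rw [Complex.conj_eq_iff_im.2 him, Complex.conj_eq_iff_im.2 (ht him)]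
    refine hF.congr ?_
    filter_upwards [hFG] with z hz
    unfold reflect
    split_ifs
    · rfl
    · exact hz
  · rw [fold_of_nonneg h.le] at hF
    refine hF.congr ?_
    filter_upwards [(isOpen_lt continuous_const Complex.continuous_im).mem_nhds h] with z hz
    have hz : 0 < z.im := hz
    simp [reflect, hz.le]

theorem doubleChart_transition_source [HasGroupoid M conformalGroupoid]
    {φ ψ : OpenPartialHomeomorph M HalfPlane}
    (hφ : φ ∈ atlas HalfPlane M) (hψ : ψ ∈ atlas HalfPlane M) :
    ((doubleChart ψ hψ).symm.trans (doubleChart φ hφ)).source = fold ⁻¹' (ψ.symm.trans φ).source :=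
  rfl

theorem HolAt.eventually {f : HalfPlane → ℂ} {x : HalfPlane} (h : HolAt f x) :
    ∀ᶠ y in 𝓝 x, HolAt f y := by
  obtain ⟨F, hF, hf⟩ := h
  have h1 : ∀ᶠ y : HalfPlane in 𝓝 x, AnalyticAt ℂ F y :=
    continuous_subtype_val.continuousAt.eventually hF.eventually_analyticAt
  filter_upwards [h1, hf.eventually_nhds] with y h2 h3
  exact ⟨F, h2, h3⟩

theorem doubleChart_transition_analyticAt [HasGroupoid M conformalGroupoid]
    {φ ψ : OpenPartialHomeomorph M HalfPlane}
    (hφ : φ ∈ atlas HalfPlane M) (hψ : ψ ∈ atlas HalfPlane M) {z₀ : ℂ}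
    (hz₀ : z₀ ∈ ((doubleChart ψ hψ).symm.trans (doubleChart φ hφ)).source) :
    AnalyticAt ℂ ((doubleChart ψ hψ).symm.trans (doubleChart φ hφ)) z₀ := by
  classical
  rw [doubleChart_transition_source] at hz₀
  have hopen : ∀ᶠ x in 𝓝 (fold z₀), x ∈ (ψ.symm.trans φ).source :=
    (ψ.symm.trans φ).open_source.mem_nhds hz₀
  -- properties of a point `x` near `fold z₀`
  have hx : ∀ x ∈ (ψ.symm.trans φ).source, ChartNear φ (ψ.symm x) ∧ ChartNear ψ (ψ.symm x) ∧
      ψ (ψ.symm x) = x := by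
    intro x hx
    simp only [OpenPartialHomeomorph.trans_source, OpenPartialHomeomorph.symm_source,
      mem_inter_iff, mem_preimage] at hx
    exact ⟨⟨hφ, hx.2⟩, ⟨hψ, ψ.map_target hx.1⟩, ψ.right_inv hx.1⟩
  -- the value of the transition map
  have hval : ∀ z, ((doubleChart ψ hψ).symm.trans (doubleChart φ hφ)) z =
      if φ ∈ (orientBy ψ (ψ.symm (fold z)) (0 ≤ z.im)).pos then (φ (ψ.symm (fold z)) : ℂ)
      else conj (φ (ψ.symm (fold z)) : ℂ) := fun z => rfl
  have hval' : ∀ z, fold z ∈ (ψ.symm.trans φ).source →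
      ((doubleChart ψ hψ).symm.trans (doubleChart φ hφ)) z =
      if (HolAt (fun y => (φ (ψ.symm y) : ℂ)) (fold z) ↔ 0 ≤ z.im) then
        (φ (ψ.symm (fold z)) : ℂ) else conj (φ (ψ.symm (fold z)) : ℂ) := by
    intro z hz
    obtain ⟨h1, h2, h3⟩ := hx _ hz
    rw [hval]
    have := mem_orientBy h2 h1 (0 ≤ z.im)
    unfold SameOr at this
    rw [h3] at this
    simp only [this]
  have hreal : ∀ x ∈ (ψ.symm.trans φ).source, (x : ℂ).im = 0 → (φ (ψ.symm x) : ℂ).im = 0 := by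
    intro x hxs h
    obtain ⟨h1, h2, h3⟩ := hx _ hxs
    exact (transition_mem h1 h2).2.2 (by rw [h3]; exact h)
  have hfold : ∀ {P : HalfPlane → Prop}, (∀ᶠ x in 𝓝 (fold z₀), P x) → ∀ᶠ z in 𝓝 z₀, P (fold z) :=
    fun h => continuous_fold.continuousAt.eventually h
  obtain ⟨h1, h2, h3⟩ := hx _ hz₀
  have hcase := (transition_mem h1 h2).1
  unfold SameOr OppOr at hcase
  rw [h3] at hcase
  rcases hcase with hc | hc
  · obtain ⟨F, hF, hfF⟩ := hc
    have hc : HolAt (fun y => (φ (ψ.symm y) : ℂ)) (fold z₀) := ⟨F, hF, hfF⟩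
    refine (analyticAt_reflect (F := F) hF ?_).congr ?_
    · filter_upwards [hfF, hopen] with y hy hy' h0
      rw [← hy]; exact hreal y hy' h0
    · filter_upwards [hfold hfF, hfold hopen, hfold hc.eventually] with z k1 k2 k3
      rw [hval' z k2]
      simp only [k3, true_iff, k1, reflect]
      split_ifs with hz
      · rw [fold_of_nonneg hz]
      · rw [fold_of_nonpos (not_le.1 hz).le]
  · obtain ⟨F, hF, hfF⟩ := hc
    have hc : AntiHolAt (fun y => (φ (ψ.symm y) : ℂ)) (fold z₀) := ⟨F, hF, hfF⟩
    refine (analyticAt_reflect (F := F) hF ?_).congr ?_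
    · filter_upwards [hfF, hopen] with y hy hy' h0
      rw [← hy, Complex.conj_im, hreal y hy' h0, neg_zero]
    · filter_upwards [hfold hfF, hfold hopen, hfold (HolAt.eventually hc)] with z k1 k2 k3
      obtain ⟨m1, m2, m3⟩ := hx _ k2
      have hno : ¬ HolAt (fun y => (φ (ψ.symm y) : ℂ)) (fold z) := by
        have := (oppOr_iff m1 m2)
        unfold SameOr OppOr at this
        rw [m3] at this
        exact this.1 k3
      rw [hval' z k2]
      simp only [hno, false_iff, k1, reflect]
      by_cases hz : 0 ≤ z.im
      · simp only [hz, not_true_eq_false, if_false, if_true]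
        rw [fold_of_nonneg hz]
      · simp only [hz, not_false_eq_true, if_false, if_true]
        rw [← fold_of_nonpos (not_le.1 hz).le, ← k1, Complex.conj_conj]

variable (M) in
/-- The atlas of the double: the topology and the complex structure are those for which all
`doubleChart`s are charts. -/
def doubleCore [HasGroupoid M conformalGroupoid] : ChartedSpaceCore ℂ (Double M) where
  atlas := {e | ∃ φ, ∃ hφ : φ ∈ atlas HalfPlane M, e = doubleChart φ hφ}
  chartAt x := doubleChart (chartAt HalfPlane x.proj) (chart_mem_atlas _ _)
  mem_chart_source x := mem_chart_source HalfPlane x.proj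
  chart_mem_atlas x := ⟨_, _, rfl⟩
  open_source := by
    rintro _ _ ⟨ψ, hψ, rfl⟩ ⟨φ, hφ, rfl⟩
    exact (ψ.symm.trans φ).open_source.preimage continuous_fold
  continuousOn_toFun := by
    rintro _ _ ⟨ψ, hψ, rfl⟩ ⟨φ, hφ, rfl⟩ z hz
    exact (doubleChart_transition_analyticAt hφ hψ hz).continuousAt.continuousWithinAt

instance [HasGroupoid M conformalGroupoid] : TopologicalSpace (Double M) :=
  (doubleCore M).toTopologicalSpace

instance [HasGroupoid M conformalGroupoid] : ChartedSpace ℂ (Double M) :=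
  (doubleCore M).toChartedSpace

instance [HasGroupoid M conformalGroupoid] : IsManifold 𝓘(ℂ, ℂ) ω (Double M) := by
  refine isManifold_of_contDiffOn _ _ _ ?_
  intro e e' he he'
  change e ∈ ⋃ (e : PartialEquiv (Double M) ℂ) (he : e ∈ (doubleCore M).atlas), _ at he
  change e' ∈ ⋃ (e : PartialEquiv (Double M) ℂ) (he : e ∈ (doubleCore M).atlas), _ at he'
  simp only [mem_iUnion, mem_singleton_iff] at he he'
  obtain ⟨_, ⟨ψ, hψ, rfl⟩, rfl⟩ := he
  obtain ⟨_, ⟨φ, hφ, rfl⟩, rfl⟩ := he'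
  intro z hz
  exact (doubleChart_transition_analyticAt hφ hψ hz.1).contDiffAt.contDiffWithinAt

/-! ## The Dolbeault complex with values in a holomorphic vector bundle

Here `X` is a Riemann surface and `L` a holomorphic vector bundle over `X` with model fibre `F`. -/

section Dolbeault

variable {F : Type u} [NormedAddCommGroup F] [NormedSpace ℂ F]

/-- The antilinear part `v ↦ (D v + i D (i v)) / 2` of a real-linear map on `ℂ`. -/
def antilinearPart (D : ℂ →L[ℝ] F) : ℂ →ₛₗ[starRingEnd ℂ] F where
  toFun v := (1 / 2 : ℂ) • (D v + Complex.I • D (Complex.I * v))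
  map_add' v w := by
    simp only [mul_add, map_add, smul_add]
    abel
  map_smul' c v := by
    have h1 : c * v = c.re • v + c.im • (Complex.I * v) := by
      simp only [Complex.real_smul]
      conv_lhs => rw [← Complex.re_add_im c]
      ring
    have h2 : Complex.I * (c * v) = c.re • (Complex.I * v) + (-c.im) • v := by
      simp only [Complex.real_smul]
      conv_lhs => rw [← Complex.re_add_im c]
      push_cast
      linear_combination (c.im * v : ℂ) * Complex.I_mul_I
    have h3 : (starRingEnd ℂ) c = (c.re : ℂ) - c.im * Complex.I := by
      apply Complex.ext <;> simp
    simp only [smul_eq_mul, h2, h3]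
    rw [h1]
    simp only [map_add, map_smul]
    have hr : ∀ (r : ℝ) (y : F), r • y = (r : ℂ) • y := fun r y => (Complex.coe_smul r y).symm
    simp only [hr, smul_add, smul_smul, Complex.ofReal_neg]
    match_scalars
    · ring
    · ring_nf
      simp only [Complex.I_sq]
      ring

theorem antilinearPart_eq (D : ℂ →L[ℝ] F) (v : ℂ) :
    antilinearPart D v = conj v • antilinearPart D 1 := by
  have := (antilinearPart D).map_smulₛₗ v 1
  simpa using this

theorem antilinearPart_comp {G : ℂ → F} {τ : ℂ → ℂ} {z : ℂ} (hτ : DifferentiableAt ℂ τ z)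
    (hG : DifferentiableAt ℝ G (τ z)) (v : ℂ) :
    antilinearPart (fderiv ℝ (fun y => G (τ y)) z) v =
      conj (fderiv ℂ τ z v) • antilinearPart (fderiv ℝ G (τ z)) 1 := by
  have h1 : HasFDerivAt τ ((fderiv ℂ τ z).restrictScalars ℝ) z :=
    hτ.hasFDerivAt.restrictScalars ℝ
  have h2 := (hG.hasFDerivAt.comp z h1).fderiv
  have h3 : fderiv ℝ (fun y => G (τ y)) z =
      (fderiv ℝ G (τ z)).comp ((fderiv ℂ τ z).restrictScalars ℝ) := h2
  rw [← antilinearPart_eq, h3]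
  have hl : fderiv ℂ τ z (Complex.I * v) = Complex.I * fderiv ℂ τ z v := by
    simpa using (fderiv ℂ τ z).map_smul Complex.I v
  simp only [antilinearPart, LinearMap.coe_mk, AddHom.coe_mk, ContinuousLinearMap.comp_apply,
    ContinuousLinearMap.coe_restrictScalars', hl]

theorem antilinearPart_smul {T : ℂ → F →L[ℂ] F} {g : ℂ → F} {z : ℂ} (hT : DifferentiableAt ℂ T z)
    (hg : DifferentiableAt ℝ g z) (v : ℂ) :
    antilinearPart (fderiv ℝ (fun y => T y (g y)) z) v =
      T z (antilinearPart (fderiv ℝ g z) v) := by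
  have h1 : HasFDerivAt T ((fderiv ℂ T z).restrictScalars ℝ) z :=
    hT.hasFDerivAt.restrictScalars ℝ
  have h0 : HasFDerivAt (fun p : (F →L[ℂ] F) × F => p.1 p.2) _ (T z, g z) :=
    ((isBoundedBilinearMap_apply (𝕜 := ℂ) (E := F) (F := F)).hasFDerivAt
      (T z, g z)).restrictScalars ℝ
  have h2 := (h0.comp z (h1.prodMk hg.hasFDerivAt)).fderiv
  have h3 : fderiv ℝ (fun y => T y (g y)) z = _ := h2
  have hl : fderiv ℂ T z (Complex.I * v) = Complex.I • fderiv ℂ T z v := by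
    simpa using (fderiv ℂ T z).map_smul Complex.I v
  have h4 : ∀ w, fderiv ℝ (fun y => T y (g y)) z w =
      T z (fderiv ℝ g z w) + (fderiv ℂ T z w) (g z) := by
    intro w
    rw [h3]
    rfl
  simp only [antilinearPart, LinearMap.coe_mk, AddHom.coe_mk, h4, hl, map_smul, map_add,
    _root_.smul_apply, smul_add, smul_smul]
  match_scalars
  · ring
  · ring_nf
    simp only [Complex.I_sq]
    ring
  · ring

variable {X : Type u} [TopologicalSpace X] [ChartedSpace ℂ X]

/-- The complex derivative at `x` of a complex-valued function. -/
def coordDeriv (φ : X → ℂ) (x : X) : ℂ →L[ℂ] ℂ := mfderiv 𝓘(ℂ, ℂ) 𝓘(ℂ, ℂ) φ x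

/-- The real derivative at `x` of a vector-valued function. -/
def realDeriv (g : X → F) (x : X) : ℂ →L[ℝ] F := mfderiv 𝓘(ℝ, ℂ) 𝓘(ℝ, F) g x

/-- The (topological) support of the section `s` is compact and contained in `V`. -/
def CompactSuppIn {E : X → Type u} [∀ x, Zero (E x)] (V : Set X) (s : ∀ x, E x) : Prop :=
  IsCompact (closure {x | s x ≠ 0}) ∧ closure {x | s x ≠ 0} ⊆ V

theorem CompactSuppIn.mono_supp {E E' : X → Type u} [∀ x, Zero (E x)] [∀ x, Zero (E' x)]
    {V : Set X} {s : ∀ x, E x} {t : ∀ x, E' x} (h : CompactSuppIn V s)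
    (hs : {x | t x ≠ 0} ⊆ closure {x | s x ≠ 0}) : CompactSuppIn V t := by
  have := closure_minimal hs isClosed_closure
  exact ⟨h.1.of_isClosed_subset isClosed_closure this, this.trans h.2⟩

theorem CompactSuppIn.add {E : X → Type u} [∀ x, AddCommGroup (E x)]
    {V : Set X} {s t : ∀ x, E x} (hs : CompactSuppIn V s) (ht : CompactSuppIn V t) :
    CompactSuppIn V (s + t) := by
  have h : closure {x | (s + t) x ≠ 0} ⊆ closure {x | s x ≠ 0} ∪ closure {x | t x ≠ 0} := by
    rw [← closure_union]
    refine closure_mono fun x hx => ?_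
    by_contra hc
    simp only [mem_union, mem_ofPred_eq, not_or, not_not] at hc
    exact hx (by simp [hc.1, hc.2])
  exact ⟨(hs.1.union ht.1).of_isClosed_subset isClosed_closure h,
    h.trans (union_subset hs.2 ht.2)⟩

theorem CompactSuppIn.zero {E : X → Type u} [∀ x, AddCommGroup (E x)] (V : Set X) :
    CompactSuppIn V (0 : ∀ x, E x) := by
  simp [CompactSuppIn]

variable (F) (L : X → Type u) [TopologicalSpace (TotalSpace F L)] [∀ x, AddCommGroup (L x)]
  [∀ x, Module ℂ (L x)] [∀ x, TopologicalSpace (L x)] [FiberBundle F L] [VectorBundle ℂ F L]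

/-- Smoothness (in the real sense) of a section of `L`: its expressions in local trivialisations
are smooth. -/
def IsSmoothSection (s : ∀ x, L x) : Prop :=
  ∀ x₀, ContMDiffAt 𝓘(ℝ, ℂ) 𝓘(ℝ, F) ∞
    (fun x => (trivializationAt F L x₀).linearMapAt ℂ x (s x)) x₀

/-- `L`-valued `(0,1)`-forms, without any regularity: antilinear maps from the tangent spaces of
`X` to the fibres of `L`. The tangent space `TangentSpace 𝓘(ℂ, ℂ) x` is by definition `ℂ`, which we
write to have the norm and the complex structure at hand. -/
abbrev Form01 : Type u := ∀ x : X, ℂ →ₛₗ[starRingEnd ℂ] L x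

/-- Smoothness (in the real sense) of an `L`-valued `(0,1)`-form: in a local trivialisation of `L`
and a local holomorphic coordinate `φ` it reads `c • dφ̄` with `c` smooth. -/
def IsSmoothForm (s : Form01 L) : Prop :=
  ∀ x₀, ∃ c : X → F, ContMDiffAt 𝓘(ℝ, ℂ) 𝓘(ℝ, F) ∞ c x₀ ∧
    ∀ᶠ x in 𝓝 x₀, ∀ v : ℂ,
      (trivializationAt F L x₀).linearMapAt ℂ x (s x v) =
        conj (coordDeriv (chartAt ℂ x₀) x v) • c x

/-- `Ω^{0,0}_c(V, L)`. Sections over `V` with compact support in `V` are extended by zero, so that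
the extension maps `Ω^{0,0}_c(V, L) → Ω^{0,0}_c(V', L)` are the inclusions. -/
def Omega0 (V : Set X) : Submodule ℂ (∀ x, L x) where
  carrier := {s | IsSmoothSection F L s ∧ CompactSuppIn V s}
  zero_mem' := by
    refine ⟨fun x₀ => ?_, CompactSuppIn.zero V⟩
    simpa using contMDiffAt_const
  add_mem' := by
    rintro s t ⟨h1, h2⟩ ⟨k1, k2⟩
    refine ⟨fun x₀ => ?_, h2.add k2⟩
    simpa [Pi.add_def] using (h1 x₀).add (k1 x₀)
  smul_mem' := by
    rintro a s ⟨h1, h2⟩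
    refine ⟨fun x₀ => ?_, h2.mono_supp ?_⟩
    · have h : ContMDiff 𝓘(ℝ, F) 𝓘(ℝ, F) ∞ (fun y : F => a • y) := by
        apply ContDiff.contMDiff
        fun_prop
      simpa [Function.comp_def] using h.contMDiffAt.comp x₀ (h1 x₀)
    · intro x hx
      refine subset_closure fun hx' => hx ?_
      simp [hx']

/-- `Ω^{0,1}_c(V, L)`, again with forms on `V` extended by zero. -/
def Omega1 (V : Set X) : Submodule ℂ (Form01 L) where
  carrier := {s | IsSmoothForm F L s ∧ CompactSuppIn V s}
  zero_mem' := by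
    refine ⟨fun x₀ => ⟨0, contMDiffAt_const, ?_⟩, CompactSuppIn.zero V⟩
    simp
  add_mem' := by
    rintro s t ⟨h1, h2⟩ ⟨k1, k2⟩
    refine ⟨fun x₀ => ?_, h2.add k2⟩
    obtain ⟨c, hc, hc'⟩ := h1 x₀
    obtain ⟨d, hd, hd'⟩ := k1 x₀
    refine ⟨c + d, hc.add hd, ?_⟩
    filter_upwards [hc', hd'] with x h k v
    simp [h v, k v]
  smul_mem' := by
    rintro a s ⟨h1, h2⟩
    refine ⟨fun x₀ => ?_, h2.mono_supp ?_⟩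
    · obtain ⟨c, hc, hc'⟩ := h1 x₀
      have h : ContMDiff 𝓘(ℝ, F) 𝓘(ℝ, F) ∞ (fun y : F => a • y) := by
        apply ContDiff.contMDiff
        fun_prop
      refine ⟨fun x => a • c x, by simpa [Function.comp_def] using h.contMDiffAt.comp x₀ hc, ?_⟩
      filter_upwards [hc'] with x h v
      simp [h v, smul_comm a]
    · intro x hx
      refine subset_closure fun hx' => hx ?_
      simp [hx']

/-- The Dolbeault operator of `L` on sections: the antilinear part of the derivative, computed in
a holomorphic local trivialisation. -/
def dbarSection (s : ∀ x, L x) : Form01 L := fun x =>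
  ((trivializationAt F L x).symmₗ ℂ x).comp
    (antilinearPart (realDeriv (fun y => (trivializationAt F L x).linearMapAt ℂ y (s y)) x))

variable {F L}

theorem chart_differentiableAt {g : X → F} {x₀ : X}
    (hg : ContMDiffAt 𝓘(ℝ, ℂ) 𝓘(ℝ, F) ∞ g x₀) :
    ContDiffAt ℝ ∞ (fun z => g ((chartAt ℂ x₀).symm z)) (chartAt ℂ x₀ x₀) := by
  have := hg.2
  simpa [ContDiffWithinAtProp, Function.comp_def, chartAt_self_eq, contDiffWithinAt_univ] using this

theorem mfderiv_eq_fderiv {g : X → F} {x₀ : X}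
    (hg : ContMDiffAt 𝓘(ℝ, ℂ) 𝓘(ℝ, F) ∞ g x₀) :
    realDeriv g x₀ = fderiv ℝ (fun z => g ((chartAt ℂ x₀).symm z)) (chartAt ℂ x₀ x₀) := by
  unfold realDeriv
  rw [(hg.mdifferentiableAt (by simp)).mfderiv]
  simp [writtenInExtChartAt, Function.comp_def, fderivWithin_univ, chartAt_self_eq]

theorem dbarSection_smooth [IsManifold 𝓘(ℂ, ℂ) ω X] [ContMDiffVectorBundle ω F L 𝓘(ℂ, ℂ)]
    {s : ∀ x, L x} (hs : IsSmoothSection F L s) : IsSmoothForm F L (dbarSection F L s) := by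
  intro x₀
  set φ := chartAt ℂ x₀ with hφ
  set e := trivializationAt F L x₀ with he
  set G : ℂ → F := fun z => e.linearMapAt ℂ (φ.symm z) (s (φ.symm z)) with hG
  have hG0 : ContDiffAt ℝ ∞ G (φ x₀) := chart_differentiableAt (hs x₀)
  have hcont : ContinuousAt φ x₀ := φ.continuousAt (mem_chart_source ℂ x₀)
  refine ⟨fun x => antilinearPart (fderiv ℝ G (φ x)) 1, ?_, ?_⟩
  · have h1 : ContDiffAt ℝ ∞ (fun z => antilinearPart (fderiv ℝ G z) 1) (φ x₀) := by
      have h2 : ContDiffAt ℝ ∞ (fderiv ℝ G) (φ x₀) := hG0.fderiv_right (by simp)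
      simp only [antilinearPart, LinearMap.coe_mk, AddHom.coe_mk]
      fun_prop
    have h3 : ContMDiffAt 𝓘(ℝ, ℂ) 𝓘(ℝ, ℂ) ∞ φ x₀ := by
      refine ⟨hcont.continuousWithinAt, ?_⟩
      have : (fun z => φ (φ.symm z)) =ᶠ[𝓝 (φ x₀)] fun z => z := by
        filter_upwards [φ.open_target.mem_nhds (φ.map_source (mem_chart_source ℂ x₀))] with z hz
        exact φ.right_inv hz
      have h4 : ContDiffAt ℝ ∞ (fun z => φ (φ.symm z)) (φ x₀) := contDiffAt_id.congr_of_eventuallyEq this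
      simpa [ContDiffWithinAtProp, Function.comp_def, chartAt_self_eq, contDiffWithinAt_univ] using h4
    exact h1.contMDiffAt.comp x₀ h3
  · have hd : ∀ᶠ x in 𝓝 x₀, DifferentiableAt ℝ G (φ x) := by
      have h1 : ∀ᶠ z in 𝓝 (φ x₀), ContDiffAt ℝ 1 G z :=
        (hG0.of_le (by norm_num)).eventually (by norm_num)
      filter_upwards [hcont.eventually h1] with x hx
      exact hx.differentiableAt (by norm_num)
    filter_upwards [hd, φ.open_source.mem_nhds (mem_chart_source ℂ x₀),
      e.open_baseSet.mem_nhds (mem_baseSet_trivializationAt F L x₀)] with x hdx hxφ hxe v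
    set ψ := chartAt ℂ x with hψ
    set e' := trivializationAt F L x with he'
    have hxe' : x ∈ e'.baseSet := mem_baseSet_trivializationAt F L x
    have hxψ : x ∈ ψ.source := mem_chart_source ℂ x
    -- the change of trivialisation and the change of coordinate
    have hT : DifferentiableAt ℂ (fun z => (e'.coordChangeL ℂ e (ψ.symm z) : F →L[ℂ] F)) (ψ x) := by
      have h1 := (contMDiffAt_coordChangeL (n := ω) (IB := 𝓘(ℂ, ℂ)) (e := e') (e' := e) hxe' hxe).2
      have h2 : ContDiffAt ℂ ω (fun z => (e'.coordChangeL ℂ e (ψ.symm z) : F →L[ℂ] F)) (ψ x) := by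
        simpa [ContDiffWithinAtProp, Function.comp_def, chartAt_self_eq, contDiffWithinAt_univ] using h1
      exact h2.differentiableAt (by simp)
    have hτ' : MDifferentiableAt 𝓘(ℂ, ℂ) 𝓘(ℂ, ℂ) φ x :=
      mdifferentiableAt_atlas (chart_mem_atlas ℂ x₀) hxφ
    have hτm : coordDeriv φ x = fderiv ℂ (fun z => φ (ψ.symm z)) (ψ x) := by
      unfold coordDeriv
      rw [hτ'.mfderiv]
      simp [writtenInExtChartAt, Function.comp_def, fderivWithin_univ, hψ, chartAt_self_eq]
    have hτ : DifferentiableAt ℂ (fun z => φ (ψ.symm z)) (ψ x) := by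
      have := hτ'.2
      simpa [DifferentiableWithinAtProp, Function.comp_def, chartAt_self_eq, differentiableWithinAt_univ] using this
    -- the two expressions of the section
    have hψc : ContinuousAt ψ.symm (ψ x) := ψ.symm.continuousAt (ψ.map_source hxψ)
    have hmem : ∀ᶠ z in 𝓝 (ψ x), ψ.symm z ∈ φ.source ∩ (e'.baseSet ∩ e.baseSet) := by
      refine hψc.eventually_mem ?_
      rw [ψ.left_inv hxψ]
      exact (φ.open_source.inter (e'.open_baseSet.inter e.open_baseSet)).mem_nhds
        ⟨hxφ, hxe', hxe⟩
    have hgs := hs x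
    have hgd : DifferentiableAt ℝ (fun z => e'.linearMapAt ℂ (ψ.symm z) (s (ψ.symm z))) (ψ x) :=
      (chart_differentiableAt hgs).differentiableAt (by simp)
    have hEq : (fun z => G (φ (ψ.symm z))) =ᶠ[𝓝 (ψ x)]
        fun z => (e'.coordChangeL ℂ e (ψ.symm z) : F →L[ℂ] F)
          (e'.linearMapAt ℂ (ψ.symm z) (s (ψ.symm z))) := by
      filter_upwards [hmem] with z hz
      simp only [hG]
      rw [φ.left_inv hz.1]
      change _ = e'.coordChangeL ℂ e (ψ.symm z) _
      rw [e'.coordChangeL_apply e hz.2, e'.coe_linearMapAt_of_mem hz.2.1,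
        e.coe_linearMapAt_of_mem hz.2.2, e'.symm_apply_apply_mk hz.2.1]
    have hx' : ψ.symm (ψ x) = x := ψ.left_inv hxψ
    have k1 := antilinearPart_comp (G := G) hτ (by rw [hx']; exact hdx) v
    have k2 := antilinearPart_smul hT hgd v
    rw [hEq.fderiv_eq, k2] at k1
    simp only [hx'] at k1
    rw [hτm]
    refine Eq.trans ?_ k1
    have k3 : dbarSection F L s x v = e'.symmₗ ℂ x
        (antilinearPart (fderiv ℝ (fun z => e'.linearMapAt ℂ (ψ.symm z) (s (ψ.symm z))) (ψ x)) v) := by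
      unfold dbarSection
      rw [mfderiv_eq_fderiv hgs]
      rfl
    rw [k3]
    change _ = e'.coordChangeL ℂ e x _
    rw [e'.coordChangeL_apply e ⟨hxe', hxe⟩, e.coe_linearMapAt_of_mem hxe, e'.symmₗ_apply hxe']

theorem dbarSection_supp (s : ∀ x, L x) :
    {x | dbarSection F L s x ≠ 0} ⊆ closure {x | s x ≠ 0} := by
  intro x hx
  by_contra hc
  refine hx ?_
  have h0 : (fun y => (trivializationAt F L x).linearMapAt ℂ y (s y)) =ᶠ[𝓝 x] fun _ => (0 : F) := by
    filter_upwards [isClosed_closure.isOpen_compl.mem_nhds hc] with y hy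
    have : s y = 0 := by
      by_contra h
      exact hy (subset_closure h)
    simp [this]
  have h1 : realDeriv (fun y => (trivializationAt F L x).linearMapAt ℂ y (s y)) x = 0 := by
    unfold realDeriv
    rw [h0.mfderiv_eq, mfderiv_const]
    rfl
  unfold dbarSection
  rw [h1]
  ext
  simp [antilinearPart]

variable (F L)

/-- The Dolbeault differential `Ω^{0,0}_c(V, L) → Ω^{0,1}_c(V, L)`. -/
def dbar [IsManifold 𝓘(ℂ, ℂ) ω X] [ContMDiffVectorBundle ω F L 𝓘(ℂ, ℂ)] (V : Set X) :
    Omega0 F L V →ₗ[ℂ] Omega1 F L V where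
  toFun s := ⟨dbarSection F L s.1, dbarSection_smooth s.2.1, s.2.2.mono_supp (dbarSection_supp _)⟩
  map_add' s t := by
    apply Subtype.ext
    funext x
    have h1 := mfderiv_eq_fderiv (s.2.1 x)
    have h2 := mfderiv_eq_fderiv (t.2.1 x)
    have h3 := mfderiv_eq_fderiv ((s + t).2.1 x)
    have d1 := (chart_differentiableAt (s.2.1 x)).differentiableAt (n := ∞) (by simp)
    have d2 := (chart_differentiableAt (t.2.1 x)).differentiableAt (n := ∞) (by simp)
    simp only [Submodule.coe_add, Pi.add_apply, map_add] at h3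
    have h4 := fderiv_fun_add d1 d2
    rw [h4, ← h1, ← h2] at h3
    apply LinearMap.ext
    intro v
    simp only [dbarSection, Submodule.coe_add, Pi.add_apply, LinearMap.comp_apply,
      LinearMap.add_apply, map_add, h3]
    rw [← map_add]
    congr 1
    simp only [antilinearPart, LinearMap.coe_mk, AddHom.coe_mk, _root_.add_apply, smul_add]
    abel
  map_smul' a s := by
    apply Subtype.ext
    funext x
    have h1 := mfderiv_eq_fderiv (s.2.1 x)
    have h3 := mfderiv_eq_fderiv ((a • s).2.1 x)
    have d1 := (chart_differentiableAt (s.2.1 x)).differentiableAt (n := ∞) (by simp)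
    simp only [Submodule.coe_smul, Pi.smul_apply, map_smul] at h3
    have h4 := fderiv_fun_const_smul d1 a
    rw [h4, ← h1] at h3
    apply LinearMap.ext
    intro v
    simp only [dbarSection, Submodule.coe_smul, Pi.smul_apply, LinearMap.comp_apply,
      LinearMap.smul_apply, map_smul, h3, RingHom.id_apply]
    rw [← map_smul]
    congr 1
    simp only [antilinearPart, LinearMap.coe_mk, AddHom.coe_mk, _root_.smul_apply, smul_add,
      smul_smul]
    congr 2 <;> ring

end Dolbeault

/-! ## Twisted local Lie algebras -/

section LieData

variable (F : Type u) [NormedAddCommGroup F] [NormedSpace ℂ F]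
  {X : Type u} [TopologicalSpace X] [ChartedSpace ℂ X] [IsManifold 𝓘(ℂ, ℂ) ω X]
  (L : X → Type u) [TopologicalSpace (TotalSpace F L)] [∀ x, AddCommGroup (L x)]
  [∀ x, Module ℂ (L x)] [∀ x, TopologicalSpace (L x)] [FiberBundle F L] [VectorBundle ℂ F L]
  [ContMDiffVectorBundle ω F L 𝓘(ℂ, ℂ)]

/-- The structure of a precosheaf of DG Lie algebras on `V ↦ Ω^{0,•}_c(V, L)`. As the complex lives
in degrees `0` and `1`, the bracket is given by its components `[a, b]` and `[a, η]` for `a, b` of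
degree `0` and `η` of degree `1`; by graded antisymmetry `[η, a] = -[a, η]`, and the bracket
of two elements of degree `1` vanishes. -/
structure DGLieBracket where
  br₀ : ∀ V : TopologicalSpace.Opens X,
    Omega0 F L (V : Set X) →ₗ[ℂ] Omega0 F L (V : Set X) →ₗ[ℂ] Omega0 F L (V : Set X)
  br₁ : ∀ V : TopologicalSpace.Opens X,
    Omega0 F L (V : Set X) →ₗ[ℂ] Omega1 F L (V : Set X) →ₗ[ℂ] Omega1 F L (V : Set X)
  antisymm : ∀ V a b, br₀ V a b = -br₀ V b a
  jacobi₀ : ∀ V a b c, br₀ V a (br₀ V b c) = br₀ V (br₀ V a b) c + br₀ V b (br₀ V a c)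
  jacobi₁ : ∀ V a b η, br₁ V a (br₁ V b η) = br₁ V (br₀ V a b) η + br₁ V b (br₁ V a η)
  leibniz : ∀ (V : TopologicalSpace.Opens X) a b, dbar F L (V : Set X) (br₀ V a b) =
    -br₁ V b (dbar F L (V : Set X) a) + br₁ V a (dbar F L (V : Set X) b)
  ext₀ : ∀ V V' : TopologicalSpace.Opens X, V ≤ V' → ∀ a b a' b', a.1 = a'.1 → b.1 = b'.1 →
    (br₀ V a b).1 = (br₀ V' a' b').1
  ext₁ : ∀ V V' : TopologicalSpace.Opens X, V ≤ V' → ∀ a η a' η', a.1 = a'.1 → η.1 = η'.1 →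
    (br₁ V a η).1 = (br₁ V' a' η').1

variable {F L} in
/-- A `2`-cocycle of the DG Lie algebras `Ω^{0,•}_c(V, L)`, of degree such that
`[a, b] + α(a, b) 𝟏` is homogeneous for `𝟏` of degree `1`: its only components are
`α(a, η) = -α(η, a)` with `a` of degree `0` and `η` of degree `1`. -/
structure TwoCocycle (b : DGLieBracket F L) where
  α : ∀ V : TopologicalSpace.Opens X,
    Omega0 F L (V : Set X) →ₗ[ℂ] Omega1 F L (V : Set X) →ₗ[ℂ] ℂ
  closed : ∀ (V : TopologicalSpace.Opens X) a a', -α V a' (dbar F L (V : Set X) a) + α V a (dbar F L (V : Set X) a') = 0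
  cocycle : ∀ V a a' η, α V a (b.br₁ V a' η) = α V (b.br₀ V a a') η + α V a' (b.br₁ V a η)

end LieData

/-! ## Pointed DG vector spaces -/

/-- A pointed DG vector space: a cochain complex of complex vector spaces with a degree `1` map
from `ℂ` with values in the cocycles. -/
structure PointedComplex where
  cx : CochainComplex (ModuleCat.{u} ℂ) ℤ
  unit : ℂ →ₗ[ℂ] cx.X 1
  unit_closed : ∀ c, (cx.d 1 2).hom (unit c) = 0

/-- Morphisms of pointed DG vector spaces. -/
structure PointedComplex.Hom (A B : PointedComplex.{u}) where
  map : A.cx ⟶ B.cx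
  map_unit : ∀ c, (map.f 1).hom (A.unit c) = B.unit c

/-- A strong deformation retract of pointed DG vector spaces, with `A` the retract of `B`. The
degree `-1` map `h` is given by its components. Note that `f ≫ g` is `g ∘ f`. -/
structure StrongDeformationRetract (A B : PointedComplex.{u}) where
  i : A.Hom B
  p : B.Hom A
  h : ∀ m n : ℤ, B.cx.X m ⟶ B.cx.X n
  h_degree : ∀ m n, n + 1 ≠ m → h m n = 0
  p_i : i.map ≫ p.map = 𝟙 A.cx
  homotopy : ∀ n, (p.map ≫ i.map).f n - 𝟙 (B.cx.X n) =
    -(h n (n - 1) ≫ B.cx.d (n - 1) n + B.cx.d n (n + 1) ≫ h (n + 1) n)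
  p_h : ∀ m n, h m n ≫ p.map.f n = 0
  h_i : ∀ m n, i.map.f m ≫ h m n = 0
  h_h : ∀ l m n, h l m ≫ h m n = 0

section TwoTerm

variable {A B : Type u} [AddCommGroup A] [Module ℂ A] [AddCommGroup B] [Module ℂ B]

variable (A B) in
/-- The components of the complex `A ⟶ B` in degrees `0` and `1`. -/
def twoTermX : ℤ → ModuleCat.{u} ℂ
  | .ofNat 0 => ModuleCat.of ℂ A
  | .ofNat 1 => ModuleCat.of ℂ B
  | _ => ModuleCat.of ℂ PUnit.{u + 1}

/-- The differential of the complex `A ⟶ B` in degrees `0` and `1`. -/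
def twoTermD (d : A →ₗ[ℂ] B) : ∀ m n : ℤ, twoTermX A B m ⟶ twoTermX A B n
  | .ofNat 0, .ofNat 1 => ModuleCat.ofHom d
  | _, _ => 0

theorem twoTermD_eq_zero (d : A →ₗ[ℂ] B) (m n : ℤ) (h : ¬(m = 0 ∧ n = 1)) : twoTermD d m n = 0 := by
  rcases m with (_ | m) | m
  · rcases n with (_ | _ | n) | n
    · rfl
    · exact absurd ⟨rfl, rfl⟩ h
    · rfl
    · rfl
  · rfl
  · rfl

/-- The complex `A ⟶ B` in degrees `0` and `1`. -/
def twoTerm (d : A →ₗ[ℂ] B) : CochainComplex (ModuleCat.{u} ℂ) ℤ where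
  X := twoTermX A B
  d := twoTermD d
  shape m n hmn := by
    refine twoTermD_eq_zero d m n fun h => hmn ?_
    change m + 1 = n
    omega
  d_comp_d' l m n h1 h2 := by
    by_cases hm : m = 1
    · rw [twoTermD_eq_zero d m n fun h => by omega, Limits.comp_zero]
    · rw [twoTermD_eq_zero d l m fun h => hm h.2, Limits.zero_comp]

end TwoTerm

/-! ## Germs at infinity, and the maps between germs and `(0,1)`-forms on the plane

A `(0,1)`-form `w dλ̄` on an open subset of `ℂ` is represented by its coefficient `w`. -/

/-- `f` is holomorphic at the point `x` of the Riemann sphere. -/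
def SphereHolAt (f : OnePoint ℂ → ℂ) (x : OnePoint ℂ) : Prop :=
  (∀ z : ℂ, x = z → AnalyticAt ℂ (fun w : ℂ => f w) z) ∧
  (x = OnePoint.infty →
    AnalyticAt ℂ (fun w : ℂ => f (if w = 0 then OnePoint.infty else ((w⁻¹ : ℂ) : OnePoint ℂ))) 0)

/-- The complement of `S` in the Riemann sphere. -/
def sphereCompl (S : Set ℂ) : Set (OnePoint ℂ) := ((fun z : ℂ => (z : OnePoint ℂ)) '' S)ᶜ

/-- `f` represents a germ at `sphereCompl S`: it is holomorphic on the open neighbourhood `Δ` of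
`sphereCompl S` and vanishes at infinity. The values of `f` outside `Δ` are irrelevant. -/
structure IsGermRep (S : Set ℂ) (f : OnePoint ℂ → ℂ) (Δ : Set (OnePoint ℂ)) : Prop where
  isOpen : IsOpen Δ
  subset : sphereCompl S ⊆ Δ
  hol : ∀ x ∈ Δ, SphereHolAt f x
  vanish : f OnePoint.infty = 0

/-- The space `𝒪_∞(Sᶜ)` of germs at `sphereCompl S` of holomorphic functions that vanish at
infinity. -/
def OInfty (S : Set ℂ) : Submodule ℂ (Filter.Germ (𝓝ˢ (sphereCompl S)) ℂ) where
  carrier := {g | ∃ f Δ, IsGermRep S f Δ ∧ g = (f : Filter.Germ (𝓝ˢ (sphereCompl S)) ℂ)}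
  zero_mem' := by
    refine ⟨0, univ, ⟨isOpen_univ, subset_univ _, fun x _ => ⟨fun z _ => ?_, fun _ => ?_⟩, rfl⟩, rfl⟩
    · exact analyticAt_const
    · exact analyticAt_const
  add_mem' := by
    rintro _ _ ⟨f, Δ, hf, rfl⟩ ⟨g, Δ', hg, rfl⟩
    refine ⟨f + g, Δ ∩ Δ', ⟨hf.isOpen.inter hg.isOpen, subset_inter hf.subset hg.subset,
      fun x hx => ⟨fun z hz => ?_, fun h => ?_⟩, ?_⟩, rfl⟩
    · exact ((hf.hol x hx.1).1 z hz).add ((hg.hol x hx.2).1 z hz)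
    · exact ((hf.hol x hx.1).2 h).add ((hg.hol x hx.2).2 h)
    · simp [hf.vanish, hg.vanish]
  smul_mem' := by
    rintro c _ ⟨f, Δ, hf, rfl⟩
    refine ⟨c • f, Δ, ⟨hf.isOpen, hf.subset, fun x hx => ⟨fun z hz => ?_, fun h => ?_⟩, ?_⟩, rfl⟩
    · exact analyticAt_const.mul ((hf.hol x hx).1 z hz)
    · exact analyticAt_const.mul ((hf.hol x hx).2 h)
    · simp [hf.vanish]

/-- `Ω^{0,1}_c(W)` for `W ⊆ ℂ`, in terms of the coefficient of `dλ̄`. -/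
def PlaneForm (W : Set ℂ) : Submodule ℂ (ℂ → ℂ) where
  carrier := {w | ContDiff ℝ ∞ w ∧ HasCompactSupport w ∧ tsupport w ⊆ W}
  zero_mem' := ⟨contDiff_const, HasCompactSupport.zero, by simp [tsupport]⟩
  add_mem' := by
    rintro v w ⟨h1, h2, h3⟩ ⟨k1, k2, k3⟩
    exact ⟨h1.add k1, h2.add k2, (tsupport_add v w).trans (union_subset h3 k3)⟩
  smul_mem' := by
    rintro c w ⟨h1, h2, h3⟩
    have hs : Function.support (c • w) ⊆ Function.support w := fun x hx hx' => hx (by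
      simp [hx'])
    exact ⟨contDiff_const.smul h1, h2.mono hs, (closure_mono hs).trans h3⟩

/-- The coefficient of `∂̄ρ` with respect to `dλ̄`. -/
def planeDbar (ρ : ℂ → ℂ) (z : ℂ) : ℂ := antilinearPart (fderiv ℝ ρ z) 1

/-- The function `ω^↓(λ) = (1 / 2πi) ∫ dμ ∧ ω / (μ - λ)` for `ω = w dμ̄`; here `dμ ∧ dμ̄ = -2i dx ∧ dy`
for `μ = x + i y`. -/
def cauchyTransform (w : ℂ → ℂ) (l : ℂ) : ℂ :=
  (2 * Real.pi * Complex.I)⁻¹ * ∫ μ : ℂ, (-2 * Complex.I) * (w μ / (μ - l))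

/-- Extension of a function on the plane to the Riemann sphere by the value `0` at infinity. -/
def extendZero (f : ℂ → ℂ) (x : OnePoint ℂ) : ℂ := x.elim 0 f

/-- The germ `g` is the germ `[ω^↓]` for `ω = w dλ̄`. -/
def IsDownGerm {W : Set ℂ} (w : ℂ → ℂ) (g : OInfty W) : Prop :=
  (g : Filter.Germ (𝓝ˢ (sphereCompl W)) ℂ) = (extendZero (cauchyTransform w) : OnePoint ℂ → ℂ)

/-- The choices on which `⌈·⌉` depends: a basis of the space of germs, for each basis element a
representative `rep` with its domain `Δ`, and a smooth bump function `ρ` with compact support in `W`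
that is `1` on a neighbourhood of the complement of `Δ`. -/
structure LiftChoice (W : Set ℂ) where
  ι : Type
  basis : Module.Basis ι ℂ (OInfty W)
  rep : ι → OnePoint ℂ → ℂ
  Δ : ι → Set (OnePoint ℂ)
  isGermRep : ∀ b, IsGermRep W (rep b) (Δ b)
  germ_eq : ∀ b, (basis b : Filter.Germ (𝓝ˢ (sphereCompl W)) ℂ) = (rep b : OnePoint ℂ → ℂ)
  ρ : ι → ℂ → ℂ
  ρ_smooth : ∀ b, ContDiff ℝ ∞ (ρ b)
  ρ_compact : ∀ b, HasCompactSupport (ρ b)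
  ρ_supp : ∀ b, tsupport (ρ b) ⊆ W
  ρ_one : ∀ b, ∀ᶠ z in 𝓝ˢ {z : ℂ | (z : OnePoint ℂ) ∉ Δ b}, ρ b z = 1

theorem planeDbar_of_eventuallyEq {ρ : ℂ → ℂ} {z c : ℂ} (h : ρ =ᶠ[𝓝 z] fun _ => c) :
    planeDbar ρ z = 0 := by
  have : fderiv ℝ ρ z = 0 := by rw [h.fderiv_eq]; simp
  simp [planeDbar, this, antilinearPart]

theorem planeDbar_contDiff {ρ : ℂ → ℂ} (h : ContDiff ℝ ∞ ρ) : ContDiff ℝ ∞ (planeDbar ρ) := by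
  have h2 : ContDiff ℝ ∞ (fderiv ℝ ρ) := h.fderiv_right (by simp)
  unfold planeDbar
  simp only [antilinearPart, LinearMap.coe_mk, AddHom.coe_mk]
  fun_prop

theorem LiftChoice.mem_planeForm {W : Set ℂ} (c : LiftChoice W) (b : c.ι) :
    (fun z : ℂ => -(c.rep b z * planeDbar (c.ρ b) z)) ∈ PlaneForm W := by
  have hsupp : Function.support (fun z : ℂ => -(c.rep b z * planeDbar (c.ρ b) z)) ⊆
      tsupport (c.ρ b) := by
    intro z hz
    by_contra hc
    refine hz ?_
    have : planeDbar (c.ρ b) z = 0 := by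
      refine planeDbar_of_eventuallyEq (c := 0) ?_
      filter_upwards [(isClosed_tsupport _).isOpen_compl.mem_nhds hc] with y hy
      exact image_eq_zero_of_notMem_tsupport hy
    simp [this]
  have hcl := closure_minimal hsupp (isClosed_tsupport _)
  refine ⟨?_, (c.ρ_compact b).of_isClosed_subset isClosed_closure hcl, hcl.trans (c.ρ_supp b)⟩
  rw [contDiff_iff_contDiffAt]
  intro z
  by_cases hz : (z : OnePoint ℂ) ∈ c.Δ b
  · have h1 : ContDiffAt ℝ ∞ (fun w : ℂ => c.rep b w) z :=
      ((((c.isGermRep b).hol _ hz).1 z rfl).contDiffAt (n := ∞)).restrict_scalars ℝ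
    exact (h1.mul (planeDbar_contDiff (c.ρ_smooth b)).contDiffAt).neg
  · have h1 : ∀ᶠ y in 𝓝 z, c.ρ b y = 1 :=
      (c.ρ_one b).filter_mono (nhds_le_nhdsSet (by simpa using hz))
    refine (contDiffAt_const (c := (0 : ℂ))).congr_of_eventuallyEq ?_
    filter_upwards [h1.eventually_nhds] with y hy
    have : planeDbar (c.ρ b) y = 0 := planeDbar_of_eventuallyEq (c := 1) hy
    simp [this]

/-- The linear map `[f] ↦ ⌈f⌉`, given by `⌈f⌉ = - f ∂̄ρ_f` on the elements of the chosen basis. -/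
def LiftChoice.lift {W : Set ℂ} (c : LiftChoice W) : OInfty W →ₗ[ℂ] PlaneForm W :=
  c.basis.constr ℂ fun b => ⟨fun z : ℂ => -(c.rep b z * planeDbar (c.ρ b) z), c.mem_planeForm b⟩

/-! ## Holomorphic coordinates -/

section Coordinates

variable (F : Type u) [NormedAddCommGroup F] [NormedSpace ℂ F]
  {X : Type u} [TopologicalSpace X] [ChartedSpace ℂ X]

variable (X) in
/-- A local holomorphic coordinate, defined on the open subset `chart.source`. -/
structure HolCoord where
  chart : OpenPartialHomeomorph X ℂ
  mem : chart ∈ IsManifold.maximalAtlas 𝓘(ℂ, ℂ) ω X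

/-- Bounded holomorphic coordinates `ξ_j : W_j → ℂ` on the connected components of `V`. -/
structure BoundedCoords (V : Set X) where
  m : ℕ
  m_eq : m = 1 ∨ m = 2
  coord : Fin m → HolCoord X
  connected : ∀ j, _root_.IsConnected (coord j).chart.source
  disjoint : Pairwise fun j k => Disjoint (coord j).chart.source (coord k).chart.source
  iUnion_eq : ⋃ j, (coord j).chart.source = V
  bounded : ∀ j, Bornology.IsBounded (coord j).chart.target

/-- The image `ξ_j(W_j)`. -/
abbrev BoundedCoords.image {V : Set X} (ξ : BoundedCoords V) (j : Fin ξ.m) : Set ℂ :=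
  (ξ.coord j).chart.target

variable (L : X → Type u) [TopologicalSpace (TotalSpace F L)] [∀ x, AddCommGroup (L x)]
  [∀ x, Module ℂ (L x)] [∀ x, TopologicalSpace (L x)] [FiberBundle F L] [VectorBundle ℂ F L]

/-- Holomorphic trivialisations of `L` over all coordinate charts `ξ : W → ℂ`, with finite-dimensional
fibres `𝔞_ξ` (`fib ξ`), together with isomorphisms `(·)_ξ` (`iso ξ`) from a fixed vector space `𝔞`
onto the `𝔞_ξ`. The map `triv ξ x` is the restriction of `W × 𝔞_ξ ≅ L|_W` to the fibres over
`x ∈ W`; its values for `x ∉ W` are irrelevant. -/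
structure CoordTrivialization (𝔞 : Type u) [AddCommGroup 𝔞] [Module ℂ 𝔞] where
  fib : HolCoord X → Type u
  [addCommGroup : ∀ ξ, AddCommGroup (fib ξ)]
  [module : ∀ ξ, Module ℂ (fib ξ)]
  [finiteDimensional : ∀ ξ, FiniteDimensional ℂ (fib ξ)]
  triv : ∀ (ξ : HolCoord X) (x : X), fib ξ →ₗ[ℂ] L x
  bijective : ∀ ξ, ∀ x ∈ ξ.chart.source, Function.Bijective (triv ξ x)
  holomorphic : ∀ ξ (a : fib ξ), ContMDiffOn 𝓘(ℂ, ℂ) (𝓘(ℂ, ℂ).prod 𝓘(ℂ, F)) ω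
    (fun x => TotalSpace.mk' F x (triv ξ x a)) ξ.chart.source
  iso : ∀ ξ, 𝔞 ≃ₗ[ℂ] fib ξ

attribute [instance] CoordTrivialization.addCommGroup CoordTrivialization.module
  CoordTrivialization.finiteDimensional

variable {F L} {𝔞 : Type u} [AddCommGroup 𝔞] [Module ℂ 𝔞]

open Classical in
/-- The section `a_ξ ⊗ ξ^* g` of `L`, for a function `g` on `ξ(W)`, extended by zero outside the
domain `W` of `ξ`. -/
def tensorSection (T : CoordTrivialization F L 𝔞) (ξ : HolCoord X) (a : 𝔞) (g : ℂ → ℂ) (x : X) :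
    L x :=
  if x ∈ ξ.chart.source then g (ξ.chart x) • T.triv ξ x (T.iso ξ a) else 0

open Classical in
/-- The `L`-valued `(0,1)`-form `a_ξ ⊗ ξ^*(w dλ̄)`, extended by zero outside the domain of `ξ`. -/
def tensorForm (T : CoordTrivialization F L 𝔞) (ξ : HolCoord X) (a : 𝔞) (w : ℂ → ℂ) : Form01 L :=
  fun x =>
    { toFun := fun v => if x ∈ ξ.chart.source then
        (w (ξ.chart x) * conj (coordDeriv ξ.chart x v)) • T.triv ξ x (T.iso ξ a) else 0
      map_add' := by
        intro v v'
        split_ifs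
        · rw [map_add, map_add, mul_add, add_smul]
        · simp
      map_smul' := by
        intro c v
        split_ifs
        · rw [map_smul, smul_eq_mul, map_mul, smul_smul]
          congr 1
          ring
        · simp }

end Coordinates

/-! ## The strong deformation retract -/

section Retract

variable {F : Type u} [NormedAddCommGroup F] [NormedSpace ℂ F]
  {X : Type u} [TopologicalSpace X] [ChartedSpace ℂ X] [IsManifold 𝓘(ℂ, ℂ) ω X]
  {L : X → Type u} [TopologicalSpace (TotalSpace F L)] [∀ x, AddCommGroup (L x)]
  [∀ x, Module ℂ (L x)] [∀ x, TopologicalSpace (L x)] [FiberBundle F L] [VectorBundle ℂ F L]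
  [ContMDiffVectorBundle ω F L 𝓘(ℂ, ℂ)]

/-- The pointed DG vector space `Ω^{0,•}_c(V, L) ⊕ ℂ 𝟏`, with `𝟏` of degree `1`, which underlies the
central extension of `Ω^{0,•}_c(V, L)` by the cocycle `α`. The cocycle and the bracket enter only in
the Lie bracket of that central extension, not in the DG vector space. -/
def twistedComplex {b : DGLieBracket F L} (_α : TwoCocycle b) (V : Set X) : PointedComplex.{u} where
  cx := twoTerm (A := Omega0 F L V) (B := Omega1 F L V × ℂ)
    ((LinearMap.inl ℂ (Omega1 F L V) ℂ).comp (dbar F L V))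
  unit := LinearMap.inr ℂ (Omega1 F L V) ℂ
  unit_closed := fun _ => rfl

variable {V : Set X} (𝔞 : Type u) [AddCommGroup 𝔞] [Module ℂ 𝔞]

/-- The vector space `⨁_j 𝔞 ⊗ 𝒪_∞(ξ_j(W_j)ᶜ) ⊕ ℂ`. -/
abbrev GermSpace (ξ : BoundedCoords V) : Type u := (∀ j, 𝔞 ⊗[ℂ] OInfty (ξ.image j)) × ℂ

/-- The pointed DG vector space given by `GermSpace` in degree `1`. -/
def germComplex (ξ : BoundedCoords V) : PointedComplex.{u} where
  cx := twoTerm (A := PUnit.{u + 1}) (B := GermSpace 𝔞 ξ) 0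
  unit := LinearMap.inr ℂ (∀ j, 𝔞 ⊗[ℂ] OInfty (ξ.image j)) ℂ
  unit_closed := fun _ => rfl

variable {𝔞} (T : CoordTrivialization F L 𝔞) (ξ : BoundedCoords V)
  (c : ∀ j, LiftChoice (ξ.image j)) {b : DGLieBracket F L} {α : TwoCocycle b}

/-- The map `i` is the one with `(a_j ⊗ [f_j])_j ↦ ∑_j (a_j)_{ξ_j} ⊗ ξ_j^* ⌈f_j⌉` and `a ↦ a 𝟏`. -/
def IsInclusion (i : (germComplex 𝔞 ξ).Hom (twistedComplex α V)) : Prop :=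
  let i₁ : GermSpace 𝔞 ξ →ₗ[ℂ] Omega1 F L V × ℂ := (i.map.f 1).hom
  (∀ j (a : 𝔞) (f : OInfty (ξ.image j)),
    (i₁ (Pi.single j (a ⊗ₜ f), 0)).1.1 = tensorForm T (ξ.coord j) a ((c j).lift f).1 ∧
    (i₁ (Pi.single j (a ⊗ₜ f), 0)).2 = 0) ∧
  ∀ z : ℂ, i₁ (0, z) = (0, z)

/-- The map `p` is the one with
`∑_j (a_j)_{ξ_j} ⊗ ω_j ↦ (a_j ⊗ [((ξ_j⁻¹)^* ω_j)^↓])_j` and `a 𝟏 ↦ a`; a form `ω_j` on the domain of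
`ξ_j` is written as `ξ_j^*(w dλ̄)`. -/
def IsProjection (p : (twistedComplex α V).Hom (germComplex 𝔞 ξ)) : Prop :=
  let p₁ : Omega1 F L V × ℂ →ₗ[ℂ] GermSpace 𝔞 ξ := (p.map.f 1).hom
  (∀ j (a : 𝔞) (w : PlaneForm (ξ.image j)) (s : Omega1 F L V),
    s.1 = tensorForm T (ξ.coord j) a w.1 →
    ∃ g : OInfty (ξ.image j), IsDownGerm w.1 g ∧ p₁ (s, 0) = (Pi.single j (a ⊗ₜ g), 0)) ∧
  ∀ z : ℂ, p₁ (0, z) = (0, z)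

/-- The map `h` is the one with `∑_j (a_j)_{ξ_j} ⊗ ω_j ↦
∑_j (a_j)_{ξ_j} ⊗ ξ_j^* ((ξ_j⁻¹)^* ω_j - ⌈((ξ_j⁻¹)^* ω_j)^↓⌉)^↓` and `a 𝟏 ↦ 0`. -/
def IsContraction
    (h : ∀ m n : ℤ, (twistedComplex α V).cx.X m ⟶ (twistedComplex α V).cx.X n) : Prop :=
  let h₁ : Omega1 F L V × ℂ →ₗ[ℂ] Omega0 F L V := (h 1 0).hom
  (∀ j (a : 𝔞) (w : PlaneForm (ξ.image j)) (s : Omega1 F L V),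
    s.1 = tensorForm T (ξ.coord j) a w.1 →
    ∃ g : OInfty (ξ.image j), IsDownGerm w.1 g ∧
      (h₁ (s, 0)).1 = tensorSection T (ξ.coord j) a (cauchyTransform (w - (c j).lift g).1)) ∧
  ∀ z : ℂ, h₁ (0, z) = 0

end Retract

/-- The pushforward to the surface: the sections over `U ⊆ M` are the sections over the preimage of
`U` in the orientation double. -/
def pushforwardComplex [HasGroupoid M conformalGroupoid]
    {F : Type u} [NormedAddCommGroup F] [NormedSpace ℂ F]
    {L : Double M → Type u} [TopologicalSpace (TotalSpace F L)] [∀ x, AddCommGroup (L x)]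
    [∀ x, Module ℂ (L x)] [∀ x, TopologicalSpace (L x)] [FiberBundle F L] [VectorBundle ℂ F L]
    [ContMDiffVectorBundle ω F L 𝓘(ℂ, ℂ)] {b : DGLieBracket F L} (α : TwoCocycle b) (U : Set M) :
    PointedComplex.{u} :=
  twistedComplex α (Double.proj ⁻¹' U)

end CFT

end

noncomputable section

namespace CFT

/-! ## The Cauchy transform in the plane -/

section CauchyTransform

open MeasureTheory
open scoped Convolution

/-! The theorem is the compactly supported Dolbeault problem for plane domains, transported to the
double by coordinates and frames.

Over each coordinate domain a basis of the finite-dimensional space `𝔞` gives a holomorphic frame of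
`L`. Expanding in these frames, and using that the coordinate domains are disjoint and cover `V`,
identifies both terms of the Dolbeault complex with finite products of spaces `𝔞 ⊗ PlaneForm
(ξ_j(W_j))` (`sectionEquiv`, `formEquiv`). Since the frames are holomorphic, `∂̄` becomes `id ⊗
∂/∂λ̄` in each factor (`dbar_totalSection`). It remains to treat scalar functions on an open set `W
⊆ ℂ`.

There everything rests on the Cauchy transform `C`. It satisfies `C ∂̄ u = u` for compactly
supported smooth `u` (`cauchyTransform_planeDbar`, a computation in polar coordinates). Being a
convolution it commutes with `∂̄`, so `∂̄ C w = w` as well (`planeDbar_cauchyTransform_self`). The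
function `C w` is holomorphic off the support of `w` and vanishes at infinity, so it has a germ at
the complement of `W` in the sphere. This germ is zero exactly when `C w` is compactly supported in
`W`, that is, when `w` is `∂̄` of an element of `PlaneForm W`. Hence `∂̄` is injective on `PlaneForm
W`, and its cokernel embeds into `OInfty W`.

The embedding is onto, with the explicit section `⌈·⌉`. For a basis germ `f` with cut-off `ρ`, `⌈f⌉
= -f ∂̄ρ = ∂̄(f (1 - ρ))`, where `f (1 - ρ)` extends smoothly to the plane and vanishes at infinity.
By Liouville it is the Cauchy transform of `⌈f⌉` (`LiftChoice.cauchyTransform_lift_basis`), and it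
agrees with `f` near the complement of `W`. So the germ of `C⌈f⌉` is `f` (`LiftChoice.down_lift`).

Consequently `w - ⌈C w⌉` has zero germ, and its Cauchy transform `h w` is compactly supported in
`W`. The relations `∂̄ h = id - i p`, `h ∂̄ = id`, `p ∂̄ = 0` and `h i = 0` follow at once, while `p
h = 0` and `h h = 0` hold for degree reasons. A strong deformation retract is a homotopy
equivalence, which gives the cohomology. -/

/-- In polar coordinates the Jacobian `r` cancels `|z|⁻¹ = 1/r`, so the integral is bounded by the
area of a rectangle in the `(r, θ)` plane. -/
theorem integrableOn_inv_closedBall (R : ℝ) :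
    IntegrableOn (fun z : ℂ => z⁻¹) (Metric.closedBall 0 R) := by
  refine ⟨measurable_inv.aestronglyMeasurable, ?_⟩
  rw [hasFiniteIntegral_iff_enorm, ← lintegral_indicator Metric.isClosed_closedBall.measurableSet,
    ← Complex.lintegral_comp_polarCoord_symm]
  calc ∫⁻ p in polarCoord.target, ENNReal.ofReal p.1 •
        (Metric.closedBall (0 : ℂ) R).indicator (fun z => ‖z⁻¹‖ₑ) (Complex.polarCoord.symm p)
      ≤ ∫⁻ p in polarCoord.target, (Icc 0 R ×ˢ Icc (-Real.pi) Real.pi).indicator 1 p := by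
        refine setLIntegral_mono' polarCoord.open_target.measurableSet fun p hp => ?_
        obtain ⟨hp1, hp2⟩ := hp
        have hp1 : 0 < p.1 := hp1
        have hn : ‖Complex.polarCoord.symm p‖ = p.1 := by
          rw [Complex.norm_polarCoord_symm, abs_of_pos hp1]
        by_cases hR : p.1 ≤ R
        · have hm : Complex.polarCoord.symm p ∈ Metric.closedBall (0 : ℂ) R := by
            rwa [mem_closedBall_zero_iff, hn]
          have hm' : p ∈ Icc 0 R ×ˢ Icc (-Real.pi) Real.pi :=
            ⟨⟨hp1.le, hR⟩, hp2.1.le, hp2.2.le⟩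
          rw [indicator_of_mem hm, indicator_of_mem hm', ← ofReal_norm, norm_inv, hn, smul_eq_mul,
            ← ENNReal.ofReal_mul hp1.le, mul_inv_cancel₀ hp1.ne']
          simp
        · have hm : Complex.polarCoord.symm p ∉ Metric.closedBall (0 : ℂ) R := by
            rwa [mem_closedBall_zero_iff, hn]
          rw [indicator_of_notMem hm]
          simp
    _ ≤ ∫⁻ p, (Icc 0 R ×ˢ Icc (-Real.pi) Real.pi).indicator 1 p := setLIntegral_le_lintegral _ _
    _ = volume (Icc 0 R ×ˢ Icc (-Real.pi) Real.pi) :=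
        lintegral_indicator_one (measurableSet_Icc.prod measurableSet_Icc)
    _ < ⊤ := (isCompact_Icc.prod isCompact_Icc).measure_lt_top

theorem locallyIntegrable_inv : LocallyIntegrable (fun z : ℂ => z⁻¹) := by
  intro z
  refine ⟨Metric.closedBall 0 (‖z‖ + 1), ?_, integrableOn_inv_closedBall _⟩
  refine Metric.isOpen_ball.mem_nhds (x := z) (by simp : z ∈ Metric.ball 0 (‖z‖ + 1)) |>
    mem_of_superset <| Metric.ball_subset_closedBall

/-- The kernel `1 / (π t)` of the Cauchy transform. -/
def cauchyKernel (t : ℂ) : ℂ := (Real.pi : ℂ)⁻¹ * t⁻¹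

theorem locallyIntegrable_cauchyKernel : LocallyIntegrable cauchyKernel :=
  locallyIntegrable_inv.smul ((Real.pi : ℂ)⁻¹)

/-- The substitution `μ = l - t` turns the factor `(2πi)⁻¹ (-2i) / (μ - l)` into `1 / (π t)`. This
exhibits the transform as a convolution with a locally integrable kernel. -/
theorem cauchyTransform_apply (w : ℂ → ℂ) (l : ℂ) :
    cauchyTransform w l = ∫ t : ℂ, cauchyKernel t * w (l - t) := by
  unfold cauchyTransform cauchyKernel
  rw [← integral_sub_left_eq_self _ volume l, ← integral_const_mul]
  congr 1
  funext t
  have : (Real.pi : ℂ) ≠ 0 := by exact_mod_cast Real.pi_ne_zero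
  -- At the pole both sides are zero, by the convention for division by zero.
  rcases eq_or_ne t 0 with rfl | ht
  · simp
  · rw [show l - t - l = -t by ring]
    field_simp [Complex.I_ne_zero]

theorem cauchyTransform_eq_convolution (w : ℂ → ℂ) :
    cauchyTransform w = cauchyKernel ⋆[ContinuousLinearMap.mul ℝ ℂ, volume] w := by
  funext l
  rw [cauchyTransform_apply]
  rfl

theorem cauchyTransform_contDiff {w : ℂ → ℂ} (hw : ContDiff ℝ ∞ w) (hc : HasCompactSupport w) :
    ContDiff ℝ ∞ (cauchyTransform w) := by
  rw [cauchyTransform_eq_convolution]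
  exact hc.contDiff_convolution_right (n := ⊤) _ locallyIntegrable_cauchyKernel hw

theorem integrable_cauchyKernel_mul {w : ℂ → ℂ} (hw : Continuous w) (hc : HasCompactSupport w)
    (l : ℂ) : Integrable fun t => cauchyKernel t * w (l - t) := by
  have := hc.convolutionExists_right (ContinuousLinearMap.mul ℝ ℂ) (μ := volume)
    locallyIntegrable_cauchyKernel hw l
  exact this

theorem cauchyTransform_add {v w : ℂ → ℂ} (hv : Continuous v) (hv' : HasCompactSupport v)
    (hw : Continuous w) (hw' : HasCompactSupport w) :
    cauchyTransform (v + w) = cauchyTransform v + cauchyTransform w := by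
  funext l
  rw [Pi.add_apply, cauchyTransform_apply, cauchyTransform_apply, cauchyTransform_apply,
    ← integral_add (integrable_cauchyKernel_mul hv hv' l) (integrable_cauchyKernel_mul hw hw' l)]
  simp only [Pi.add_apply, mul_add]

theorem cauchyTransform_smul (c : ℂ) (w : ℂ → ℂ) :
    cauchyTransform (c • w) = c • cauchyTransform w := by
  funext l
  rw [Pi.smul_apply, cauchyTransform_apply, cauchyTransform_apply, smul_eq_mul,
    ← integral_const_mul]
  simp only [Pi.smul_apply, smul_eq_mul, mul_left_comm]

theorem planeDbar_apply (u : ℂ → ℂ) (z : ℂ) :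
    planeDbar u z = (1 / 2 : ℂ) * (fderiv ℝ u z 1 + Complex.I * fderiv ℝ u z Complex.I) := by
  simp [planeDbar, antilinearPart]

/-- The derivative of a convolution can be put on the smooth, compactly supported factor, so the
singular kernel is never differentiated. -/
theorem fderiv_cauchyTransform {w : ℂ → ℂ} (hw : ContDiff ℝ ∞ w) (hc : HasCompactSupport w)
    (l v : ℂ) : fderiv ℝ (cauchyTransform w) l v =
      ∫ t : ℂ, cauchyKernel t * fderiv ℝ w (l - t) v := by
  have h := hc.hasFDerivAt_convolution_right (ContinuousLinearMap.mul ℝ ℂ)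
    locallyIntegrable_cauchyKernel (hw.of_le (by simp)) l
  rw [← cauchyTransform_eq_convolution] at h
  have hi := (hc.fderiv ℝ).convolutionExists_right
    ((ContinuousLinearMap.mul ℝ ℂ).precompR ℂ) (μ := volume)
    locallyIntegrable_cauchyKernel (hw.continuous_fderiv (by simp)) l
  rw [h.fderiv, convolution, ContinuousLinearMap.integral_apply hi]
  rfl

/-- By this commutation a left inverse of `∂̄` on compactly supported functions is automatically a
right inverse. -/
theorem planeDbar_cauchyTransform {w : ℂ → ℂ} (hw : ContDiff ℝ ∞ w) (hc : HasCompactSupport w) :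
    planeDbar (cauchyTransform w) = cauchyTransform (planeDbar w) := by
  funext l
  have hi : ∀ v : ℂ, Integrable fun t => cauchyKernel t * fderiv ℝ w (l - t) v := fun v =>
    integrable_cauchyKernel_mul (w := fun z => fderiv ℝ w z v)
      ((hw.continuous_fderiv (by simp)).clm_apply continuous_const) (hc.fderiv_apply ℝ v) l
  rw [planeDbar_apply, fderiv_cauchyTransform hw hc, fderiv_cauchyTransform hw hc,
    cauchyTransform_apply, ← integral_const_mul, ← integral_add (hi _) ((hi _).const_mul _),
    ← integral_const_mul]
  congr 1
  funext t
  rw [planeDbar_apply]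
  ring

end CauchyTransform

end CFT

end
noncomputable section

namespace CFT

/-! ### The Cauchy–Pompeiu formula, and decay and holomorphy of the Cauchy transform -/

section CauchyPompeiu

open MeasureTheory

/-- The point of the unit circle with argument `θ`. -/
def circlePoint (θ : ℝ) : ℂ := Real.cos θ + Real.sin θ * Complex.I

theorem continuous_circlePoint : Continuous circlePoint := by
  unfold circlePoint
  fun_prop

theorem norm_circlePoint (θ : ℝ) : ‖circlePoint θ‖ = 1 := by
  simpa only [circlePoint, Complex.polarCoord_symm_apply, Complex.ofReal_one, one_mul, abs_one]
    using Complex.norm_polarCoord_symm (1, θ)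

theorem circlePoint_inv (θ : ℝ) : (circlePoint θ)⁻¹ = conj (circlePoint θ) := by
  rw [Complex.inv_def, Complex.normSq_eq_norm_sq, norm_circlePoint]
  simp

theorem hasDerivAt_circlePoint (θ : ℝ) :
    HasDerivAt circlePoint (Complex.I * circlePoint θ) θ := by
  have h1 := (Real.hasDerivAt_cos θ).ofReal_comp
  have h2 := ((Real.hasDerivAt_sin θ).ofReal_comp).mul_const Complex.I
  refine (h1.fun_add h2).congr_deriv ?_
  simp only [circlePoint, Complex.ofReal_neg]
  linear_combination -(Real.sin θ : ℂ) * Complex.I_mul_I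

theorem integrableOn_polar {h : ℝ × ℝ → ℂ} (hh : Continuous h) {R : ℝ}
    (hR : ∀ p : ℝ × ℝ, R < p.1 → h p = 0) :
    IntegrableOn h (Ioi (0 : ℝ) ×ˢ Ioo (-Real.pi) Real.pi) := by
  have h1 : IntegrableOn h (Icc 0 R ×ˢ Icc (-Real.pi) Real.pi) :=
    hh.continuousOn.integrableOn_compact (isCompact_Icc.prod isCompact_Icc)
  refine h1.of_forall_sdiff_eq_zero (measurableSet_Ioi.prod measurableSet_Ioo) ?_
  rintro p ⟨⟨hp1, hp2⟩, hp⟩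
  refine hR p (not_le.1 fun hle => hp ⟨⟨(mem_Ioi.1 hp1).le, hle⟩, hp2.1.le, hp2.2.le⟩)

/-- In polar coordinates `r t⁻¹ ∂̄g = (∂_r g + (i/r) ∂_θ g) / 2`. The radial term integrates to `-g
0` along each ray, and the angular term integrates to zero over each circle. -/
theorem integral_inv_mul_planeDbar {g : ℂ → ℂ} (hg : ContDiff ℝ ∞ g) (hc : HasCompactSupport g) :
    ∫ t : ℂ, t⁻¹ * planeDbar g t = -Real.pi * g 0 := by
  obtain ⟨R, hR⟩ := hc.isCompact.isBounded.subset_closedBall (0 : ℂ)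
  have hdg : ∀ z : ℂ, R < ‖z‖ → fderiv ℝ g z = 0 := fun z hz => by
    refine image_eq_zero_of_notMem_tsupport fun hz' => ?_
    have := hR (tsupport_fderiv_subset ℝ hz')
    rw [mem_closedBall_zero_iff] at this
    exact absurd this (not_le.2 hz)
  have hcd : Continuous (fderiv ℝ g) := hg.continuous_fderiv (by simp)
  have hd : ∀ z, HasFDerivAt g (fderiv ℝ g z) z := fun z =>
    (hg.differentiable (by simp) z).hasFDerivAt
  -- With `g` restricted to `r e^{iθ}`, `A` is the `r`-derivative and `r B` is the `θ`-derivative.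
  -- Written through `fderiv`, `B` stays continuous at `r = 0`.
  set A : ℝ × ℝ → ℂ := fun p => fderiv ℝ g (p.1 * circlePoint p.2) (circlePoint p.2) with hA
  set B : ℝ × ℝ → ℂ :=
    fun p => fderiv ℝ g (p.1 * circlePoint p.2) (Complex.I * circlePoint p.2) with hB
  have hce : Continuous fun p : ℝ × ℝ => circlePoint p.2 := continuous_circlePoint.comp continuous_snd
  have hcp : Continuous fun p : ℝ × ℝ => (p.1 : ℂ) * circlePoint p.2 :=
    (Complex.continuous_ofReal.comp continuous_fst).mul hce
  have hcA : Continuous A := (hcd.comp hcp).clm_apply hce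
  have hcB : Continuous B := (hcd.comp hcp).clm_apply (continuous_const.mul hce)
  have hzero : ∀ p : ℝ × ℝ, R < p.1 → fderiv ℝ g (p.1 * circlePoint p.2) = 0 := fun p hp => by
    refine hdg _ ?_
    rw [norm_mul, norm_circlePoint, mul_one, Complex.norm_real]
    exact hp.trans_le (le_abs_self _)
  have hiA := integrableOn_polar hcA (R := R) fun p hp => by simp [hA, hzero p hp]
  have hiB := integrableOn_polar hcB (R := R) fun p hp => by simp [hB, hzero p hp]
  have hintA : ∫ p in Ioi (0 : ℝ) ×ˢ Ioo (-Real.pi) Real.pi, A p = -(2 * Real.pi * g 0) := by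
    have h1 : ∀ θ : ℝ, ∫ r in Ioi (0 : ℝ), A (r, θ) = -g 0 := fun θ => by
      have hder : ∀ r : ℝ, HasDerivAt (fun r : ℝ => g (r * circlePoint θ)) (A (r, θ)) r := fun r => by
        have hl : HasDerivAt (fun r : ℝ => (r : ℂ) * circlePoint θ) (circlePoint θ) r := by
          simpa using (Complex.ofRealCLM.hasDerivAt (x := r)).mul_const (circlePoint θ)
        exact (hd _).comp_hasDerivAt r hl
      have hev : ∀ᶠ r : ℝ in atTop, g (r * circlePoint θ) = 0 := by
        filter_upwards [eventually_gt_atTop R, eventually_gt_atTop 0] with r hr hr0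
        refine image_eq_zero_of_notMem_tsupport fun hz => ?_
        have := hR hz
        rw [mem_closedBall_zero_iff, norm_mul, norm_circlePoint, mul_one, Complex.norm_real,
          Real.norm_of_nonneg hr0.le] at this
        exact absurd this (not_le.2 hr)
      have hint : IntegrableOn (fun r : ℝ => A (r, θ)) (Ioi 0) := by
        have hcont : Continuous fun r : ℝ => A (r, θ) := hcA.comp (by fun_prop)
        refine (hcont.continuousOn.integrableOn_compact (isCompact_Icc (a := 0) (b := R))).of_forall_sdiff_eq_zero
          measurableSet_Ioi ?_
        rintro r ⟨hr, hr'⟩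
        have : R < r := not_le.1 fun h => hr' ⟨(mem_Ioi.1 hr).le, h⟩
        simp [hA, hzero (r, θ) this]
      have := integral_Ioi_of_hasDerivAt_of_tendsto' (a := 0) (fun r _ => hder r) hint
        (tendsto_const_nhds.congr' (hev.mono fun r hr => hr.symm))
      simpa using this
    -- The order of integration is exchanged so that the inner integral runs over `r`, where the
    -- fundamental theorem of calculus applies.
    rw [Measure.volume_eq_prod, setIntegral_prod A hiA,
      MeasureTheory.integral_integral_swap (f := fun r θ => A (r, θ))
        (by rw [Measure.prod_restrict]; exact hiA)]
    simp only [h1]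
    rw [setIntegral_const, Measure.real, Real.volume_Ioo, ENNReal.toReal_ofReal (by linarith [Real.pi_pos])]
    simp only [sub_neg_eq_add, smul_neg, Complex.real_smul]
    push_cast
    ring
  have hintB : ∫ p in Ioi (0 : ℝ) ×ˢ Ioo (-Real.pi) Real.pi, B p = 0 := by
    rw [Measure.volume_eq_prod, setIntegral_prod B hiB]
    refine setIntegral_eq_zero_of_forall_eq_zero fun r hr => ?_
    have hr : 0 < r := hr
    rw [← integral_Ioc_eq_integral_Ioo, ← intervalIntegral.integral_of_le (by linarith [Real.pi_pos])]
    have hder : ∀ θ : ℝ, HasDerivAt (fun θ : ℝ => g (r * circlePoint θ)) (r * B (r, θ)) θ :=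
      fun θ => by
        have hl := (hasDerivAt_circlePoint θ).const_mul (r : ℂ)
        refine ((hd _).comp_hasDerivAt θ hl).congr_deriv ?_
        rw [← Complex.real_smul, ← Complex.real_smul, map_smul]
        simp only [hB, Complex.real_smul]
    have hcont : Continuous fun θ : ℝ => (r : ℂ) * B (r, θ) :=
      continuous_const.mul (hcB.comp (by fun_prop))
    have := intervalIntegral.integral_eq_sub_of_hasDerivAt (a := -Real.pi) (b := Real.pi)
      (fun θ _ => hder θ) (hcont.intervalIntegrable _ _)
    rw [intervalIntegral.integral_const_mul] at this
    have h0 : circlePoint Real.pi = circlePoint (-Real.pi) := by simp [circlePoint]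
    rw [h0, sub_self] at this
    exact (mul_eq_zero.1 this).resolve_left (by exact_mod_cast hr.ne')
  -- The radius cancels against the Jacobian. What remains of `t⁻¹` is `e^{-iθ}`, the conjugate of
  -- `e^{iθ}`, which antilinearity absorbs by evaluating the antilinear part of the derivative at
  -- `e^{iθ}` instead of at `1`.
  have hpol : ∀ p ∈ polarCoord.target, p.1 • ((Complex.polarCoord.symm p)⁻¹ *
      planeDbar g (Complex.polarCoord.symm p)) = (1 / 2 : ℂ) * (A p + Complex.I * B p) := by
    rintro p ⟨hp, -⟩
    have hp : 0 < p.1 := hp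
    have hp' : (p.1 : ℂ) ≠ 0 := by exact_mod_cast hp.ne'
    have hs : Complex.polarCoord.symm p = p.1 * circlePoint p.2 := by simp [circlePoint]
    have ha := antilinearPart_eq (fderiv ℝ g (p.1 * circlePoint p.2)) (circlePoint p.2)
    rw [hs, Complex.real_smul, mul_inv, mul_assoc, ← mul_assoc, mul_inv_cancel₀ hp', one_mul,
      circlePoint_inv, planeDbar, ← smul_eq_mul, ← ha]
    rfl
  rw [← Complex.integral_comp_polarCoord_symm,
    setIntegral_congr_fun polarCoord.open_target.measurableSet hpol, integral_const_mul]
  change (1 / 2 : ℂ) * ∫ p in Ioi (0 : ℝ) ×ˢ Ioo (-Real.pi) Real.pi, _ = _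
  rw [integral_add hiA (hiB.const_mul _), integral_const_mul, hintA, hintB]
  ring

/-- The Cauchy transform inverts `∂̄` on compactly supported functions. -/
theorem cauchyTransform_planeDbar {u : ℂ → ℂ} (hu : ContDiff ℝ ∞ u) (hc : HasCompactSupport u) :
    cauchyTransform (planeDbar u) = u := by
  funext l
  have hg : ContDiff ℝ ∞ fun t => u (l - t) := hu.comp (contDiff_const.sub contDiff_id)
  have hgc : HasCompactSupport fun t => u (l - t) :=
    hc.comp_homeomorph (Homeomorph.subLeft l)
  have hd : ∀ t, planeDbar (fun t => u (l - t)) t = -planeDbar u (l - t) := fun t => by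
    have h1 : HasFDerivAt (fun t => u (l - t)) (-fderiv ℝ u (l - t)) t := by
      have h2 := ((hu.differentiable (by simp) (l - t)).hasFDerivAt).comp t
        ((hasFDerivAt_id (𝕜 := ℝ) t).const_sub l)
      exact h2.congr_fderiv (by ext; simp)
    rw [planeDbar_apply, planeDbar_apply, h1.fderiv]
    simp only [_root_.neg_apply]
    ring
  -- The function `t ↦ u (l - t)` has value `u l` at `0`. The reflection changes the sign of `∂̄`,
  -- which cancels the minus sign in the formula.
  have h := integral_inv_mul_planeDbar hg hgc
  simp only [hd, sub_zero, mul_neg] at h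
  rw [integral_neg] at h
  rw [cauchyTransform_apply]
  simp only [cauchyKernel, mul_assoc]
  rw [integral_const_mul, neg_inj.1 (h.trans (by ring : _ = -(Real.pi * u l))),
    inv_mul_cancel_left₀ (by exact_mod_cast Real.pi_ne_zero)]

theorem planeDbar_hasCompactSupport {u : ℂ → ℂ} (hc : HasCompactSupport u) :
    HasCompactSupport (planeDbar u) := by
  refine (hc.fderiv ℝ).mono fun z hz hz' => hz ?_
  simp [planeDbar_apply, hz']

theorem tsupport_planeDbar_subset (u : ℂ → ℂ) : tsupport (planeDbar u) ⊆ tsupport u := by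
  have h : Function.support (planeDbar u) ⊆ Function.support (fderiv ℝ u) := fun z hz hz' => hz (by
    simp [planeDbar_apply, hz'])
  exact (closure_mono h).trans (tsupport_fderiv_subset ℝ)

/-- The Cauchy transform is a right inverse of `∂̄`. -/
theorem planeDbar_cauchyTransform_self {w : ℂ → ℂ} (hw : ContDiff ℝ ∞ w)
    (hc : HasCompactSupport w) : planeDbar (cauchyTransform w) = w := by
  rw [planeDbar_cauchyTransform hw hc, cauchyTransform_planeDbar hw hc]

theorem differentiableAt_of_planeDbar_eq_zero {u : ℂ → ℂ} {z : ℂ} (hu : DifferentiableAt ℝ u z)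
    (h : planeDbar u z = 0) : DifferentiableAt ℂ u z := by
  refine differentiableAt_complex_iff_differentiableAt_real.2 ⟨hu, ?_⟩
  rw [planeDbar_apply] at h
  rw [smul_eq_mul]
  linear_combination (-2 * Complex.I) * h + fderiv ℝ u z Complex.I * Complex.I_mul_I

/-- If the support lies in the disc of radius `R`, then `|μ - l| ≥ |l| - R` on it, so the transform
is `O(1 / (|l| - R))`. -/
theorem cauchyTransform_tendsto_cocompact {w : ℂ → ℂ} (hw : Continuous w)
    (hc : HasCompactSupport w) : Tendsto (cauchyTransform w) (cocompact ℂ) (𝓝 0) := by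
  obtain ⟨R, hR⟩ := hc.isCompact.isBounded.subset_closedBall (0 : ℂ)
  have hi : Integrable w := hw.integrable_of_hasCompactSupport hc
  have hbound : ∀ l : ℂ, R < ‖l‖ → ‖cauchyTransform w l‖ ≤
      ‖(2 * Real.pi * Complex.I)⁻¹‖ * (2 * ((∫ μ, ‖w μ‖) / (‖l‖ - R))) := by
    intro l hl
    unfold cauchyTransform
    rw [norm_mul, integral_const_mul, norm_mul]
    have h2 : ‖(-2 * Complex.I : ℂ)‖ = 2 := by simp
    rw [h2]
    gcongr
    rw [← integral_div]
    refine norm_integral_le_of_norm_le (hi.norm.div_const _) (Eventually.of_forall fun μ => ?_)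
    by_cases hμ : w μ = 0
    · simp [hμ]
    · have hμ' : ‖μ‖ ≤ R := by
        simpa using hR (subset_tsupport w hμ)
      rw [norm_div]
      have h3 : ‖l‖ - R ≤ ‖μ - l‖ := by
        have := norm_sub_norm_le l μ
        rw [norm_sub_rev] at this
        linarith
      have h4 : 0 < ‖l‖ - R := by linarith
      gcongr
  have hev : ∀ᶠ l in cocompact ℂ, R < ‖l‖ :=
    (tendsto_norm_cocompact_atTop).eventually (eventually_gt_atTop R)
  refine squeeze_zero_norm' (hev.mono hbound) ?_
  have h5 : Tendsto (fun l : ℂ => (∫ μ, ‖w μ‖) / (‖l‖ - R)) (cocompact ℂ) (𝓝 0) :=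
    Tendsto.const_div_atTop (tendsto_atTop_add_const_right _ (-R) tendsto_norm_cocompact_atTop) _
  simpa using (h5.const_mul 2).const_mul ‖(2 * Real.pi * Complex.I : ℂ)⁻¹‖

/-- The difference of two solutions of the same `∂̄` equation is entire. If both vanish at infinity,
it is zero by Liouville. Unlike `cauchyTransform_planeDbar`, this applies to primitives without
compact support, such as `f (1 - ρ)`. -/
theorem cauchyTransform_eq_of_planeDbar_eq {u w : ℂ → ℂ} (hw : ContDiff ℝ ∞ w)
    (hc : HasCompactSupport w) (hu : ContDiff ℝ ∞ u) (hu0 : Tendsto u (cocompact ℂ) (𝓝 0))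
    (h : planeDbar u = w) : cauchyTransform w = u := by
  have hC := cauchyTransform_contDiff hw hc
  have hC' := hC.differentiable (by simp)
  have hu' := hu.differentiable (by simp)
  have hd : Differentiable ℂ fun z => cauchyTransform w z - u z := fun z => by
    refine differentiableAt_of_planeDbar_eq_zero ((hC' z).sub (hu' z)) ?_
    have h1 := congrFun (planeDbar_cauchyTransform_self hw hc) z
    have h2 := congrFun h z
    rw [planeDbar_apply] at h1 h2 ⊢
    rw [fderiv_fun_sub (hC' z) (hu' z)]
    simp only [_root_.sub_apply]
    linear_combination h1 - h2
  have ht : Tendsto (fun z => cauchyTransform w z - u z) (cocompact ℂ) (𝓝 0) := by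
    simpa using (cauchyTransform_tendsto_cocompact hw.continuous hc).sub hu0
  funext z
  exact sub_eq_zero.1 (hd.apply_eq_of_tendsto_cocompact z ht)

/-- The complement of the topological support is open, and there `∂̄` of the transform is `w = 0`.
-/
theorem cauchyTransform_analyticAt {w : ℂ → ℂ} (hw : ContDiff ℝ ∞ w) (hc : HasCompactSupport w)
    {z : ℂ} (hz : z ∉ tsupport w) : AnalyticAt ℂ (cauchyTransform w) z := by
  rw [Complex.analyticAt_iff_eventually_differentiableAt]
  filter_upwards [(isClosed_tsupport w).isOpen_compl.mem_nhds hz] with y hy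
  refine differentiableAt_of_planeDbar_eq_zero
    ((cauchyTransform_contDiff hw hc).differentiable (by simp) y) ?_
  rw [planeDbar_cauchyTransform_self hw hc]
  exact image_eq_zero_of_notMem_tsupport hy

end CauchyPompeiu

end CFT

end
noncomputable section

namespace CFT

/-! ## Germs at infinity and forms on the plane -/

section PlaneRetract

variable {W : Set ℂ}

theorem extendZero_coe (f : ℂ → ℂ) (z : ℂ) : extendZero f (z : OnePoint ℂ) = f z := rfl

theorem extendZero_infty (f : ℂ → ℂ) : extendZero f OnePoint.infty = 0 := rfl

theorem extendZero_add (f g : ℂ → ℂ) : extendZero (f + g) = extendZero f + extendZero g := by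
  funext x
  induction x using OnePoint.rec with
  | infty => simp [extendZero_infty]
  | coe z => rfl

theorem extendZero_smul (c : ℂ) (f : ℂ → ℂ) : extendZero (c • f) = c • extendZero f := by
  funext x
  induction x using OnePoint.rec with
  | infty => simp [extendZero_infty]
  | coe z => rfl

theorem isOpen_compl_coe_image {K : Set ℂ} (hK : IsCompact K) :
    IsOpen ((fun z : ℂ => (z : OnePoint ℂ)) '' K)ᶜ :=
  (hK.image OnePoint.continuous_coe).isClosed.isOpen_compl

/-- In the coordinate `1/z` the limit at infinity makes the function continuous at the origin, and
the isolated singularity is removable. -/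
theorem sphereHolAt_infty_of_tendsto {f : ℂ → ℂ} (h0 : Tendsto f (cocompact ℂ) (𝓝 0))
    (hd : ∀ᶠ z in cocompact ℂ, DifferentiableAt ℂ f z) :
    SphereHolAt (extendZero f) OnePoint.infty := by
  refine ⟨fun z hz => absurd hz (OnePoint.infty_ne_coe z), fun _ => ?_⟩
  have hinv : Tendsto (fun w : ℂ => w⁻¹) (𝓝[≠] 0) (cocompact ℂ) := by
    rw [← Metric.cobounded_eq_cocompact]
    exact tendsto_inv₀_nhdsNE_zero
  have heq : ∀ w : ℂ, w ≠ 0 → extendZero f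
      (if w = 0 then OnePoint.infty else ((w⁻¹ : ℂ) : OnePoint ℂ)) = f w⁻¹ := fun w hw => by
    rw [if_neg hw, extendZero_coe]
  refine Complex.analyticAt_of_differentiable_on_punctured_nhds_of_continuousAt ?_ ?_
  · filter_upwards [hinv.eventually hd, self_mem_nhdsWithin] with w hw hw0
    have hw0 : w ≠ 0 := hw0
    refine (hw.comp w (differentiableAt_inv hw0)).congr_of_eventuallyEq ?_
    filter_upwards [isOpen_ne.mem_nhds hw0] with y hy
    exact heq y hy
  · rw [continuousAt_iff_punctured_nhds]
    simp only [if_true, extendZero_infty]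
    refine (h0.comp hinv).congr' ?_
    filter_upwards [self_mem_nhdsWithin] with w hw
    exact (heq w hw).symm

theorem isGermRep_cauchyTransform {w : ℂ → ℂ} (hw : w ∈ PlaneForm W) :
    IsGermRep W (extendZero (cauchyTransform w))
      ((fun z : ℂ => (z : OnePoint ℂ)) '' tsupport w)ᶜ where
  isOpen := isOpen_compl_coe_image hw.2.1
  subset := compl_subset_compl.2 (image_mono hw.2.2)
  vanish := rfl
  hol := by
    intro x hx
    induction x using OnePoint.rec with
    | infty =>
      refine sphereHolAt_infty_of_tendsto
        (cauchyTransform_tendsto_cocompact hw.1.continuous hw.2.1) ?_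
      filter_upwards [hw.2.1.isCompact.compl_mem_cocompact] with z hz
      exact (cauchyTransform_analyticAt hw.1 hw.2.1 hz).differentiableAt
    | coe z =>
      refine ⟨fun y hy => ?_, fun h => absurd h (OnePoint.coe_ne_infty z)⟩
      obtain rfl : z = y := OnePoint.coe_injective hy
      exact cauchyTransform_analyticAt hw.1 hw.2.1 fun hz => hx ⟨z, hz, rfl⟩

variable (W) in
/-- The map `ω ↦ [ω^↓]`. -/
def down : PlaneForm W →ₗ[ℂ] OInfty W where
  toFun w := ⟨(extendZero (cauchyTransform w.1) : OnePoint ℂ → ℂ),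
    _, _, isGermRep_cauchyTransform w.2, rfl⟩
  map_add' v w := by
    apply Subtype.ext
    change ((extendZero (cauchyTransform (v.1 + w.1)) : OnePoint ℂ → ℂ) :
      Filter.Germ (𝓝ˢ (sphereCompl W)) ℂ) = _
    rw [cauchyTransform_add v.2.1.continuous v.2.2.1 w.2.1.continuous w.2.2.1, extendZero_add]
    rfl
  map_smul' a w := by
    apply Subtype.ext
    change ((extendZero (cauchyTransform (a • w.1)) : OnePoint ℂ → ℂ) :
      Filter.Germ (𝓝ˢ (sphereCompl W)) ℂ) = _
    rw [cauchyTransform_smul, extendZero_smul]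
    rfl

theorem isDownGerm_down (w : PlaneForm W) : IsDownGerm w.1 (down W w) := rfl

theorem germ_extendZero_eq_zero {u : ℂ → ℂ} (hc : HasCompactSupport u) (hs : tsupport u ⊆ W) :
    ((extendZero u : OnePoint ℂ → ℂ) : Filter.Germ (𝓝ˢ (sphereCompl W)) ℂ) = 0 := by
  refine Filter.Germ.coe_eq.2 ?_
  refine mem_of_superset ((isOpen_compl_coe_image hc).mem_nhdsSet.2
    (compl_subset_compl.2 (image_mono hs))) fun x hx => ?_
  induction x using OnePoint.rec with
  | infty => rfl
  | coe z =>
    exact image_eq_zero_of_notMem_tsupport (f := u) fun hz => hx ⟨z, hz, rfl⟩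

/-- If `u` vanishes on an open `O` containing the complement of `W`, its support lies in the
complement of `O`. That set is compact because the sphere is compact, and it lies in `W`. Applied to
Cauchy transforms, this gives the values of the homotopy their compact support. -/
theorem compactSupport_of_germ_eq_zero {u : ℂ → ℂ}
    (h : ((extendZero u : OnePoint ℂ → ℂ) : Filter.Germ (𝓝ˢ (sphereCompl W)) ℂ) = 0) :
    HasCompactSupport u ∧ tsupport u ⊆ W := by
  obtain ⟨O, hO, hWO, hzero⟩ := mem_nhdsSet_iff_exists.1 (Filter.Germ.coe_eq.1 h)
  have hK : IsCompact ((fun z : ℂ => (z : OnePoint ℂ)) ⁻¹' Oᶜ) := by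
    refine (OnePoint.isOpenEmbedding_coe.isInducing.isCompact_preimage_iff fun x hx => ?_).2
      hO.isClosed_compl.isCompact
    induction x using OnePoint.rec with
    -- Infinity belongs to `O`, so the compact set misses it and is already compact in `ℂ`.
    | infty => exact absurd (hWO (by simp [sphereCompl])) hx
    | coe z => exact ⟨z, rfl⟩
  have hsub : Function.support u ⊆ (fun z : ℂ => (z : OnePoint ℂ)) ⁻¹' Oᶜ := fun z hz hzO =>
    hz (hzero hzO)
  have hcl := closure_minimal hsub hK.isClosed
  refine ⟨hK.of_isClosed_subset isClosed_closure hcl, hcl.trans fun z hz => ?_⟩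
  by_contra hzW
  refine hz (hWO ?_)
  rintro ⟨y, hy, hyz⟩
  exact hzW (OnePoint.coe_injective hyz ▸ hy)

variable (W) in
/-- The operator `∂̄` on compactly supported functions. -/
def planeDbarMap : PlaneForm W →ₗ[ℂ] PlaneForm W where
  toFun u := ⟨planeDbar u.1, planeDbar_contDiff u.2.1, planeDbar_hasCompactSupport u.2.2.1,
    (tsupport_planeDbar_subset _).trans u.2.2.2⟩
  map_add' u v := by
    apply Subtype.ext
    funext z
    have hu := u.2.1.differentiable (by simp) z
    have hv := v.2.1.differentiable (by simp) z
    simp only [Submodule.coe_add, Pi.add_apply, planeDbar_apply, fderiv_add hu hv,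
      _root_.add_apply]
    ring
  map_smul' a u := by
    apply Subtype.ext
    funext z
    have hu := u.2.1.differentiable (by simp) z
    simp only [Submodule.coe_smul, Pi.smul_apply, planeDbar_apply, fderiv_const_smul hu a,
      _root_.smul_apply, smul_eq_mul, RingHom.id_apply]
    ring

theorem planeDbarMap_coe (u : PlaneForm W) : (planeDbarMap W u).1 = planeDbar u.1 := rfl

/-- The transform of `∂̄u` is `u` itself, which vanishes near the complement of `W`. -/
theorem down_planeDbarMap (u : PlaneForm W) : down W (planeDbarMap W u) = 0 := by
  apply Subtype.ext
  change ((extendZero (cauchyTransform (planeDbar u.1)) : OnePoint ℂ → ℂ) :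
      Filter.Germ (𝓝ˢ (sphereCompl W)) ℂ) = 0
  rw [cauchyTransform_planeDbar u.2.1 u.2.2.1]
  exact germ_extendZero_eq_zero u.2.2.1 u.2.2.2

theorem tendsto_cocompact_of_sphereHolAt {f : OnePoint ℂ → ℂ} (h : SphereHolAt f OnePoint.infty)
    (h0 : f OnePoint.infty = 0) : Tendsto (fun z : ℂ => f z) (cocompact ℂ) (𝓝 0) := by
  have hc := (h.2 rfl).continuousAt.tendsto
  simp only [if_true, h0] at hc
  have hinv : Tendsto (fun w : ℂ => w⁻¹) (cocompact ℂ) (𝓝 0) := by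
    rw [← Metric.cobounded_eq_cocompact]
    exact tendsto_inv₀_cobounded
  refine (hc.comp hinv).congr' ?_
  have hne : ∀ᶠ z : ℂ in cocompact ℂ, z ≠ 0 := by
    filter_upwards [(isCompact_singleton (x := (0 : ℂ))).compl_mem_cocompact] with z hz
    exact hz
  filter_upwards [hne] with z hz
  simp [hz]

variable (c : LiftChoice W)

theorem LiftChoice.lift_basis (b : c.ι) :
    (c.lift (c.basis b)).1 = fun z : ℂ => -(c.rep b z * planeDbar (c.ρ b) z) := by
  simp [LiftChoice.lift]

/-- The Cauchy transform of `⌈f⌉` is `f (1 - ρ)`. -/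
theorem LiftChoice.cauchyTransform_lift_basis (b : c.ι) :
    cauchyTransform (c.lift (c.basis b)).1 = fun z : ℂ => c.rep b z * (1 - c.ρ b z) := by
  have hρ := c.ρ_smooth b
  have hΔ : ∀ z : ℂ, (z : OnePoint ℂ) ∈ c.Δ b → AnalyticAt ℂ (fun w : ℂ => c.rep b w) z :=
    fun z hz => ((c.isGermRep b).hol _ hz).1 z rfl
  have hΔc : ∀ z : ℂ, (z : OnePoint ℂ) ∉ c.Δ b → ∀ᶠ y in 𝓝 z, c.ρ b y = 1 := fun z hz =>
    (c.ρ_one b).filter_mono (nhds_le_nhdsSet (by simpa using hz))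
  -- The candidate is smooth, equals `f` near infinity and so vanishes there, and has `∂̄(f (1 - ρ))
  -- = -f ∂̄ρ` where `f` is holomorphic.
  refine cauchyTransform_eq_of_planeDbar_eq (c.lift (c.basis b)).2.1 (c.lift (c.basis b)).2.2.1
    ?_ ?_ ?_
  · rw [contDiff_iff_contDiffAt]
    intro z
    by_cases hz : (z : OnePoint ℂ) ∈ c.Δ b
    · exact (((hΔ z hz).contDiffAt (n := ∞)).restrict_scalars ℝ).mul
        (contDiffAt_const.sub hρ.contDiffAt)
    -- Outside `Δ` the values of the representative are arbitrary, but `1 - ρ` vanishes on a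
    -- neighbourhood of the point.
    · refine (contDiffAt_const (c := (0 : ℂ))).congr_of_eventuallyEq ?_
      filter_upwards [hΔc z hz] with y hy
      simp [hy]
  · have hinf : OnePoint.infty ∈ c.Δ b := (c.isGermRep b).subset (by simp [sphereCompl])
    have h0 := tendsto_cocompact_of_sphereHolAt ((c.isGermRep b).hol _ hinf)
      (c.isGermRep b).vanish
    refine h0.congr' ?_
    filter_upwards [(c.ρ_compact b).isCompact.compl_mem_cocompact] with z hz
    rw [image_eq_zero_of_notMem_tsupport hz, sub_zero, mul_one]
  · rw [c.lift_basis]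
    funext z
    by_cases hz : (z : OnePoint ℂ) ∈ c.Δ b
    · have hf := (hΔ z hz).differentiableAt
      have hf' := hf.restrictScalars ℝ
      have hρ' := hρ.differentiable (by simp) z
      have hCR := (differentiableAt_complex_iff_differentiableAt_real.1 hf).2
      rw [planeDbar_apply, planeDbar_apply, fderiv_fun_mul hf' (hρ'.const_sub 1),
        fderiv_const_sub]
      simp only [_root_.add_apply, _root_.smul_apply, _root_.neg_apply, smul_eq_mul, hCR]
      linear_combination
        (1 / 2 * (1 - c.ρ b z) * fderiv ℝ (fun w : ℂ => c.rep b w) z 1) * Complex.I_mul_I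
    · rw [planeDbar_of_eventuallyEq (c := 0), planeDbar_of_eventuallyEq (c := 1) (hΔc z hz)]
      · simp
      · filter_upwards [hΔc z hz] with y hy
        simp [hy]

/-- On basis elements the transform is `f (1 - ρ)`, which equals `f` off the support of `ρ`, an open
neighbourhood of the complement of `W`. Linearity gives the rest. -/
theorem LiftChoice.down_lift (f : OInfty W) : down W (c.lift f) = f := by
  suffices (down W).comp c.lift = LinearMap.id from LinearMap.congr_fun this f
  refine c.basis.ext fun b => Subtype.ext ?_
  change ((extendZero (cauchyTransform (c.lift (c.basis b)).1) : OnePoint ℂ → ℂ) :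
      Filter.Germ (𝓝ˢ (sphereCompl W)) ℂ) = (c.basis b).1
  rw [c.cauchyTransform_lift_basis, c.germ_eq b]
  refine Filter.Germ.coe_eq.2 ?_
  refine mem_of_superset ((isOpen_compl_coe_image (c.ρ_compact b)).mem_nhdsSet.2
    (compl_subset_compl.2 (image_mono (c.ρ_supp b)))) fun x hx => ?_
  induction x using OnePoint.rec with
  | infty => exact (c.isGermRep b).vanish.symm
  | coe z =>
    have : c.ρ b z = 0 := image_eq_zero_of_notMem_tsupport fun hz => hx ⟨z, hz, rfl⟩
    simp [extendZero_coe, this]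

theorem LiftChoice.down_sub_lift (w : PlaneForm W) : down W (w - c.lift (down W w)) = 0 := by
  rw [map_sub, c.down_lift, sub_self]

/-- The map `ω ↦ (ω - ⌈ω^↓⌉)^↓`. -/
def LiftChoice.contraction : PlaneForm W →ₗ[ℂ] PlaneForm W where
  toFun w := ⟨cauchyTransform (w - c.lift (down W w)).1,
    cauchyTransform_contDiff (w - c.lift (down W w)).2.1 (w - c.lift (down W w)).2.2.1,
    compactSupport_of_germ_eq_zero (congrArg Subtype.val (c.down_sub_lift w))⟩
  map_add' v w := by
    apply Subtype.ext
    change cauchyTransform _ = cauchyTransform _ + cauchyTransform _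
    rw [← cauchyTransform_add (v - c.lift (down W v)).2.1.continuous
      (v - c.lift (down W v)).2.2.1 (w - c.lift (down W w)).2.1.continuous
      (w - c.lift (down W w)).2.2.1, ← Submodule.coe_add, map_add, map_add]
    congr 2
    abel
  map_smul' a w := by
    apply Subtype.ext
    change cauchyTransform _ = a • cauchyTransform _
    rw [← cauchyTransform_smul, ← Submodule.coe_smul, map_smul, map_smul, smul_sub]

theorem LiftChoice.contraction_coe (w : PlaneForm W) :
    (c.contraction w).1 = cauchyTransform (w - c.lift (down W w)).1 := rfl

theorem LiftChoice.planeDbarMap_contraction (w : PlaneForm W) :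
    planeDbarMap W (c.contraction w) = w - c.lift (down W w) :=
  Subtype.ext (planeDbar_cauchyTransform_self (w - c.lift (down W w)).2.1
    (w - c.lift (down W w)).2.2.1)

/-- An exact form has zero germ, so the correction by `⌈·⌉` disappears and the transform inverts
`∂̄`. -/
theorem LiftChoice.contraction_planeDbarMap (u : PlaneForm W) :
    c.contraction (planeDbarMap W u) = u := by
  apply Subtype.ext
  rw [c.contraction_coe, down_planeDbarMap, map_zero, sub_zero, planeDbarMap_coe,
    cauchyTransform_planeDbar u.2.1 u.2.2.1]

theorem LiftChoice.contraction_lift (f : OInfty W) : c.contraction (c.lift f) = 0 := by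
  apply Subtype.ext
  rw [c.contraction_coe, c.down_lift, sub_self]
  -- The transform of the zero function is zero, as the case of the scalar `0`.
  simpa using cauchyTransform_smul 0 0

end PlaneRetract

end CFT

end
noncomputable section

namespace CFT

/-! ## Calculus in holomorphic coordinates -/

section Coordinates

/-- Holomorphic changes of coordinates are real smooth. Hence every holomorphic coordinate is also a
chart of the real structure in which smoothness of sections and forms is expressed. -/
theorem contDiffGroupoid_complex_le_real :
    contDiffGroupoid ω 𝓘(ℂ, ℂ) ≤ contDiffGroupoid ∞ 𝓘(ℝ, ℂ) := by
  rw [StructureGroupoid.le_iff]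
  intro e he
  rw [contDiffGroupoid, mem_groupoid_of_pregroupoid] at he ⊢
  have h : ∀ {f : ℂ → ℂ} {s : Set ℂ}, (contDiffPregroupoid ω 𝓘(ℂ, ℂ)).property f s →
      (contDiffPregroupoid ∞ 𝓘(ℝ, ℂ)).property f s := by
    intro f s hf
    have h1 : ContDiffOn ℂ ω f (s ∩ univ) := by simpa [contDiffPregroupoid] using hf
    have h2 : ContDiffOn ℝ ∞ f (s ∩ univ) := (h1.restrict_scalars ℝ).of_le le_top
    simpa [contDiffPregroupoid] using h2
  exact ⟨h he.1, h he.2⟩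

variable {F : Type u} [NormedAddCommGroup F] [NormedSpace ℂ F]
  {X : Type u} [TopologicalSpace X] [ChartedSpace ℂ X]

theorem HolCoord.mem_real (ξ : HolCoord X) : ξ.chart ∈ IsManifold.maximalAtlas 𝓘(ℝ, ℂ) ∞ X :=
  StructureGroupoid.maximalAtlas_mono contDiffGroupoid_complex_le_real ξ.mem

variable (X) in
theorem isManifold_real [IsManifold 𝓘(ℂ, ℂ) ω X] : IsManifold 𝓘(ℝ, ℂ) ∞ X := by
  have h : HasGroupoid X (contDiffGroupoid ω 𝓘(ℂ, ℂ)) := inferInstance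
  have := hasGroupoid_of_le h contDiffGroupoid_complex_le_real
  exact IsManifold.mk' _ _ _

theorem HolCoord.eventually_mem (ξ : HolCoord X) {x : X} (hx : x ∈ ξ.chart.source) :
    ∀ᶠ y in 𝓝 x, y ∈ ξ.chart.source := ξ.chart.open_source.mem_nhds hx

theorem HolCoord.tendsto_symm (ξ : HolCoord X) {x : X} (hx : x ∈ ξ.chart.source) :
    Tendsto ξ.chart.symm (𝓝 (ξ.chart x)) (𝓝 x) := by
  have := ξ.chart.symm.continuousAt (x := ξ.chart x) (ξ.chart.map_source hx)
  rwa [ContinuousAt, ξ.chart.left_inv hx] at this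

/-- Smoothness is defined with the preferred charts, while the frames live in the coordinate `ξ`;
this passes between the two. -/
theorem HolCoord.contMDiffAt_iff [IsManifold 𝓘(ℂ, ℂ) ω X] (ξ : HolCoord X) {x : X}
    (hx : x ∈ ξ.chart.source) {g : X → F} :
    ContMDiffAt 𝓘(ℝ, ℂ) 𝓘(ℝ, F) ∞ g x ↔
      ContDiffAt ℝ ∞ (fun z => g (ξ.chart.symm z)) (ξ.chart x) := by
  have := isManifold_real X
  constructor
  · intro h
    have h1 := contMDiffAt_symm_of_mem_maximalAtlas ξ.mem_real (ξ.chart.map_source hx)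
    have h2 := ContMDiffAt.comp (ξ.chart x) (by rwa [ξ.chart.left_inv hx]) h1
    exact h2.contDiffAt
  · intro h
    have h1 := contMDiffAt_of_mem_maximalAtlas ξ.mem_real hx
    refine (ContMDiffAt.comp x h.contMDiffAt h1).congr_of_eventuallyEq ?_
    filter_upwards [ξ.eventually_mem hx] with y hy
    simp [ξ.chart.left_inv hy]

theorem HolCoord.contDiffAt_symm {F : Type*} [NormedAddCommGroup F] [NormedSpace ℂ F]
    (ξ : HolCoord X) {x : X} (hx : x ∈ ξ.chart.source) {g : X → F} (h : ContMDiffAt 𝓘(ℂ, ℂ) 𝓘(ℂ, F) ω g x) :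
    ContDiffAt ℂ ω (fun z => g (ξ.chart.symm z)) (ξ.chart x) := by
  have h1 := contMDiffAt_symm_of_mem_maximalAtlas ξ.mem (ξ.chart.map_source hx)
  have h2 := ContMDiffAt.comp (ξ.chart x) (by rwa [ξ.chart.left_inv hx]) h1
  exact h2.contDiffAt

theorem HolCoord.mdifferentiableAt (ξ : HolCoord X) {x : X} (hx : x ∈ ξ.chart.source) :
    MDifferentiableAt 𝓘(ℂ, ℂ) 𝓘(ℂ, ℂ) ξ.chart x :=
  (contMDiffAt_of_mem_maximalAtlas ξ.mem hx).mdifferentiableAt (by simp)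

theorem HolCoord.coordDeriv_ne_zero (ξ : HolCoord X) {x : X} (hx : x ∈ ξ.chart.source) :
    coordDeriv ξ.chart x 1 ≠ 0 := by
  have hd : ξ.chart.MDifferentiable 𝓘(ℂ, ℂ) 𝓘(ℂ, ℂ) :=
    ⟨(contMDiffOn_of_mem_maximalAtlas ξ.mem).mdifferentiableOn (by simp),
      (contMDiffOn_symm_of_mem_maximalAtlas ξ.mem).mdifferentiableOn (by simp)⟩
  have hinj := hd.mfderiv_injective hx
  intro h
  exact one_ne_zero (α := ℂ) (hinj (h.trans (map_zero (coordDeriv ξ.chart x)).symm))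

theorem coordDeriv_apply (φ : X → ℂ) (x : X) (v : ℂ) :
    coordDeriv φ x v = v * coordDeriv φ x 1 := by
  simpa using (coordDeriv φ x).map_smul v 1

/-- Change of coordinates for the derivative. -/
theorem HolCoord.coordDeriv_eq (ξ : HolCoord X) {x : X} (hx : x ∈ ξ.chart.source) {φ : X → ℂ}
    (hφ : DifferentiableAt ℂ (fun z => φ (ξ.chart.symm z)) (ξ.chart x)) (v : ℂ) :
    coordDeriv φ x v =
      deriv (fun z => φ (ξ.chart.symm z)) (ξ.chart x) * coordDeriv ξ.chart x v := by
  have he : φ =ᶠ[𝓝 x] (fun z => φ (ξ.chart.symm z)) ∘ ξ.chart := by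
    filter_upwards [ξ.eventually_mem hx] with y hy
    simp [ξ.chart.left_inv hy]
  have h1 : coordDeriv φ x = (fderiv ℂ (fun z => φ (ξ.chart.symm z)) (ξ.chart x)).comp
      (coordDeriv ξ.chart x) := by
    have h2 := hφ.hasFDerivAt.hasMFDerivAt.comp x (ξ.mdifferentiableAt hx).hasMFDerivAt
    exact (h2.congr_of_eventuallyEq he).mfderiv
  rw [h1, ContinuousLinearMap.comp_apply, fderiv_eq_deriv_mul]

/-- The real and the complex models use the same charts, so the expression in charts is the same
function and only the scalars of its derivative are restricted. -/
theorem hasMFDerivAt_real {φ : X → ℂ} {x : X} (h : MDifferentiableAt 𝓘(ℂ, ℂ) 𝓘(ℂ, ℂ) φ x) :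
    HasMFDerivAt 𝓘(ℝ, ℂ) 𝓘(ℝ, ℂ) φ x ((coordDeriv φ x).restrictScalars ℝ) := by
  have h1 := h.hasMFDerivAt
  refine ⟨h1.1, ?_⟩
  exact h1.2.restrictScalars ℝ

theorem HolCoord.realDeriv_eq (ξ : HolCoord X) {x : X} (hx : x ∈ ξ.chart.source) {g : X → F}
    (hg : DifferentiableAt ℝ (fun z => g (ξ.chart.symm z)) (ξ.chart x)) :
    realDeriv g x = (fderiv ℝ (fun z => g (ξ.chart.symm z)) (ξ.chart x)).comp
      ((coordDeriv ξ.chart x).restrictScalars ℝ) := by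
  have he : g =ᶠ[𝓝 x] (fun z => g (ξ.chart.symm z)) ∘ ξ.chart := by
    filter_upwards [ξ.eventually_mem hx] with y hy
    simp [ξ.chart.left_inv hy]
  unfold realDeriv
  have h2 := (hg.hasFDerivAt.hasMFDerivAt).comp x (hasMFDerivAt_real (ξ.mdifferentiableAt hx))
  exact (h2.congr_of_eventuallyEq he).mfderiv

/-- The derivative of `ξ` is complex linear, so composing with it commutes with taking antilinear
parts. This is the identity `∂̄g = (∂g/∂ξ̄) dξ̄`. -/
theorem HolCoord.antilinearPart_realDeriv (ξ : HolCoord X) {x : X} (hx : x ∈ ξ.chart.source)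
    {g : X → F} (hg : DifferentiableAt ℝ (fun z => g (ξ.chart.symm z)) (ξ.chart x)) (v : ℂ) :
    antilinearPart (realDeriv g x) v = conj (coordDeriv ξ.chart x v) •
      antilinearPart (fderiv ℝ (fun z => g (ξ.chart.symm z)) (ξ.chart x)) 1 := by
  rw [← antilinearPart_eq, ξ.realDeriv_eq hx hg]
  have hl : coordDeriv ξ.chart x (Complex.I * v) = Complex.I * coordDeriv ξ.chart x v := by
    simpa using (coordDeriv ξ.chart x).map_smul Complex.I v
  simp only [antilinearPart, LinearMap.coe_mk, AddHom.coe_mk, ContinuousLinearMap.comp_apply,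
    ContinuousLinearMap.coe_restrictScalars', hl]

/-- By the Leibniz rule and the Cauchy–Riemann equations for `τ`, only the derivative of `f`
contributes to the antilinear part. -/
theorem antilinearPart_fderiv_smul {f : ℂ → ℂ} {τ : ℂ → F} {z : ℂ} (hf : DifferentiableAt ℝ f z)
    (hτ : DifferentiableAt ℂ τ z) :
    antilinearPart (fderiv ℝ (fun y => f y • τ y) z) 1 = planeDbar f z • τ z := by
  have hτr := hτ.restrictScalars ℝ
  have hCR := (differentiableAt_complex_iff_differentiableAt_real.1 hτ).2
  rw [fderiv_fun_smul hf hτr, planeDbar_apply]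
  simp only [antilinearPart, LinearMap.coe_mk, AddHom.coe_mk, _root_.add_apply, mul_one,
    _root_.smul_apply, ContinuousLinearMap.smulRight_apply, hCR, smul_add, smul_smul]
  match_scalars
  · linear_combination (1 / 2 * f z) * Complex.I_mul_I
  · ring

/-- The preferred chart at a point, as a holomorphic coordinate. -/
def holChartAt [IsManifold 𝓘(ℂ, ℂ) ω X] (x₀ : X) : HolCoord X := ⟨chartAt ℂ x₀, IsManifold.chart_mem_maximalAtlas x₀⟩

theorem coordChange_contDiffAt (ξ η : HolCoord X) {x : X} (hξ : x ∈ ξ.chart.source)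
    (hη : x ∈ η.chart.source) :
    ContDiffAt ℂ ω (fun z => ξ.chart (η.chart.symm z)) (η.chart x) :=
  η.contDiffAt_symm hη (contMDiffAt_of_mem_maximalAtlas ξ.mem hξ)

/-- This function is the transition factor in `dξ̄ = conj (dξ/dη) dη̄`. -/
theorem coordChange_deriv_contDiffAt (ξ η : HolCoord X) {x : X} (hξ : x ∈ ξ.chart.source)
    (hη : x ∈ η.chart.source) :
    ContDiffAt ℝ ∞ (fun z => conj (deriv (fun z => ξ.chart (η.chart.symm z)) z)) (η.chart x) := by
  have h := (coordChange_contDiffAt ξ η hξ hη).analyticAt.deriv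
  exact Complex.conjCLE.contDiff.contDiffAt.comp _ ((h.contDiffAt (n := ∞)).restrict_scalars ℝ)

theorem eventually_coordDeriv_eq (ξ η : HolCoord X) {x₀ : X} (hξ : x₀ ∈ ξ.chart.source)
    (hη : x₀ ∈ η.chart.source) : ∀ᶠ x in 𝓝 x₀, ∀ v, coordDeriv ξ.chart x v =
      deriv (fun z => ξ.chart (η.chart.symm z)) (η.chart x) * coordDeriv η.chart x v := by
  filter_upwards [ξ.eventually_mem hξ, η.eventually_mem hη] with x h1 h2 v
  exact η.coordDeriv_eq h2 ((coordChange_contDiffAt ξ η h1 h2).differentiableAt (by simp)) v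

end Coordinates

/-! ## The double is Hausdorff -/

section DoubleHausdorff

variable {M : Type u} [TopologicalSpace M] [ChartedSpace HalfPlane M]
  [HasGroupoid M conformalGroupoid]

theorem chartAt_double_source (x : Double M) :
    (chartAt ℂ x).source = Double.proj ⁻¹' (chartAt HalfPlane x.proj).source := rfl

theorem proj_eq_of_mem_chart {x y : Double M} (hy : y ∈ (chartAt ℂ x).source) :
    y.proj = (chartAt HalfPlane x.proj).symm (fold (chartAt ℂ x y)) := by
  have h := (chartAt ℂ x).left_inv hy
  conv_lhs => rw [← h]
  rfl

theorem continuous_proj : Continuous (Double.proj : Double M → M) := by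
  rw [continuous_iff_continuousAt]
  intro x
  have hx : x ∈ (chartAt ℂ x).source := mem_chart_source ℂ x
  have h1 : ContinuousAt (fun y => (chartAt HalfPlane x.proj).symm (fold (chartAt ℂ x y))) x := by
    refine ContinuousAt.comp (g := (chartAt HalfPlane x.proj).symm) ?_
      (continuous_fold.continuousAt.comp ((chartAt ℂ x).continuousAt hx))
    exact (chartAt HalfPlane x.proj).symm.continuousAt ((chartAt ℂ x).map_source hx)
  refine h1.congr ?_
  filter_upwards [(chartAt ℂ x).open_source.mem_nhds hx] with y hy
  exact (proj_eq_of_mem_chart hy).symm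

/-- The source of a chart of the double is the full preimage of a chart domain below. Two points
with the same projection therefore lie in a common chart, and points with different projections are
separated by preimages of open sets of `M`. -/
instance [T2Space M] : T2Space (Double M) where
  t2 x y hxy := by
    by_cases h : x.proj = y.proj
    · have hx : x ∈ (chartAt ℂ x).source := mem_chart_source ℂ x
      have hy : y ∈ (chartAt ℂ x).source := by
        rw [chartAt_double_source, mem_preimage, ← h]
        exact mem_chart_source HalfPlane x.proj
      obtain ⟨u, v, hu, hv, hxu, hyv, huv⟩ :=
        t2_separation fun h' => hxy ((chartAt ℂ x).injOn hx hy h')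
      exact ⟨_, _, (chartAt ℂ x).isOpen_inter_preimage hu, (chartAt ℂ x).isOpen_inter_preimage hv,
        ⟨hx, hxu⟩, ⟨hy, hyv⟩, (huv.preimage _).mono inter_subset_right inter_subset_right⟩
    · obtain ⟨u, v, hu, hv, hxu, hyv, huv⟩ := t2_separation h
      exact ⟨_, _, hu.preimage continuous_proj, hv.preimage continuous_proj, hxu, hyv,
        huv.preimage _⟩

end DoubleHausdorff

end CFT

end
noncomputable section

namespace CFT

/-! ## Sections and forms over the domain of a coordinate -/

set_option linter.unusedSectionVars false

section LocalSections

variable {F : Type u} [NormedAddCommGroup F] [NormedSpace ℂ F]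
  {X : Type u} [TopologicalSpace X] [ChartedSpace ℂ X]
  {L : X → Type u} [TopologicalSpace (TotalSpace F L)] [∀ x, AddCommGroup (L x)]
  [∀ x, Module ℂ (L x)] [∀ x, TopologicalSpace (L x)] [FiberBundle F L] [VectorBundle ℂ F L]
  {𝔞 : Type u} [AddCommGroup 𝔞] [Module ℂ 𝔞]

variable (F) in
/-- The expression of a section in the coordinate `ξ` and the local trivialisation at `x₀`. -/
def localRep (ξ : HolCoord X) (x₀ : X) (σ : ∀ x, L x) (z : ℂ) : F :=
  (trivializationAt F L x₀).linearMapAt ℂ (ξ.chart.symm z) (σ (ξ.chart.symm z))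

theorem HolCoord.eventually_symm_mem (ξ : HolCoord X) {x₀ : X} (hx₀ : x₀ ∈ ξ.chart.source) :
    ∀ᶠ z in 𝓝 (ξ.chart x₀), z ∈ ξ.chart.target ∧ ξ.chart.symm z ∈ ξ.chart.source ∧
      ξ.chart.symm z ∈ (trivializationAt F L x₀).baseSet := by
  filter_upwards [ξ.chart.open_target.mem_nhds (ξ.chart.map_source hx₀), (ξ.tendsto_symm hx₀).eventually
    ((trivializationAt F L x₀).open_baseSet.mem_nhds (mem_baseSet_trivializationAt F L x₀))]
    with z h1 h2
  exact ⟨h1, ξ.chart.map_target h1, h2⟩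

variable (T : CoordTrivialization F L 𝔞) (ξ : HolCoord X)

/-- The section `a_ξ`, without cut-off. -/
def frameSection (a : 𝔞) (x : X) : L x := T.triv ξ x (T.iso ξ a)

theorem tensorSection_of_mem {a : 𝔞} {g : ℂ → ℂ} {x : X} (hx : x ∈ ξ.chart.source) :
    tensorSection T ξ a g x = g (ξ.chart x) • frameSection T ξ a x := if_pos hx

theorem tensorSection_of_notMem {a : 𝔞} {g : ℂ → ℂ} {x : X} (hx : x ∉ ξ.chart.source) :
    tensorSection T ξ a g x = 0 := if_neg hx

/-- Factoring out `dξ̄` lets statements about forms be deduced from those about sections. -/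
theorem tensorForm_apply (a : 𝔞) (w : ℂ → ℂ) (x : X) (v : ℂ) :
    tensorForm T ξ a w x v = conj (coordDeriv ξ.chart x v) • tensorSection T ξ a w x := by
  classical
  change (if x ∈ ξ.chart.source then
    (w (ξ.chart x) * conj (coordDeriv ξ.chart x v)) • T.triv ξ x (T.iso ξ a) else 0) = _
  by_cases hx : x ∈ ξ.chart.source
  · rw [if_pos hx, tensorSection_of_mem T ξ hx, smul_smul, mul_comm]
    rfl
  · rw [if_neg hx, tensorSection_of_notMem T ξ hx, smul_zero]

theorem localRep_frameSection_contDiffAt {x₀ : X} (hx₀ : x₀ ∈ ξ.chart.source) (a : 𝔞) :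
    ContDiffAt ℂ ω (localRep F ξ x₀ (frameSection T ξ a)) (ξ.chart x₀) := by
  have h1 := (T.holomorphic ξ (T.iso ξ a)).contMDiffAt (ξ.chart.open_source.mem_nhds hx₀)
  have h2 := (contMDiffAt_section (F := F) (E := L) x₀).1 h1
  refine (ξ.contDiffAt_symm hx₀ h2).congr_of_eventuallyEq ?_
  filter_upwards [ξ.eventually_symm_mem (F := F) (L := L) hx₀] with z hz
  simp only [localRep, frameSection]
  rw [(trivializationAt F L x₀).coe_linearMapAt_of_mem hz.2.2]

theorem localRep_tensorSection {x₀ : X} (hx₀ : x₀ ∈ ξ.chart.source) (a : 𝔞) (g : ℂ → ℂ) :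
    localRep F ξ x₀ (tensorSection T ξ a g) =ᶠ[𝓝 (ξ.chart x₀)]
      fun z => g z • localRep F ξ x₀ (frameSection T ξ a) z := by
  filter_upwards [ξ.eventually_symm_mem (F := F) (L := L) hx₀] with z hz
  simp only [localRep]
  rw [tensorSection_of_mem T ξ hz.2.1, map_smul, ξ.chart.right_inv hz.1]

theorem localRep_tensorSection_contDiffAt {x₀ : X} (hx₀ : x₀ ∈ ξ.chart.source) (a : 𝔞) {g : ℂ → ℂ}
    (hg : ContDiff ℝ ∞ g) :
    ContDiffAt ℝ ∞ (localRep F ξ x₀ (tensorSection T ξ a g)) (ξ.chart x₀) :=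
  (hg.contDiffAt.smul (((localRep_frameSection_contDiffAt T ξ hx₀ a).restrict_scalars ℝ).of_le
    le_top)).congr_of_eventuallyEq (localRep_tensorSection T ξ hx₀ a g)

theorem isCompact_symm_image {g : ℂ → ℂ} (hg : g ∈ PlaneForm ξ.chart.target) :
    IsCompact (ξ.chart.symm '' tsupport g) :=
  hg.2.1.isCompact.image_of_continuousOn (ξ.chart.continuousOn_symm.mono hg.2.2)

theorem tensorSection_support {a : 𝔞} {g : ℂ → ℂ} {x : X} (hx : tensorSection T ξ a g x ≠ 0) :
    x ∈ ξ.chart.symm '' tsupport g := by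
  by_cases hxs : x ∈ ξ.chart.source
  · refine ⟨ξ.chart x, subset_tsupport g fun h => hx ?_, ξ.chart.left_inv hxs⟩
    rw [tensorSection_of_mem T ξ hxs, h, zero_smul]
  · exact absurd (tensorSection_of_notMem T ξ hxs) hx

variable [T2Space X]

/-- The support lies in the image of a compact set under the inverse coordinate. The Hausdorff
property makes this image closed, so that taking the closure does not leave it; extension by zero is
then harmless at the edge of the domain. -/
theorem tensorSection_compactSuppIn {V : Set X} (hV : ξ.chart.source ⊆ V) (a : 𝔞) {g : ℂ → ℂ}
    (hg : g ∈ PlaneForm ξ.chart.target) : CompactSuppIn V (tensorSection T ξ a g) := by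
  have hK := isCompact_symm_image ξ hg
  have hcl : closure {x | tensorSection T ξ a g x ≠ 0} ⊆ ξ.chart.symm '' tsupport g :=
    closure_minimal (fun x hx => tensorSection_support T ξ hx) hK.isClosed
  refine ⟨hK.of_isClosed_subset isClosed_closure hcl, hcl.trans ?_⟩
  rintro _ ⟨z, hz, rfl⟩
  exact hV (ξ.chart.map_target (hg.2.2 hz))

theorem tensorSection_eventually_zero {a : 𝔞} {g : ℂ → ℂ} (hg : g ∈ PlaneForm ξ.chart.target)
    {x₀ : X} (hx₀ : x₀ ∉ ξ.chart.source) : ∀ᶠ x in 𝓝 x₀, tensorSection T ξ a g x = 0 := by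
  have h := tensorSection_compactSuppIn T ξ subset_rfl a hg
  filter_upwards [isClosed_closure.isOpen_compl.mem_nhds fun hx => hx₀ (h.2 hx)] with x hx
  by_contra hne
  exact hx (subset_closure hne)

/-- Inside the domain this is the Leibniz rule with a holomorphic frame. Outside it both sides
vanish, since `∂̄` does not enlarge the closed support. -/
theorem dbarSection_tensorSection (a : 𝔞) {g : ℂ → ℂ} (hg : g ∈ PlaneForm ξ.chart.target) :
    dbarSection F L (tensorSection T ξ a g) = tensorForm T ξ a (planeDbar g) := by
  funext x
  by_cases hx : x ∈ ξ.chart.source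
  · apply LinearMap.ext
    intro v
    have hxe := mem_baseSet_trivializationAt F L x
    have hd : DifferentiableAt ℝ (localRep F ξ x (tensorSection T ξ a g)) (ξ.chart x) :=
      (localRep_tensorSection_contDiffAt T ξ hx a hg.1).differentiableAt (by simp)
    have h1 := ξ.antilinearPart_realDeriv hx
      (g := fun y => (trivializationAt F L x).linearMapAt ℂ y (tensorSection T ξ a g y)) hd v
    have h2 : fderiv ℝ (localRep F ξ x (tensorSection T ξ a g)) (ξ.chart x) =
        fderiv ℝ (fun z => g z • localRep F ξ x (frameSection T ξ a) z) (ξ.chart x) :=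
      (localRep_tensorSection T ξ hx a g).fderiv_eq
    have h3 := antilinearPart_fderiv_smul (hg.1.differentiable (by simp) (ξ.chart x))
      ((localRep_frameSection_contDiffAt T ξ hx a).differentiableAt (by simp))
    have h4 : localRep F ξ x (frameSection T ξ a) (ξ.chart x) =
        (trivializationAt F L x).linearMapAt ℂ x (frameSection T ξ a x) := by
      unfold localRep
      rw [ξ.chart.left_inv hx]
    unfold dbarSection
    rw [LinearMap.comp_apply, h1]
    change (trivializationAt F L x).symmₗ ℂ x (_ • antilinearPart
      (fderiv ℝ (localRep F ξ x (tensorSection T ξ a g)) (ξ.chart x)) 1) = _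
    rw [h2, h3, h4, map_smul, map_smul, (trivializationAt F L x).symmₗ_linearMapAt hxe,
      tensorForm_apply, tensorSection_of_mem T ξ hx]
  · have h0 := tensorSection_compactSuppIn T ξ subset_rfl a hg
    have h1 : dbarSection F L (tensorSection T ξ a g) x = 0 := by
      by_contra h
      exact hx (h0.2 (dbarSection_supp _ h))
    rw [h1]
    apply LinearMap.ext
    intro v
    rw [tensorForm_apply, tensorSection_of_notMem T ξ hx, smul_zero]
    rfl

variable [IsManifold 𝓘(ℂ, ℂ) ω X]

theorem tensorSection_mem_Omega0 {V : Set X} (hV : ξ.chart.source ⊆ V) (a : 𝔞) {g : ℂ → ℂ}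
    (hg : g ∈ PlaneForm ξ.chart.target) : tensorSection T ξ a g ∈ Omega0 F L V := by
  refine ⟨fun x₀ => ?_, tensorSection_compactSuppIn T ξ hV a hg⟩
  by_cases hx₀ : x₀ ∈ ξ.chart.source
  · exact (ξ.contMDiffAt_iff hx₀).2 (localRep_tensorSection_contDiffAt T ξ hx₀ a hg.1)
  · refine (contMDiffAt_const (c := (0 : F))).congr_of_eventuallyEq ?_
    filter_upwards [tensorSection_eventually_zero T ξ (a := a) hg hx₀] with x hx
    rw [hx, map_zero]

theorem tensorForm_mem_Omega1 {V : Set X} (hV : ξ.chart.source ⊆ V) (a : 𝔞) {w : ℂ → ℂ}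
    (hw : w ∈ PlaneForm ξ.chart.target) : tensorForm T ξ a w ∈ Omega1 F L V := by
  have hzero : ∀ x, tensorSection T ξ a w x = 0 → tensorForm T ξ a w x = 0 := fun x hx => by
    apply LinearMap.ext
    intro v
    rw [tensorForm_apply, hx, smul_zero]
    rfl
  refine ⟨fun x₀ => ?_, (tensorSection_compactSuppIn T ξ hV a hw).mono_supp fun x hx =>
    subset_closure fun h => hx (hzero x h)⟩
  by_cases hx₀ : x₀ ∈ ξ.chart.source
  · set η := holChartAt x₀ with hη
    have hx₀' : x₀ ∈ η.chart.source := mem_chart_source ℂ x₀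
    -- The coefficient is taken with respect to the preferred chart `η`, which `IsSmoothForm` uses,
    -- hence the factor `conj (dξ/dη)`.
    refine ⟨fun x => conj (deriv (fun z => ξ.chart (η.chart.symm z)) (η.chart x)) •
      (trivializationAt F L x₀).linearMapAt ℂ x (tensorSection T ξ a w x), ?_, ?_⟩
    · rw [η.contMDiffAt_iff hx₀']
      have h1 := coordChange_deriv_contDiffAt ξ η hx₀ hx₀'
      have h2 := (η.contMDiffAt_iff hx₀').1 ((tensorSection_mem_Omega0 T ξ hV a hw).1 x₀)
      refine (h1.smul h2).congr_of_eventuallyEq ?_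
      filter_upwards [η.chart.open_target.mem_nhds (η.chart.map_source hx₀')] with z hz
      rw [η.chart.right_inv hz]
      rfl
    · filter_upwards [eventually_coordDeriv_eq ξ η hx₀ hx₀'] with x hx v
      rw [tensorForm_apply, map_smul, hx, map_mul, mul_comm, mul_smul]
      rfl
  · refine ⟨0, contMDiffAt_const, ?_⟩
    filter_upwards [tensorSection_eventually_zero T ξ (a := a) hw hx₀] with x hx v
    rw [hzero x hx]
    simp

end LocalSections

end CFT

end
noncomputable section

namespace CFT

set_option linter.unusedSectionVars false

/-! ## Coefficients of sections with respect to a frame -/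

section Coefficients

variable {F : Type u} [NormedAddCommGroup F] [NormedSpace ℂ F]
  {X : Type u} [TopologicalSpace X] [ChartedSpace ℂ X]
  {L : X → Type u} [TopologicalSpace (TotalSpace F L)] [∀ x, AddCommGroup (L x)]
  [∀ x, Module ℂ (L x)] [∀ x, TopologicalSpace (L x)] [FiberBundle F L] [VectorBundle ℂ F L]
  {𝔞 : Type u} [AddCommGroup 𝔞] [Module ℂ 𝔞]
  (T : CoordTrivialization F L 𝔞) (ξ : HolCoord X)

/-- The isomorphism `𝔞 → 𝔞_ξ → L_x`. -/
def frameEquiv {x : X} (hx : x ∈ ξ.chart.source) : 𝔞 ≃ₗ[ℂ] L x :=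
  (T.iso ξ).trans (LinearEquiv.ofBijective (T.triv ξ x) (T.bijective ξ x hx))

theorem frameEquiv_apply {x : X} (hx : x ∈ ξ.chart.source) (a : 𝔞) :
    frameEquiv T ξ hx a = frameSection T ξ a x := rfl

variable {ι : Type*} [Fintype ι] (e : Module.Basis ι ℂ 𝔞)

open Classical in
/-- The coefficients of a section with respect to the frame given by a basis of `𝔞`. -/
def frameCoeff (σ : ∀ x, L x) (k : ι) (z : ℂ) : ℂ :=
  if hz : z ∈ ξ.chart.target then
    e.equivFun ((frameEquiv T ξ (ξ.chart.map_target hz)).symm (σ (ξ.chart.symm z))) k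
  else 0

theorem frameCoeff_of_mem (σ : ∀ x, L x) (k : ι) {z : ℂ} (hz : z ∈ ξ.chart.target) :
    frameCoeff T ξ e σ k z =
      e.equivFun ((frameEquiv T ξ (ξ.chart.map_target hz)).symm (σ (ξ.chart.symm z))) k :=
  dif_pos hz

theorem sum_frameCoeff (σ : ∀ x, L x) {x : X} (hx : x ∈ ξ.chart.source) :
    ∑ k, tensorSection T ξ (e k) (frameCoeff T ξ e σ k) x = σ x := by
  have hz := ξ.chart.map_source hx
  have hx' := ξ.chart.left_inv hx
  -- The fibre `L y` depends on the point, so the base point `ξ⁻¹(ξ x)` is replaced by a variable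
  -- `y` before it is identified with `x`.
  have key : ∀ y (hy : y ∈ ξ.chart.source), y = x →
      ∑ k, e.equivFun ((frameEquiv T ξ hy).symm (σ y)) k • frameSection T ξ (e k) x = σ x := by
    rintro y hy rfl
    simp only [← frameEquiv_apply T ξ hy, ← map_smul]
    rw [← map_sum, e.sum_equivFun, LinearEquiv.apply_symm_apply]
  rw [← key _ (ξ.chart.map_target hz) hx']
  refine Finset.sum_congr rfl fun k _ => ?_
  rw [tensorSection_of_mem T ξ hx, frameCoeff_of_mem T ξ e σ k hz]

/-- The frame in the coordinate `ξ` and the local trivialisation at `x₀`, as a linear map. -/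
def frameMap (x₀ : X) (z : ℂ) : (ι → ℂ) →L[ℂ] F :=
  ∑ k, (ContinuousLinearMap.proj (R := ℂ) (φ := fun _ : ι => ℂ) k).smulRight
    (localRep F ξ x₀ (frameSection T ξ (e k)) z)

theorem frameMap_contDiffAt {x₀ : X} (hx₀ : x₀ ∈ ξ.chart.source) :
    ContDiffAt ℂ ω (frameMap T ξ e x₀) (ξ.chart x₀) := by
  unfold frameMap
  refine ContDiffAt.sum fun k _ => ?_
  exact contDiffAt_const.smulRight (localRep_frameSection_contDiffAt T ξ hx₀ (e k))

theorem frameMap_apply {x₀ : X} {z : ℂ} (hz : ξ.chart.symm z ∈ ξ.chart.source) (v : ι → ℂ) :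
    frameMap T ξ e x₀ z v = (trivializationAt F L x₀).linearMapAt ℂ (ξ.chart.symm z)
      (frameEquiv T ξ hz (e.equivFun.symm v)) := by
  rw [Module.Basis.equivFun_symm_apply, map_sum, map_sum]
  simp [frameMap, localRep, frameEquiv_apply]

theorem frameMap_isInvertible {x₀ : X} {z : ℂ} (hz : ξ.chart.symm z ∈ ξ.chart.source)
    (hz' : ξ.chart.symm z ∈ (trivializationAt F L x₀).baseSet) :
    (frameMap T ξ e x₀ z).IsInvertible := by
  let E : (ι → ℂ) ≃ₗ[ℂ] F := (e.equivFun.symm.trans (frameEquiv T ξ hz)).trans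
    ((trivializationAt F L x₀).linearEquivAt ℂ _ hz')
  -- The model fibre inherits finite dimension from the coefficient space, which makes the algebraic
  -- isomorphism a continuous one.
  have : FiniteDimensional ℂ F := E.finiteDimensional
  refine ⟨E.toContinuousLinearEquiv, ?_⟩
  refine ContinuousLinearMap.ext fun v => ?_
  rw [frameMap_apply T ξ e hz, (trivializationAt F L x₀).linearMapAt_def_of_mem hz']
  rfl

/-- The coefficient vector is the inverse of the frame matrix applied to the local expression of
`σ`. The frame matrix is holomorphic in `z`, and inversion is smooth at invertible maps, so
smoothness passes from `σ` to its coefficients. -/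
theorem frameCoeff_contDiffAt {σ : ∀ x, L x} {x₀ : X} (hx₀ : x₀ ∈ ξ.chart.source)
    (hσ : ContDiffAt ℝ ∞ (localRep F ξ x₀ σ) (ξ.chart x₀)) (k : ι) :
    ContDiffAt ℝ ∞ (frameCoeff T ξ e σ k) (ξ.chart x₀) := by
  have hev := ξ.eventually_symm_mem (F := F) (L := L) hx₀
  have h0 := hev.self_of_nhds
  have hinv : ContDiffAt ℂ ω (fun z => (frameMap T ξ e x₀ z).inverse) (ξ.chart x₀) := by
    obtain ⟨E, hE⟩ := frameMap_isInvertible T ξ e h0.2.1 h0.2.2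
    refine ContDiffAt.comp (g := ContinuousLinearMap.inverse) _ ?_ (frameMap_contDiffAt T ξ e hx₀)
    rw [← hE]
    exact contDiffAt_map_inverse E
  have hinv' : ContDiffAt ℝ ∞
      (fun z => ((frameMap T ξ e x₀ z).inverse).restrictScalars ℝ) (ξ.chart x₀) :=
    (ContinuousLinearMap.restrictScalarsL ℂ F (ι → ℂ) ℝ ℝ).contDiff.contDiffAt.comp (ξ.chart x₀)
      ((hinv.restrict_scalars ℝ).of_le le_top)
  have h1 : ContDiffAt ℝ ∞ (fun z => (frameMap T ξ e x₀ z).inverse (localRep F ξ x₀ σ z) k)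
      (ξ.chart x₀) :=
    contDiffAt_pi.1 (hinv'.clm_apply hσ) k
  refine h1.congr_of_eventuallyEq ?_
  filter_upwards [hev] with z hz
  rw [frameCoeff_of_mem T ξ e σ k hz.1]
  refine congrFun (Eq.symm ?_) k
  rw [(frameMap_isInvertible T ξ e hz.2.1 hz.2.2).inverse_apply_eq, frameMap_apply T ξ e hz.2.1,
    LinearEquiv.symm_apply_apply, LinearEquiv.apply_symm_apply]
  rfl

theorem frameCoeff_mem_planeForm {σ : ∀ x, L x}
    (hσ : ∀ x ∈ ξ.chart.source, ContDiffAt ℝ ∞ (localRep F ξ x σ) (ξ.chart x))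
    {K : Set X} (hK : IsCompact K) (hKs : K ⊆ ξ.chart.source)
    (h0 : ∀ x ∈ ξ.chart.source, x ∉ K → σ x = 0) (k : ι) :
    frameCoeff T ξ e σ k ∈ PlaneForm ξ.chart.target := by
  have hK' : IsCompact (ξ.chart '' K) := hK.image_of_continuousOn (ξ.chart.continuousOn.mono hKs)
  have hsub : Function.support (frameCoeff T ξ e σ k) ⊆ ξ.chart '' K := by
    intro z hz
    by_cases hzt : z ∈ ξ.chart.target
    · refine ⟨ξ.chart.symm z, ?_, ξ.chart.right_inv hzt⟩
      by_contra hn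
      refine hz ?_
      rw [frameCoeff_of_mem T ξ e σ k hzt, h0 _ (ξ.chart.map_target hzt) hn]
      simp
    · exact absurd (dif_neg hzt) hz
  have hcl := closure_minimal hsub hK'.isClosed
  have hKt : ξ.chart '' K ⊆ ξ.chart.target := by
    rintro _ ⟨x, hx, rfl⟩
    exact ξ.chart.map_source (hKs hx)
  refine ⟨?_, hK'.of_isClosed_subset isClosed_closure hcl, hcl.trans hKt⟩
  rw [contDiff_iff_contDiffAt]
  intro z
  by_cases hz : z ∈ ξ.chart '' K
  · obtain ⟨x, hx, rfl⟩ := hz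
    exact frameCoeff_contDiffAt T ξ e (hKs hx) (hσ x (hKs hx)) k
  · refine (contDiffAt_const (c := (0 : ℂ))).congr_of_eventuallyEq ?_
    filter_upwards [hK'.isClosed.isOpen_compl.mem_nhds hz] with y hy
    by_contra hne
    exact hy (hsub hne)

end Coefficients

/-! ## Tensors as sections and forms -/

section TensorMaps

variable {F : Type u} [NormedAddCommGroup F] [NormedSpace ℂ F]
  {X : Type u} [TopologicalSpace X] [ChartedSpace ℂ X] [IsManifold 𝓘(ℂ, ℂ) ω X] [T2Space X]
  {L : X → Type u} [TopologicalSpace (TotalSpace F L)] [∀ x, AddCommGroup (L x)]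
  [∀ x, Module ℂ (L x)] [∀ x, TopologicalSpace (L x)] [FiberBundle F L] [VectorBundle ℂ F L]
  {𝔞 : Type u} [AddCommGroup 𝔞] [Module ℂ 𝔞]
  (T : CoordTrivialization F L 𝔞) (ξ : HolCoord X) {V : Set X} (hV : ξ.chart.source ⊆ V)

theorem tensorSection_bilinear (x : X) :
    (∀ (a a' : 𝔞) (g : ℂ → ℂ), tensorSection T ξ (a + a') g x =
      tensorSection T ξ a g x + tensorSection T ξ a' g x) ∧
    (∀ (c : ℂ) (a : 𝔞) (g : ℂ → ℂ), tensorSection T ξ (c • a) g x =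
      c • tensorSection T ξ a g x) ∧
    (∀ (a : 𝔞) (g g' : ℂ → ℂ), tensorSection T ξ a (g + g') x =
      tensorSection T ξ a g x + tensorSection T ξ a g' x) ∧
    (∀ (c : ℂ) (a : 𝔞) (g : ℂ → ℂ), tensorSection T ξ a (c • g) x =
      c • tensorSection T ξ a g x) := by
  by_cases hx : x ∈ ξ.chart.source
  · simp only [tensorSection_of_mem T ξ hx, frameSection]
    refine ⟨fun a a' g => ?_, fun c a g => ?_, fun a g g' => ?_, fun c a g => ?_⟩
    · rw [map_add, map_add, smul_add]
    · rw [map_smul, map_smul, smul_comm]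
    · rw [Pi.add_apply, add_smul]
    · rw [Pi.smul_apply, smul_eq_mul, mul_smul]
  · simp [tensorSection_of_notMem T ξ hx]

/-- The linear map `a ⊗ g ↦ a_ξ ⊗ ξ^* g`. -/
def sectionMap : 𝔞 ⊗[ℂ] PlaneForm ξ.chart.target →ₗ[ℂ] Omega0 F L V :=
  TensorProduct.lift (LinearMap.mk₂ ℂ
    (fun a g => ⟨tensorSection T ξ a g.1, tensorSection_mem_Omega0 T ξ hV a g.2⟩)
    (fun a a' g => Subtype.ext (funext fun x => (tensorSection_bilinear T ξ x).1 a a' g.1))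
    (fun c a g => Subtype.ext (funext fun x => (tensorSection_bilinear T ξ x).2.1 c a g.1))
    (fun a g g' => Subtype.ext (funext fun x =>
      (tensorSection_bilinear T ξ x).2.2.1 a g.1 g'.1))
    (fun c a g => Subtype.ext (funext fun x => (tensorSection_bilinear T ξ x).2.2.2 c a g.1)))

theorem sectionMap_tmul (a : 𝔞) (g : PlaneForm ξ.chart.target) :
    (sectionMap T ξ hV (a ⊗ₜ g)).1 = tensorSection T ξ a g.1 := rfl

theorem tensorForm_bilinear (x : X) :
    (∀ (a a' : 𝔞) (g : ℂ → ℂ), tensorForm T ξ (a + a') g x =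
      tensorForm T ξ a g x + tensorForm T ξ a' g x) ∧
    (∀ (c : ℂ) (a : 𝔞) (g : ℂ → ℂ), tensorForm T ξ (c • a) g x =
      c • tensorForm T ξ a g x) ∧
    (∀ (a : 𝔞) (g g' : ℂ → ℂ), tensorForm T ξ a (g + g') x =
      tensorForm T ξ a g x + tensorForm T ξ a g' x) ∧
    (∀ (c : ℂ) (a : 𝔞) (g : ℂ → ℂ), tensorForm T ξ a (c • g) x =
      c • tensorForm T ξ a g x) := by
  obtain ⟨h1, h2, h3, h4⟩ := tensorSection_bilinear T ξ x
  refine ⟨fun a a' g => LinearMap.ext fun v => ?_, fun c a g => LinearMap.ext fun v => ?_,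
    fun a g g' => LinearMap.ext fun v => ?_, fun c a g => LinearMap.ext fun v => ?_⟩
  · simp only [LinearMap.add_apply, tensorForm_apply, h1, smul_add]
  · simp only [LinearMap.smul_apply, tensorForm_apply, h2, smul_comm c]
  · simp only [LinearMap.add_apply, tensorForm_apply, h3, smul_add]
  · simp only [LinearMap.smul_apply, tensorForm_apply, h4, smul_comm c]

/-- The linear map `a ⊗ w ↦ a_ξ ⊗ ξ^* (w dλ̄)`. -/
def formMap : 𝔞 ⊗[ℂ] PlaneForm ξ.chart.target →ₗ[ℂ] Omega1 F L V :=
  TensorProduct.lift (LinearMap.mk₂ ℂ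
    (fun a g => ⟨tensorForm T ξ a g.1, tensorForm_mem_Omega1 T ξ hV a g.2⟩)
    (fun a a' g => Subtype.ext (funext fun x => (tensorForm_bilinear T ξ x).1 a a' g.1))
    (fun c a g => Subtype.ext (funext fun x => (tensorForm_bilinear T ξ x).2.1 c a g.1))
    (fun a g g' => Subtype.ext (funext fun x => (tensorForm_bilinear T ξ x).2.2.1 a g.1 g'.1))
    (fun c a g => Subtype.ext (funext fun x => (tensorForm_bilinear T ξ x).2.2.2 c a g.1)))

theorem formMap_tmul (a : 𝔞) (w : PlaneForm ξ.chart.target) :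
    (formMap T ξ hV (a ⊗ₜ w)).1 = tensorForm T ξ a w.1 := rfl

/-- The same tensor defines a form and a section, and the form is `dξ̄` times the section.
Injectivity and surjectivity for forms reduce in this way to sections. -/
theorem formMap_apply (t : 𝔞 ⊗[ℂ] PlaneForm ξ.chart.target) (x : X) (v : ℂ) :
    (formMap T ξ hV t).1 x v = conj (coordDeriv ξ.chart x v) • (sectionMap T ξ hV t).1 x := by
  induction t using TensorProduct.induction_on with
  | zero => simp
  | tmul a w => rw [formMap_tmul, sectionMap_tmul, tensorForm_apply]
  | add s t hs ht =>
    rw [map_add, map_add]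
    change (formMap T ξ hV s).1 x v + (formMap T ξ hV t).1 x v =
      _ • ((sectionMap T ξ hV s).1 x + (sectionMap T ξ hV t).1 x)
    rw [hs, ht, smul_add]

theorem sectionMap_of_notMem (t : 𝔞 ⊗[ℂ] PlaneForm ξ.chart.target) {x : X}
    (hx : x ∉ ξ.chart.source) : (sectionMap T ξ hV t).1 x = 0 := by
  induction t using TensorProduct.induction_on with
  | zero => simp
  | tmul a w => exact tensorSection_of_notMem T ξ hx
  | add s t hs ht =>
    rw [map_add]
    change (sectionMap T ξ hV s).1 x + (sectionMap T ξ hV t).1 x = 0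
    rw [hs, ht, add_zero]

theorem sectionMap_sum {ι : Type*} [Fintype ι] (a : ι → 𝔞) (g : ι → PlaneForm ξ.chart.target)
    (x : X) : (sectionMap T ξ hV (∑ k, a k ⊗ₜ g k)).1 x =
      ∑ k, tensorSection T ξ (a k) (g k).1 x := by
  rw [map_sum, Submodule.coe_sum, Finset.sum_apply]
  rfl

variable [FiniteDimensional ℂ 𝔞]

/-- Expanded in a basis of `𝔞`, the tensor has finitely many coefficient functions. They vanish at
each point because the frame is a basis of the fibre there. -/
theorem eq_zero_of_sectionMap_eq_zero {t : 𝔞 ⊗[ℂ] PlaneForm ξ.chart.target}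
    (h : ∀ x ∈ ξ.chart.source, (sectionMap T ξ hV t).1 x = 0) : t = 0 := by
  let e := Module.finBasis ℂ 𝔞
  obtain ⟨w, rfl⟩ := TensorProduct.eq_repr_basis_left e t
  rw [Finsupp.sum_fintype _ _ (fun k => TensorProduct.tmul_zero _ _)] at h ⊢
  have hw : ∀ k, w k = 0 := by
    intro k
    apply Subtype.ext
    funext z
    by_cases hz : z ∈ ξ.chart.target
    · have hx := ξ.chart.map_target hz
      have h1 := h _ hx
      rw [sectionMap_sum] at h1
      simp only [tensorSection_of_mem T ξ hx, ξ.chart.right_inv hz,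
        ← frameEquiv_apply T ξ hx, ← map_smul] at h1
      rw [← map_sum, LinearEquiv.map_eq_zero_iff] at h1
      exact linearIndependent_iff'.1 e.linearIndependent Finset.univ (fun k => (w k).1 z) h1 k
        (Finset.mem_univ k)
    · exact image_eq_zero_of_notMem_tsupport fun hz' => hz ((w k).2.2.2 hz')
  simp [hw]

/-- The frame coefficients of `σ` are functions in `PlaneForm`; since `𝔞` has a finite basis, they
assemble into a tensor. -/
theorem exists_sectionMap_eq {σ : ∀ x, L x}
    (hσ : ∀ x ∈ ξ.chart.source, ContDiffAt ℝ ∞ (localRep F ξ x σ) (ξ.chart x))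
    {K : Set X} (hK : IsCompact K) (hKs : K ⊆ ξ.chart.source)
    (h0 : ∀ x ∈ ξ.chart.source, x ∉ K → σ x = 0) :
    ∃ t : 𝔞 ⊗[ℂ] PlaneForm ξ.chart.target,
      ∀ x ∈ ξ.chart.source, (sectionMap T ξ hV t).1 x = σ x := by
  let e := Module.finBasis ℂ 𝔞
  refine ⟨∑ k, e k ⊗ₜ ⟨frameCoeff T ξ e σ k, frameCoeff_mem_planeForm T ξ e hσ hK hKs h0 k⟩,
    fun x hx => ?_⟩
  rw [sectionMap_sum]
  exact sum_frameCoeff T ξ e σ hx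

end TensorMaps

end CFT

end
noncomputable section

namespace CFT

set_option linter.unusedSectionVars false

/-! ## Sections and forms over a union of coordinate domains -/

section Global

variable {F : Type u} [NormedAddCommGroup F] [NormedSpace ℂ F]
  {X : Type u} [TopologicalSpace X] [ChartedSpace ℂ X]
  {V : Set X} (ξ : BoundedCoords V)

theorem BoundedCoords.source_subset (j : Fin ξ.m) : (ξ.coord j).chart.source ⊆ V := by
  conv_rhs => rw [← ξ.iUnion_eq]
  exact subset_iUnion (fun j => (ξ.coord j).chart.source) j

theorem BoundedCoords.exists_mem {x : X} (hx : x ∈ V) : ∃ j, x ∈ (ξ.coord j).chart.source := by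
  rw [← ξ.iUnion_eq] at hx
  exact mem_iUnion.1 hx

theorem BoundedCoords.notMem_of_ne {x : X} {j k : Fin ξ.m} (hx : x ∈ (ξ.coord j).chart.source)
    (h : k ≠ j) : x ∉ (ξ.coord k).chart.source := fun hk =>
  (ξ.disjoint h).le_bot ⟨hk, hx⟩

/-- The part of a compact subset of `V` in one of the coordinate domains is compact. -/
theorem BoundedCoords.isCompact_inter {K : Set X} (hK : IsCompact K) (hKV : K ⊆ V) (j : Fin ξ.m) :
    IsCompact (K ∩ (ξ.coord j).chart.source) := by
  -- Within `V` the domain of `ξ_j` is the complement of the other domains, so the intersection is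
  -- `K` minus an open set.
  have h : K ∩ (ξ.coord j).chart.source =
      K \ ⋃ k ∈ {k | k ≠ j}, (ξ.coord k).chart.source := by
    ext x
    simp only [mem_inter_iff, Set.mem_sdiff, mem_iUnion, mem_ofPred_eq, exists_prop, not_exists,
      not_and]
    refine and_congr_right fun hx => ⟨fun hj k hk => ξ.notMem_of_ne hj hk, fun h => ?_⟩
    obtain ⟨k, hk⟩ := ξ.exists_mem (hKV hx)
    by_cases hkj : k = j
    · exact hkj ▸ hk
    · exact absurd hk (h k hkj)
  rw [h]
  exact IsCompact.diff hK (isOpen_biUnion fun k _ => (ξ.coord k).chart.open_source)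

variable [IsManifold 𝓘(ℂ, ℂ) ω X] [T2Space X]
  {L : X → Type u} [TopologicalSpace (TotalSpace F L)] [∀ x, AddCommGroup (L x)]
  [∀ x, Module ℂ (L x)] [∀ x, TopologicalSpace (L x)] [FiberBundle F L] [VectorBundle ℂ F L]
  {𝔞 : Type u} [AddCommGroup 𝔞] [Module ℂ 𝔞] (T : CoordTrivialization F L 𝔞)


/-- The sum over the coordinate domains of the maps `a ⊗ g ↦ a_ξ ⊗ ξ^* g`. -/
def totalSection : (∀ j, 𝔞 ⊗[ℂ] PlaneForm (ξ.image j)) →ₗ[ℂ] Omega0 F L V :=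
  ∑ j, (sectionMap T (ξ.coord j) (ξ.source_subset j)).comp (LinearMap.proj j)

/-- The sum over the coordinate domains of the maps `a ⊗ w ↦ a_ξ ⊗ ξ^* (w dλ̄)`. -/
def totalForm : (∀ j, 𝔞 ⊗[ℂ] PlaneForm (ξ.image j)) →ₗ[ℂ] Omega1 F L V :=
  ∑ j, (formMap T (ξ.coord j) (ξ.source_subset j)).comp (LinearMap.proj j)

variable (t : ∀ j, 𝔞 ⊗[ℂ] PlaneForm (ξ.image j))

theorem totalSection_apply (x : X) : (totalSection ξ T t).1 x =
    ∑ j, (sectionMap T (ξ.coord j) (ξ.source_subset j) (t j)).1 x := by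
  simp only [totalSection, LinearMap.sum_apply, LinearMap.comp_apply, LinearMap.proj_apply]
  rw [Submodule.coe_sum, Finset.sum_apply]

theorem totalSection_of_mem {x : X} {j : Fin ξ.m} (hx : x ∈ (ξ.coord j).chart.source) :
    (totalSection ξ T t).1 x = (sectionMap T (ξ.coord j) (ξ.source_subset j) (t j)).1 x := by
  rw [totalSection_apply]
  exact Finset.sum_eq_single j (fun k _ hk => sectionMap_of_notMem T _ _ _ (ξ.notMem_of_ne hx hk))
    fun h => absurd (Finset.mem_univ j) h

theorem totalForm_apply (x : X) (v : ℂ) : (totalForm ξ T t).1 x v =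
    ∑ j, conj (coordDeriv (ξ.coord j).chart x v) •
      (sectionMap T (ξ.coord j) (ξ.source_subset j) (t j)).1 x := by
  simp only [totalForm, LinearMap.sum_apply, LinearMap.comp_apply, LinearMap.proj_apply]
  rw [Submodule.coe_sum, Finset.sum_apply, LinearMap.sum_apply]
  simp only [formMap_apply]

theorem totalForm_of_mem {x : X} {j : Fin ξ.m} (hx : x ∈ (ξ.coord j).chart.source) (v : ℂ) :
    (totalForm ξ T t).1 x v = conj (coordDeriv (ξ.coord j).chart x v) •
      (sectionMap T (ξ.coord j) (ξ.source_subset j) (t j)).1 x := by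
  rw [totalForm_apply]
  refine Finset.sum_eq_single j (fun k _ hk => ?_) fun h => absurd (Finset.mem_univ j) h
  rw [sectionMap_of_notMem T _ _ _ (ξ.notMem_of_ne hx hk), smul_zero]

theorem totalForm_single [DecidableEq (Fin ξ.m)] (j : Fin ξ.m) (a : 𝔞)
    (w : PlaneForm (ξ.image j)) :
    (totalForm ξ T (Pi.single j (a ⊗ₜ w))).1 = tensorForm T (ξ.coord j) a w.1 := by
  simp only [totalForm, LinearMap.sum_apply, LinearMap.comp_apply, LinearMap.proj_apply]
  rw [Finset.sum_eq_single j (fun k _ hk => by rw [Pi.single_eq_of_ne hk, map_zero])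
    fun h => absurd (Finset.mem_univ j) h, Pi.single_eq_same, formMap_tmul]

theorem totalSection_single [DecidableEq (Fin ξ.m)] (j : Fin ξ.m) (a : 𝔞)
    (w : PlaneForm (ξ.image j)) :
    (totalSection ξ T (Pi.single j (a ⊗ₜ w))).1 = tensorSection T (ξ.coord j) a w.1 := by
  simp only [totalSection, LinearMap.sum_apply, LinearMap.comp_apply, LinearMap.proj_apply]
  rw [Finset.sum_eq_single j (fun k _ hk => by rw [Pi.single_eq_of_ne hk, map_zero])
    fun h => absurd (Finset.mem_univ j) h, Pi.single_eq_same, sectionMap_tmul]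

theorem CompactSuppIn.eq_zero_of_notMem {E : X → Type u} [∀ x, Zero (E x)] {s : ∀ x, E x}
    (hs : CompactSuppIn V s) {x : X} (hx : x ∉ V) : s x = 0 := by
  by_contra h
  exact hx (hs.2 (subset_closure h))

section Bijective

variable [FiniteDimensional ℂ 𝔞]

theorem totalSection_injective : Function.Injective (totalSection ξ T) := by
  rw [injective_iff_map_eq_zero]
  intro t ht
  funext j
  refine eq_zero_of_sectionMap_eq_zero T (ξ.coord j) (ξ.source_subset j) fun x hx => ?_
  rw [← totalSection_of_mem ξ T t hx, ht]
  rfl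

/-- Evaluating a form on the vector `1` gives its coefficient section up to the nonzero factor `conj
(ξ'(x))`. -/
theorem totalForm_injective : Function.Injective (totalForm ξ T) := by
  rw [injective_iff_map_eq_zero]
  intro t ht
  funext j
  refine eq_zero_of_sectionMap_eq_zero T (ξ.coord j) (ξ.source_subset j) fun x hx => ?_
  have h := totalForm_of_mem ξ T t hx 1
  rw [ht] at h
  exact (smul_eq_zero.1 h.symm).resolve_left
    ((map_ne_zero _).2 ((ξ.coord j).coordDeriv_ne_zero hx))

theorem totalSection_surjective : Function.Surjective (totalSection ξ T) := by
  intro s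
  have h : ∀ j, ∃ t : 𝔞 ⊗[ℂ] PlaneForm (ξ.image j), ∀ x ∈ (ξ.coord j).chart.source,
      (sectionMap T (ξ.coord j) (ξ.source_subset j) t).1 x = s.1 x := by
    intro j
    refine exists_sectionMap_eq T (ξ.coord j) (ξ.source_subset j)
      (fun x hx => ((ξ.coord j).contMDiffAt_iff hx).1 (s.2.1 x))
      (ξ.isCompact_inter s.2.2.1 s.2.2.2 j) inter_subset_right fun x hx hxK => ?_
    by_contra hne
    exact hxK ⟨subset_closure hne, hx⟩
  choose t ht using h
  refine ⟨t, Subtype.ext (funext fun x => ?_)⟩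
  by_cases hx : x ∈ V
  · obtain ⟨j, hj⟩ := ξ.exists_mem hx
    rw [totalSection_of_mem ξ T t hj, ht j x hj]
  · rw [s.2.2.eq_zero_of_notMem hx, (totalSection ξ T t).2.2.eq_zero_of_notMem hx]

/-- An antilinear map on `ℂ` is determined by one value. The vector used here is the one on which
`dξ_j` equals `1`, so its value is the coefficient of `dξ̄_j`. -/
theorem form_apply_eq (s : Form01 L) {j : Fin ξ.m} {x : X} (hx : x ∈ (ξ.coord j).chart.source)
    (v : ℂ) : s x v = conj (coordDeriv (ξ.coord j).chart x v) •
      s x (coordDeriv (ξ.coord j).chart x 1)⁻¹ := by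
  have h0 := (ξ.coord j).coordDeriv_ne_zero hx
  rw [← LinearMap.map_smulₛₗ, smul_eq_mul, coordDeriv_apply, mul_assoc, mul_inv_cancel₀ h0, mul_one]

theorem totalForm_surjective : Function.Surjective (totalForm ξ T) := by
  intro s
  have h : ∀ j, ∃ t : 𝔞 ⊗[ℂ] PlaneForm (ξ.image j), ∀ x ∈ (ξ.coord j).chart.source,
      (sectionMap T (ξ.coord j) (ξ.source_subset j) t).1 x =
        s.1 x (coordDeriv (ξ.coord j).chart x 1)⁻¹ := by
    intro j
    refine exists_sectionMap_eq T (ξ.coord j) (ξ.source_subset j)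
      (σ := fun x => s.1 x (coordDeriv (ξ.coord j).chart x 1)⁻¹) (fun x₀ hx₀ => ?_)
      (ξ.isCompact_inter s.2.2.1 s.2.2.2 j) inter_subset_right fun x hx hxK => ?_
    · obtain ⟨c, hc, hcs⟩ := s.2.1 x₀
      set η := holChartAt x₀ with hη
      have hx₀' : x₀ ∈ η.chart.source := mem_chart_source ℂ x₀
      -- Smoothness of `s` is known as `s = c dη̄` in the preferred chart. On the vector dual to
      -- `dξ_j` this becomes `conj (dη/dξ_j) c`, a product of smooth functions.
      have h1 := coordChange_deriv_contDiffAt η (ξ.coord j) hx₀' hx₀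
      have h2 := ((ξ.coord j).contMDiffAt_iff hx₀).1 hc
      refine (h1.smul h2).congr_of_eventuallyEq ?_
      have hev := (((ξ.coord j).eventually_mem hx₀).and
        (hcs.and (eventually_coordDeriv_eq η (ξ.coord j) hx₀' hx₀)))
      filter_upwards [((ξ.coord j).tendsto_symm hx₀).eventually hev,
        (ξ.coord j).chart.open_target.mem_nhds ((ξ.coord j).chart.map_source hx₀)]
        with z hz hzt
      obtain ⟨hz1, hz2, hz3⟩ := hz
      have h0 := (ξ.coord j).coordDeriv_ne_zero hz1
      have hz3' := hz3 (coordDeriv (ξ.coord j).chart ((ξ.coord j).chart.symm z) 1)⁻¹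
      rw [coordDeriv_apply (ξ.coord j).chart _ (_)⁻¹, inv_mul_cancel₀ h0, mul_one,
        (ξ.coord j).chart.right_inv hzt] at hz3'
      change (trivializationAt F L x₀).linearMapAt ℂ _ (s.1 _ _) = _
      rw [hz2]
      change conj (coordDeriv η.chart _ _) • _ = _
      rw [hz3']
      rfl
    · by_contra hne
      refine hxK ⟨subset_closure fun h0 => hne ?_, hx⟩
      rw [h0]
      rfl
  choose t ht using h
  refine ⟨t, Subtype.ext (funext fun x => LinearMap.ext fun v => ?_)⟩
  by_cases hx : x ∈ V
  · obtain ⟨j, hj⟩ := ξ.exists_mem hx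
    rw [totalForm_of_mem ξ T t hj, ht j x hj, ← form_apply_eq ξ s.1 hj]
  · rw [s.2.2.eq_zero_of_notMem hx, (totalForm ξ T t).2.2.eq_zero_of_notMem hx]

/-- Sections over `V` in terms of tensors on the images of the coordinates. -/
def sectionEquiv : (∀ j, 𝔞 ⊗[ℂ] PlaneForm (ξ.image j)) ≃ₗ[ℂ] Omega0 F L V :=
  LinearEquiv.ofBijective (totalSection ξ T)
    ⟨totalSection_injective ξ T, totalSection_surjective ξ T⟩

/-- Forms over `V` in terms of tensors on the images of the coordinates. -/
def formEquiv : (∀ j, 𝔞 ⊗[ℂ] PlaneForm (ξ.image j)) ≃ₗ[ℂ] Omega1 F L V :=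
  LinearEquiv.ofBijective (totalForm ξ T) ⟨totalForm_injective ξ T, totalForm_surjective ξ T⟩

end Bijective

variable (𝔞) in
/-- The componentwise map `id ⊗ f_j` on a product of tensor products. -/
def tensorPi {ι : Type*} {N N' : ι → Type*} [∀ j, AddCommGroup (N j)] [∀ j, Module ℂ (N j)]
    [∀ j, AddCommGroup (N' j)] [∀ j, Module ℂ (N' j)] (f : ∀ j, N j →ₗ[ℂ] N' j) :
    (∀ j, 𝔞 ⊗[ℂ] N j) →ₗ[ℂ] ∀ j, 𝔞 ⊗[ℂ] N' j :=
  LinearMap.pi fun j => ((f j).lTensor 𝔞).comp (LinearMap.proj j)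

theorem tensorPi_apply {ι : Type*} {N N' : ι → Type*} [∀ j, AddCommGroup (N j)]
    [∀ j, Module ℂ (N j)] [∀ j, AddCommGroup (N' j)] [∀ j, Module ℂ (N' j)]
    (f : ∀ j, N j →ₗ[ℂ] N' j) (t : ∀ j, 𝔞 ⊗[ℂ] N j) (j : ι) :
    tensorPi 𝔞 f t j = (f j).lTensor 𝔞 (t j) := rfl

theorem tensorPi_single {ι : Type*} [DecidableEq ι] {N N' : ι → Type*} [∀ j, AddCommGroup (N j)]
    [∀ j, Module ℂ (N j)] [∀ j, AddCommGroup (N' j)] [∀ j, Module ℂ (N' j)]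
    (f : ∀ j, N j →ₗ[ℂ] N' j) (j : ι) (a : 𝔞) (n : N j) :
    tensorPi 𝔞 f (Pi.single j (a ⊗ₜ n)) = Pi.single j (a ⊗ₜ f j n) := by
  funext k
  rw [tensorPi_apply]
  by_cases hk : k = j
  · subst hk
    rw [Pi.single_eq_same, Pi.single_eq_same, LinearMap.lTensor_tmul]
  · rw [Pi.single_eq_of_ne hk, Pi.single_eq_of_ne hk, map_zero]

theorem dbar_sectionMap [ContMDiffVectorBundle ω F L 𝓘(ℂ, ℂ)] (η : HolCoord X)
    (hη : η.chart.source ⊆ V) (t : 𝔞 ⊗[ℂ] PlaneForm η.chart.target) :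
    dbar F L V (sectionMap T η hη t) =
      formMap T η hη ((planeDbarMap η.chart.target).lTensor 𝔞 t) := by
  induction t using TensorProduct.induction_on with
  | zero => simp only [map_zero]
  | tmul a g =>
    apply Subtype.ext
    rw [LinearMap.lTensor_tmul, formMap_tmul]
    exact dbarSection_tensorSection T η a g.2
  | add s t hs ht => simp only [map_add, hs, ht]

theorem dbar_totalSection [ContMDiffVectorBundle ω F L 𝓘(ℂ, ℂ)] :
    dbar F L V (totalSection ξ T t) =
      totalForm ξ T (tensorPi 𝔞 (fun j => planeDbarMap (ξ.image j)) t) := by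
  simp only [totalSection, totalForm, LinearMap.sum_apply, LinearMap.comp_apply,
    LinearMap.proj_apply, map_sum, dbar_sectionMap]
  rfl

end Global

end CFT

end
noncomputable section

namespace CFT

/-! ## Strong deformation retracts of two-term complexes -/

section TwoTermMaps

variable {A B A' B' : Type u} [AddCommGroup A] [Module ℂ A] [AddCommGroup B] [Module ℂ B]
  [AddCommGroup A'] [Module ℂ A'] [AddCommGroup B'] [Module ℂ B']

/-- The components of the map of two-term complexes given by `f₀` and `f₁`. -/
def twoTermF (f₀ : A →ₗ[ℂ] A') (f₁ : B →ₗ[ℂ] B') : ∀ n : ℤ, twoTermX A B n ⟶ twoTermX A' B' n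
  | .ofNat 0 => ModuleCat.ofHom f₀
  | .ofNat 1 => ModuleCat.ofHom f₁
  | .ofNat (_ + 2) => 0
  | .negSucc _ => 0

/-- The map of two-term complexes given by `f₀` and `f₁`. -/
def twoTermMap {d : A →ₗ[ℂ] B} {d' : A' →ₗ[ℂ] B'} (f₀ : A →ₗ[ℂ] A') (f₁ : B →ₗ[ℂ] B')
    (h : d'.comp f₀ = f₁.comp d) : twoTerm d ⟶ twoTerm d' where
  f := twoTermF f₀ f₁
  comm' m n _ := by
    change twoTermF f₀ f₁ m ≫ twoTermD d' m n = twoTermD d m n ≫ twoTermF f₀ f₁ n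
    by_cases hmn : m = 0 ∧ n = 1
    · obtain ⟨rfl, rfl⟩ := hmn
      exact congrArg ModuleCat.ofHom h
    · rw [twoTermD_eq_zero d m n hmn, twoTermD_eq_zero d' m n hmn, Limits.comp_zero,
        Limits.zero_comp]

/-- The degree `-1` map given by `h`. -/
def twoTermH (h : B →ₗ[ℂ] A) : ∀ m n : ℤ, twoTermX A B m ⟶ twoTermX A B n
  | .ofNat 1, .ofNat 0 => ModuleCat.ofHom h
  | _, _ => 0

theorem twoTermH_eq_zero (h : B →ₗ[ℂ] A) (m n : ℤ) (hmn : ¬(m = 1 ∧ n = 0)) :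
    twoTermH h m n = 0 := by
  rcases m with (_ | _ | m) | m
  · rfl
  · rcases n with (_ | n) | n
    · exact absurd ⟨rfl, rfl⟩ hmn
    · rfl
    · rfl
  · rfl
  · rfl

theorem isZero_twoTermX {n : ℤ} (h0 : n ≠ 0) (h1 : n ≠ 1) : Limits.IsZero (twoTermX A B n) := by
  have : Limits.IsZero (ModuleCat.of ℂ PUnit.{u + 1}) :=
    ModuleCat.isZero_of_subsingleton (ModuleCat.of ℂ PUnit.{u + 1})
  rcases n with (_ | _ | n) | n
  · exact absurd rfl h0
  · exact absurd rfl h1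
  · exact this
  · exact this

variable {G : Type u} [AddCommGroup G] [Module ℂ G]

/-- Only degrees `0` and `1` matter. The retract is zero in degree `0`, which leaves `h d = id`
there; in degree `1` the identity is `d h = id - i p`. -/
theorem twoTerm_homotopy {d : A →ₗ[ℂ] B} {i : G →ₗ[ℂ] B} {p : B →ₗ[ℂ] G} {h : B →ₗ[ℂ] A}
    (hip : d.comp h = LinearMap.id - i.comp p) (hhd : h.comp d = LinearMap.id) (n : ℤ) :
    twoTermF (0 : A →ₗ[ℂ] PUnit.{u + 1}) p n ≫ twoTermF 0 i n - 𝟙 (twoTermX A B n) =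
      -(twoTermH h n (n - 1) ≫ twoTermD d (n - 1) n +
        twoTermD d n (n + 1) ≫ twoTermH h (n + 1) n) := by
  by_cases h0 : n = 0
  · subst h0
    have hz : twoTermF (0 : A →ₗ[ℂ] PUnit.{u + 1}) p 0 = 0 := rfl
    rw [twoTermH_eq_zero h 0 (0 - 1) (by simp), Limits.zero_comp, zero_add, hz, Limits.zero_comp,
      zero_sub]
    exact congrArg (fun f : A →ₗ[ℂ] A => -ModuleCat.ofHom f) hhd.symm
  by_cases h1 : n = 1
  · subst h1
    rw [twoTermD_eq_zero d 1 (1 + 1) (by simp), Limits.zero_comp, add_zero]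
    have hlin : i.comp p - LinearMap.id = -d.comp h := by
      rw [hip]
      abel
    exact congrArg (fun f : B →ₗ[ℂ] B => ModuleCat.ofHom f) hlin
  · exact (isZero_twoTermX h0 h1).eq_of_src _ _

theorem twoTermH_comp_twoTermH (h : B →ₗ[ℂ] A) (l m n : ℤ) :
    twoTermH h l m ≫ twoTermH h m n = 0 := by
  by_cases hlm : l = 1 ∧ m = 0
  · rw [twoTermH_eq_zero h m n fun h => by omega, Limits.comp_zero]
  · rw [twoTermH_eq_zero h l m hlm, Limits.zero_comp]

/-- A strong deformation retract of a two-term complex onto its cohomology in degree `1`. -/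
def twoTermRetract {d : A →ₗ[ℂ] B} (i : G →ₗ[ℂ] B) (p : B →ₗ[ℂ] G) (h : B →ₗ[ℂ] A)
    (hpi : p.comp i = LinearMap.id) (hpd : p.comp d = 0)
    (hip : d.comp h = LinearMap.id - i.comp p) (hhd : h.comp d = LinearMap.id)
    (hhi : h.comp i = 0) (uG : ℂ →ₗ[ℂ] G) (uB : ℂ →ₗ[ℂ] B) (hiu : i.comp uG = uB)
    (hpu : p.comp uB = uG) :
    StrongDeformationRetract
      ⟨twoTerm (A := PUnit.{u + 1}) (B := G) 0, uG, fun _ => rfl⟩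
      ⟨twoTerm d, uB, fun _ => rfl⟩ where
  i := ⟨twoTermMap 0 i (by simp), fun c => LinearMap.congr_fun hiu c⟩
  p := ⟨twoTermMap 0 p (by simp [hpd]), fun c => LinearMap.congr_fun hpu c⟩
  h := twoTermH h
  h_degree m n hmn := twoTermH_eq_zero h m n fun h => hmn (by omega)
  p_i := by
    ext1 n
    by_cases h1 : n = 1
    · subst h1
      exact congrArg ModuleCat.ofHom hpi
    · refine Limits.IsZero.eq_of_src (X := twoTermX PUnit.{u + 1} G n) ?_ _ _
      by_cases h0 : n = 0
      · subst h0
        exact ModuleCat.isZero_of_subsingleton (ModuleCat.of ℂ PUnit.{u + 1})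
      · exact isZero_twoTermX h0 h1
  homotopy n := twoTerm_homotopy hip hhd n
  p_h m n := by
    change twoTermH h m n ≫ twoTermF 0 p n = 0
    by_cases hmn : m = 1 ∧ n = 0
    · obtain ⟨rfl, rfl⟩ := hmn
      -- The map `h` lands in degree `0`, where the projection is zero.
      exact Limits.comp_zero
    · rw [twoTermH_eq_zero h m n hmn, Limits.zero_comp]
  h_i m n := by
    change twoTermF 0 i m ≫ twoTermH h m n = 0
    by_cases hmn : m = 1 ∧ n = 0
    · obtain ⟨rfl, rfl⟩ := hmn
      exact congrArg ModuleCat.ofHom hhi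
    · rw [twoTermH_eq_zero h m n hmn, Limits.comp_zero]
  h_h := twoTermH_comp_twoTermH h

end TwoTermMaps

/-! ### Cohomology of a strong deformation retract -/

section RetractHomology

variable {A B : PointedComplex.{u}}

/-- A strong deformation retract is a homotopy equivalence. -/
def StrongDeformationRetract.homotopyEquiv (S : StrongDeformationRetract A B) :
    HomotopyEquiv B.cx A.cx where
  hom := S.p.map
  inv := S.i.map
  homotopyHomInvId :=
    -- A homotopy expresses `i p` as `d h' + h' d + id`. The retract has the opposite sign, whence
    -- `h' = -h`.
    { hom := fun m n => -S.h m n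
      zero := fun m n hmn => by
        rw [S.h_degree m n hmn, neg_zero]
      comm := fun n => by
        have h := S.homotopy n
        rw [dNext_eq (c := ComplexShape.up ℤ) _ (i' := n + 1) rfl,
          prevD_eq (c := ComplexShape.up ℤ) _ (j' := n - 1) (by simp),
          Preadditive.comp_neg, Preadditive.neg_comp, HomologicalComplex.id_f,
          sub_eq_iff_eq_add.1 h]
        abel }
  homotopyInvHomId := Homotopy.ofEq S.p_i

theorem StrongDeformationRetract.isZero_homology (S : StrongDeformationRetract A B) {n : ℤ} (h : Limits.IsZero (A.cx.X n)) :
    Limits.IsZero (B.cx.homology n) := by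
  refine Limits.IsZero.of_iso ?_ (S.homotopyEquiv.toHomologyIso n)
  exact (A.cx.exactAt_iff_isZero_homology n).1
    (ShortComplex.exact_of_isZero_X₂ _ h)

/-- Both differentials of `A` at degree `n` vanish, so its cycles and its cohomology there are the
whole of `A.cx.X n`. Naturality shows that the resulting isomorphism is induced by `p` on cycles. -/
theorem StrongDeformationRetract.exists_homologyIso (S : StrongDeformationRetract A B) (n : ℤ)
    (h : A.cx.d (n - 1) n = 0)
    (h' : A.cx.d n (n + 1) = 0) :
    ∃ Φ : B.cx.homology n ≅ A.cx.X n,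
      B.cx.homologyπ n ≫ Φ.hom = B.cx.iCycles n ≫ S.p.map.f n := by
  have := A.cx.isIso_homologyπ (n - 1) n (by simp) h
  have := A.cx.isIso_iCycles n (n + 1) (by simp) h'
  refine ⟨(S.homotopyEquiv.toHomologyIso n).trans
    ((asIso (A.cx.homologyπ n)).symm.trans (asIso (A.cx.iCycles n))), ?_⟩
  change B.cx.homologyπ n ≫ HomologicalComplex.homologyMap S.p.map n ≫
    inv (A.cx.homologyπ n) ≫ A.cx.iCycles n = _
  rw [HomologicalComplex.homologyπ_naturality_assoc, IsIso.hom_inv_id_assoc,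
    HomologicalComplex.cyclesMap_i]

end RetractHomology

end CFT

end
noncomputable section

namespace CFT

set_option linter.unusedSectionVars false

/-! ## The strong deformation retract of the twisted complex -/

section MainRetract

theorem tensorPi_tensorPi {𝔞 : Type*} [AddCommGroup 𝔞] [Module ℂ 𝔞] {ι : Type*}
    {N N' N'' : ι → Type*} [∀ j, AddCommGroup (N j)] [∀ j, Module ℂ (N j)]
    [∀ j, AddCommGroup (N' j)] [∀ j, Module ℂ (N' j)] [∀ j, AddCommGroup (N'' j)]
    [∀ j, Module ℂ (N'' j)] (f : ∀ j, N' j →ₗ[ℂ] N'' j) (g : ∀ j, N j →ₗ[ℂ] N' j)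
    (t : ∀ j, 𝔞 ⊗[ℂ] N j) :
    tensorPi 𝔞 f (tensorPi 𝔞 g t) = tensorPi 𝔞 (fun j => (f j).comp (g j)) t := by
  funext j
  simp only [tensorPi_apply, LinearMap.lTensor_comp, LinearMap.comp_apply]

theorem tensorPi_id {𝔞 : Type*} [AddCommGroup 𝔞] [Module ℂ 𝔞] {ι : Type*} {N : ι → Type*}
    [∀ j, AddCommGroup (N j)] [∀ j, Module ℂ (N j)] (t : ∀ j, 𝔞 ⊗[ℂ] N j) :
    tensorPi 𝔞 (fun j => (LinearMap.id : N j →ₗ[ℂ] N j)) t = t := by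
  funext j
  simp [tensorPi_apply]

theorem tensorPi_zero {𝔞 : Type*} [AddCommGroup 𝔞] [Module ℂ 𝔞] {ι : Type*} {N N' : ι → Type*}
    [∀ j, AddCommGroup (N j)] [∀ j, Module ℂ (N j)] [∀ j, AddCommGroup (N' j)]
    [∀ j, Module ℂ (N' j)] (t : ∀ j, 𝔞 ⊗[ℂ] N j) :
    tensorPi 𝔞 (fun j => (0 : N j →ₗ[ℂ] N' j)) t = 0 := by
  funext j
  simp [tensorPi_apply]

variable {F : Type u} [NormedAddCommGroup F] [NormedSpace ℂ F]
  {X : Type u} [TopologicalSpace X] [ChartedSpace ℂ X] [IsManifold 𝓘(ℂ, ℂ) ω X] [T2Space X]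
  {L : X → Type u} [TopologicalSpace (TotalSpace F L)] [∀ x, AddCommGroup (L x)]
  [∀ x, Module ℂ (L x)] [∀ x, TopologicalSpace (L x)] [FiberBundle F L] [VectorBundle ℂ F L]
  [ContMDiffVectorBundle ω F L 𝓘(ℂ, ℂ)]
  {𝔞 : Type u} [AddCommGroup 𝔞] [Module ℂ 𝔞] [FiniteDimensional ℂ 𝔞]
  (T : CoordTrivialization F L 𝔞) {V : Set X} (ξ : BoundedCoords V)
  (c : ∀ j, LiftChoice (ξ.image j))

/-- The inclusion of germs into forms. -/
def inclusionMap : GermSpace 𝔞 ξ →ₗ[ℂ] Omega1 F L V × ℂ :=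
  ((formEquiv ξ T).toLinearMap.comp (tensorPi 𝔞 fun j => (c j).lift)).prodMap LinearMap.id

/-- The projection of forms onto germs. -/
def projectionMap : Omega1 F L V × ℂ →ₗ[ℂ] GermSpace 𝔞 ξ :=
  ((tensorPi 𝔞 fun j => down (ξ.image j)).comp (formEquiv ξ T).symm.toLinearMap).prodMap
    LinearMap.id

/-- The contracting homotopy from forms to sections. -/
def contractionMap : Omega1 F L V × ℂ →ₗ[ℂ] Omega0 F L V :=
  ((sectionEquiv ξ T).toLinearMap.comp ((tensorPi 𝔞 fun j => (c j).contraction).comp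
    (formEquiv ξ T).symm.toLinearMap)).comp (LinearMap.fst ℂ _ ℂ)

theorem inclusionMap_apply (t : ∀ j, 𝔞 ⊗[ℂ] OInfty (ξ.image j)) (z : ℂ) :
    inclusionMap T ξ c (t, z) = (formEquiv ξ T (tensorPi 𝔞 (fun j => (c j).lift) t), z) := rfl

theorem projectionMap_apply (t : ∀ j, 𝔞 ⊗[ℂ] PlaneForm (ξ.image j)) (z : ℂ) :
    projectionMap T ξ (formEquiv ξ T t, z) =
      (tensorPi 𝔞 (fun j => down (ξ.image j)) t, z) := by
  change (tensorPi 𝔞 (fun j => down (ξ.image j)) ((formEquiv ξ T).symm (formEquiv ξ T t)), z) = _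
  rw [LinearEquiv.symm_apply_apply]

theorem contractionMap_apply (t : ∀ j, 𝔞 ⊗[ℂ] PlaneForm (ξ.image j)) (z : ℂ) :
    contractionMap T ξ c (formEquiv ξ T t, z) =
      sectionEquiv ξ T (tensorPi 𝔞 (fun j => (c j).contraction) t) := by
  change sectionEquiv ξ T (tensorPi 𝔞 (fun j => (c j).contraction)
    ((formEquiv ξ T).symm (formEquiv ξ T t))) = _
  rw [LinearEquiv.symm_apply_apply]

theorem dbar_sectionEquiv (t : ∀ j, 𝔞 ⊗[ℂ] PlaneForm (ξ.image j)) :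
    dbar F L V (sectionEquiv ξ T t) =
      formEquiv ξ T (tensorPi 𝔞 (fun j => planeDbarMap (ξ.image j)) t) :=
  dbar_totalSection ξ T t

/-- `IsProjection` and `IsContraction` speak of a form that equals a pure tensor; this rewrites it
as the image of that tensor, on which the maps are computed componentwise. -/
theorem eq_formEquiv_single {j : Fin ξ.m} {a : 𝔞} {w : PlaneForm (ξ.image j)}
    {s : Omega1 F L V} (hs : s.1 = tensorForm T (ξ.coord j) a w.1) :
    s = formEquiv ξ T (Pi.single j (a ⊗ₜ w)) :=
  Subtype.ext (hs.trans (totalForm_single ξ T j a w).symm)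

/-- The strong deformation retract given by `inclusionMap`, `projectionMap` and
`contractionMap`. -/
def germRetract {b : DGLieBracket F L} (α : TwoCocycle b) :
    StrongDeformationRetract (germComplex 𝔞 ξ) (twistedComplex α V) :=
  twoTermRetract (d := (LinearMap.inl ℂ (Omega1 F L V) ℂ).comp (dbar F L V))
    (inclusionMap T ξ c) (projectionMap T ξ) (contractionMap T ξ c)
    (by
      refine LinearMap.ext fun ⟨t, z⟩ => ?_
      rw [LinearMap.comp_apply, inclusionMap_apply, projectionMap_apply, tensorPi_tensorPi]
      simp only [show ∀ j, (down (ξ.image j)).comp (c j).lift = LinearMap.id from fun j =>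
        LinearMap.ext fun f => (c j).down_lift f, tensorPi_id]
      rfl)
    (by
      refine LinearMap.ext fun s => ?_
      -- Once the section is written as a tensor, `∂̄` and the projection act componentwise, and the
      -- claim reduces to the planar identity `down_planeDbarMap`. The other relations are reduced
      -- to the plane in the same manner.
      obtain ⟨t, rfl⟩ := (sectionEquiv ξ T).surjective s
      rw [LinearMap.comp_apply, LinearMap.comp_apply, LinearMap.inl_apply, dbar_sectionEquiv,
        projectionMap_apply, tensorPi_tensorPi]
      simp only [show ∀ j, (down (ξ.image j)).comp (planeDbarMap (ξ.image j)) = 0 from fun j =>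
        LinearMap.ext fun f => down_planeDbarMap f, tensorPi_zero]
      rfl)
    (by
      refine LinearMap.ext fun ⟨s, z⟩ => ?_
      obtain ⟨t, rfl⟩ := (formEquiv ξ T).surjective s
      rw [LinearMap.comp_apply, LinearMap.comp_apply, LinearMap.inl_apply, contractionMap_apply,
        dbar_sectionEquiv, LinearMap.sub_apply, LinearMap.comp_apply, projectionMap_apply,
        inclusionMap_apply, LinearMap.id_apply, tensorPi_tensorPi, tensorPi_tensorPi,
        Prod.mk_sub_mk, sub_self, ← map_sub]
      congr 2
      funext j
      rw [Pi.sub_apply, tensorPi_apply, tensorPi_apply]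
      have h : (planeDbarMap (ξ.image j)).comp (c j).contraction =
          LinearMap.id - ((c j).lift).comp (down (ξ.image j)) :=
        LinearMap.ext fun w => (c j).planeDbarMap_contraction w
      rw [h, LinearMap.lTensor_sub, LinearMap.sub_apply, LinearMap.lTensor_id, LinearMap.id_apply])
    (by
      refine LinearMap.ext fun s => ?_
      obtain ⟨t, rfl⟩ := (sectionEquiv ξ T).surjective s
      rw [LinearMap.comp_apply, LinearMap.comp_apply, LinearMap.inl_apply, dbar_sectionEquiv,
        contractionMap_apply, tensorPi_tensorPi]
      simp only [show ∀ j, ((c j).contraction).comp (planeDbarMap (ξ.image j)) = LinearMap.id from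
        fun j => LinearMap.ext fun f => (c j).contraction_planeDbarMap f, tensorPi_id]
      rfl)
    (by
      refine LinearMap.ext fun ⟨t, z⟩ => ?_
      rw [LinearMap.comp_apply, inclusionMap_apply, contractionMap_apply, tensorPi_tensorPi]
      simp only [show ∀ j, ((c j).contraction).comp (c j).lift = 0 from fun j =>
        LinearMap.ext fun f => (c j).contraction_lift f, tensorPi_zero, map_zero]
      rfl)
    (LinearMap.inr ℂ _ ℂ) (LinearMap.inr ℂ _ ℂ)
    (LinearMap.ext fun z => by
      rw [LinearMap.comp_apply, LinearMap.inr_apply, inclusionMap_apply, map_zero, map_zero]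
      rfl)
    (LinearMap.ext fun z => by
      rw [LinearMap.comp_apply, LinearMap.inr_apply, ← map_zero (formEquiv ξ T),
        projectionMap_apply, map_zero]
      rfl)

variable {b : DGLieBracket F L} (α : TwoCocycle b)

theorem isInclusion_germRetract : IsInclusion T ξ c (germRetract T ξ c α).i := by
  refine ⟨fun j a f => ?_, fun z => ?_⟩
  · change (inclusionMap T ξ c (Pi.single j (a ⊗ₜ f), 0)).1.1 = _ ∧
      (inclusionMap T ξ c (Pi.single j (a ⊗ₜ f), 0)).2 = 0
    rw [inclusionMap_apply, tensorPi_single]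
    exact ⟨totalForm_single ξ T j a _, rfl⟩
  · change inclusionMap T ξ c (0, z) = (0, z)
    rw [inclusionMap_apply, map_zero, map_zero]

theorem isProjection_germRetract : IsProjection T ξ (germRetract T ξ c α).p := by
  refine ⟨fun j a w s hs => ⟨down _ w, isDownGerm_down w, ?_⟩, fun z => ?_⟩
  · change projectionMap T ξ (s, 0) = _
    rw [eq_formEquiv_single T ξ hs, projectionMap_apply, tensorPi_single]
  · change projectionMap T ξ (0, z) = (0, z)
    rw [← map_zero (formEquiv ξ T), projectionMap_apply, map_zero]

theorem isContraction_germRetract : IsContraction T ξ c (germRetract T ξ c α).h := by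
  refine ⟨fun j a w s hs => ⟨down _ w, isDownGerm_down w, ?_⟩, fun z => ?_⟩
  · change (contractionMap T ξ c (s, 0)).1 = _
    rw [eq_formEquiv_single T ξ hs, contractionMap_apply, tensorPi_single]
    exact totalSection_single ξ T j a _
  · change contractionMap T ξ c (0, z) = 0
    rw [← map_zero (formEquiv ξ T), contractionMap_apply, map_zero, map_zero]

end MainRetract

end CFT

end

/-! ### The strong deformation retract for the orientation double -/

open CFT in
theorem mainTheorem5
    -- the conformal surface
    {M : Type u} [TopologicalSpace M] [T2Space M] [SecondCountableTopology M] [ConnectedSpace M]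
    [ChartedSpace HalfPlane M] [HasGroupoid M conformalGroupoid]
    -- the holomorphic vector bundle over the double, with its Lie bracket and cocycle
    {F : Type u} [NormedAddCommGroup F] [NormedSpace ℂ F] [FiniteDimensional ℂ F]
    {L : Double M → Type u} [TopologicalSpace (TotalSpace F L)] [∀ x, AddCommGroup (L x)]
    [∀ x, Module ℂ (L x)] [∀ x, TopologicalSpace (L x)] [FiberBundle F L] [VectorBundle ℂ F L]
    [ContMDiffVectorBundle ω F L 𝓘(ℂ, ℂ)]
    {b : DGLieBracket F L} (α : TwoCocycle b)
    {𝔞 : Type u} [AddCommGroup 𝔞] [Module ℂ 𝔞] (T : CoordTrivialization F L 𝔞)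
    -- the open subset with its coordinates, and the choices made in `⌈·⌉`
    (U : Set M) (hU : IsOpen U) (hUconn : _root_.IsConnected U) (hUint : U ⊆ surfaceInterior M)
    (ξ : BoundedCoords (Double.proj ⁻¹' U : Set (Double M)))
    (c : ∀ j, LiftChoice (ξ.image j)) :
    ∃ S : StrongDeformationRetract (germComplex 𝔞 ξ) (pushforwardComplex α U),
      IsInclusion T ξ c S.i ∧ IsProjection T ξ S.p ∧ IsContraction T ξ c S.h ∧
      Limits.IsZero ((pushforwardComplex α U).cx.homology 0) ∧
      ∃ Φ : (pushforwardComplex α U).cx.homology 1 ≅ ModuleCat.of ℂ (GermSpace 𝔞 ξ),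
        (pushforwardComplex α U).cx.homologyπ 1 ≫ Φ.hom =
          (pushforwardComplex α U).cx.iCycles 1 ≫ S.p.map.f 1 := by
  -- There is at least one coordinate domain, and its fibre space `𝔞_ξ` transfers finite dimension
  -- to `𝔞`.
  have j : Fin ξ.m := ⟨0, by have := ξ.m_eq; omega⟩
  have : FiniteDimensional ℂ 𝔞 := (T.iso (ξ.coord j)).symm.finiteDimensional
  refine ⟨germRetract T ξ c α, isInclusion_germRetract T ξ c α, isProjection_germRetract T ξ c α,
    isContraction_germRetract T ξ c α, ?_, ?_⟩
  · exact (germRetract T ξ c α).isZero_homology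
      (ModuleCat.isZero_of_subsingleton (ModuleCat.of ℂ PUnit.{u + 1}))
  -- The differentials of the germ complex are zero by definition, so its cohomology in degree `1`
  -- is the germ space itself.
  · exact (germRetract T ξ c α).exists_homologyIso 1 rfl rfl
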